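/- For a positive integer $n$ let $S_n$ be the group of permutations of $\{1,\dots,n\}$. For a real array $C=(c^{ij}_{kl})_{1\le i,j,k,l\le n}$ let $f:S_n\to\mathbb{R}$ be the objective function of the (generalized) Quadratic Assignment Problem, $$f(\sigma)=\sum_{i,j=1}^n c^{ij}_{\sigma(i)\sigma(j)}$$ (the case $c^{ij}_{kl}=a_{ij}b_{kl}$ is the usual Quadratic Assignment Problem with matrices $A=(a_{ij})$ and $B=(b_{kl})$). Let $\overline f=\frac1{n!}\sum_{\sigma\in S_n}f(\sigma)$, let $f_0=f-\overline f$, and let $\tau\in S_n$ be an optimal permutation, that is, $f_0(\tau)=\max_{\sigma\in S_n}f_0(\sigma)$. Let $\mathbf P$ be the uniform probability on $S_n$. (1) There is an absolute constant $c>0$ such that for every $\alpha>1$ there is an $N(\alpha)$ such that for all $n\ge N(\alpha)$, all arrays $C$ and all optimal $\tau$, $$\mathbf P\Bigl\{\sigma\in S_n:\ f_0(\sigma)\ge\frac{\alpha}{n^2}f_0(\tau)\Bigr\}\ \ge\ \delta n^{-2},\qquad \delta=\exp\{-c\,\alpha\ln\alpha\}.$$ (2) For every $\epsilon>0$ and every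 $\delta>0$ with $\delta>1-\epsilon$ there is an $N(\epsilon,\delta)$ such that for all $n\ge N(\epsilon,\delta)$, all arrays $C$ and all optimal $\tau$, $$\mathbf P\bigl\{\sigma\in S_n:\ f_0(\sigma)\ge n^{-1-\epsilon}f_0(\tau)\bigr\}\ \ge\ \exp\{-n^{\delta}\}.$$ In particular, for every $\epsilon>0$ this holds with some $\delta=\delta(\epsilon)<1$. -/

import Mathlib

noncomputable section

/-- The objective function `f(σ) = ∑_{i,j} c^{ij}_{σ(i)σ(j)}` of the (generalized) quadratic
assignment problem on `S_n`, where `C i j k l` stands for `c^{ij}_{kl}`. The choice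
`C i j k l = a i j * b k l` is the quadratic assignment problem given by two matrices. -/
def qapObjective {n : ℕ} (C : Fin n → Fin n → Fin n → Fin n → ℝ)
    (σ : Equiv.Perm (Fin n)) : ℝ :=
  ∑ i, ∑ j, C i j (σ i) (σ j)

/-- The average value of a real function on `S_n`. -/
def permAverage {n : ℕ} (f : Equiv.Perm (Fin n) → ℝ) : ℝ :=
  (∑ σ, f σ) / (n.factorial : ℝ)

/-- The shifted function `f₀ = f - average of f`. -/
def permShift {n : ℕ} (f : Equiv.Perm (Fin n) → ℝ) (σ : Equiv.Perm (Fin n)) : ℝ :=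
  f σ - permAverage f

/-- The probability that a uniformly random permutation in `S_n` belongs to `E`. -/
def permProb {n : ℕ} (E : Set (Equiv.Perm (Fin n))) : ℝ :=
  (E.ncard : ℝ) / (n.factorial : ℝ)

end

/-! After relabelling by `τ`, centring and scaling, `f` is quadratic with mean `0` and maximum `f 1
= 1`. Averaging over conjugation turns `f` into `x₀ + x₁ p + x₂ p(p-1) + x₃ q`, where `p` counts
fixed points and `q` points on two-cycles (`exists_conjSum_form`). Suppose few `σ` are good, meaning
`f σ ≥ s`. Since `f ≤ 1` has mean zero, `L = ∑ |f|` is small (`sum_abs_le`). This forces `x₀, x₁, x₂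
= O(L / n!)` (`HasConjForm.coef_bound`), and evaluation at the identity, where `p = n`, then gives
`x₂ ≥ 1 / (2n²)`. So `f` grows quadratically, on average, with the number of fixed points, while the
competing terms are linear.

Second claim, `ε < 1`: average `f` over conjugates of permutations fixing `k` points
(`fixing_inequality`). The gain is about `k² / (2n²)` and the loss `O(s k)`; for `s = n^(-1-ε)` the
gain wins once `k` is a large multiple of `n^(1-ε)`. These conjugates favour no permutation by more
than a factor of order `(k+3)^k`, so the good set has density at least about `s (k+3)^(-k)`, which
exceeds `exp(-n^δ)`. For `ε ≥ 1` the first claim suffices.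

First claim: every constant below `1` is obtained in place of `δ` (`exists_le_card_filter`). A
second difference of `f` along disjoint transpositions depends on only four values of `σ`, hence `f`
is nearly constant, in mean, on each coset `σ i = k, σ j = l` (`sum_abs_sub_cosetAvg_le`). If some
coset average exceeds a small constant `c`, almost the whole coset is good, and it has `(n-2)!`
elements. Otherwise boundedly many averages reach `c` in absolute value. Second differences are
nearly signed sums of sixteen coset averages (`abs_secDiff_sub_le`), so they are at most about `16c`
outside a small exceptional set. Now expand `f` at a permutation with `k` fixed points around the
one with those points destroyed, average over conjugates, and discard the good conjugates
(`averaged_inequality`). Discarding costs little because second differences are bounded above, so a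
gain of order `k² / n²` meets a loss `O(k / n²)`. A large constant `k` yields a contradiction. -/

namespace QAP

open Equiv Finset

variable {n : ℕ}

/-! ### Permutation matrices, rectangles and second differences -/

/-- The matrix unit at `(i, k)`. -/
def unitMat (i k : Fin n) : Fin n → Fin n → ℝ := fun x y => if x = i ∧ y = k then 1 else 0

/-- The permutation matrix of `σ`. -/
def permMat (σ : Perm (Fin n)) : Fin n → Fin n → ℝ := fun x y => if σ x = y then 1 else 0

/-- The rectangle with rows `p, x` and columns `k, w`. -/
def rect (p x k w : Fin n) : Fin n → Fin n → ℝ :=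
  unitMat p k + unitMat x w - unitMat p w - unitMat x k

/-- All four rectangles on the right share the corner `(x, w)`. This is what later lets one second
difference be read off from second differences at other permutations. -/
lemma rect_split (i a k₁ k₂ x w : Fin n) :
    rect i a k₁ k₂ = rect i x k₁ w - rect i x k₂ w - rect a x k₁ w + rect a x k₂ w := by
  unfold rect; abel

lemma permMat_mul_swap (σ : Perm (Fin n)) {i a : Fin n} (h : i ≠ a) :
    permMat (σ * swap i a) = permMat σ - rect i a (σ i) (σ a) := by
  funext x y
  simp only [permMat, rect, unitMat, Pi.sub_apply, Pi.add_apply, Perm.mul_apply]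
  by_cases hx : x = i
  · subst hx
    simp [h, eq_comm]
  · by_cases hx' : x = a
    · subst hx'
      simp [Ne.symm h, eq_comm]
    · simp [swap_apply_of_ne_of_ne hx hx', hx, hx']

/-- The bilinear form attached to an array. -/
def bil (C : Fin n → Fin n → Fin n → Fin n → ℝ) :
    (Fin n → Fin n → ℝ) →ₗ[ℝ] (Fin n → Fin n → ℝ) →ₗ[ℝ] ℝ :=
  LinearMap.mk₂ ℝ (fun M N => ∑ i, ∑ j, ∑ k, ∑ l, C i j k l * M i k * N j l)
    (by intro a b c; simp only [Pi.add_apply, mul_add, add_mul, sum_add_distrib])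
    (by intro c a b; simp only [Pi.smul_apply, smul_eq_mul, Finset.mul_sum, mul_left_comm, mul_assoc])
    (by intro a b c; simp only [Pi.add_apply, mul_add, sum_add_distrib])
    (by intro c a b; simp only [Pi.smul_apply, smul_eq_mul, Finset.mul_sum, mul_left_comm, mul_assoc])

lemma qapObjective_eq_bil (C : Fin n → Fin n → Fin n → Fin n → ℝ) (σ : Perm (Fin n)) :
    qapObjective C σ = bil C (permMat σ) (permMat σ) := by
  simp only [qapObjective, bil, LinearMap.mk₂_apply, permMat]
  refine Finset.sum_congr rfl fun i _ => Finset.sum_congr rfl fun j _ => ?_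
  simp

/-- The symmetrized bilinear form. -/
def bilSymm (C : Fin n → Fin n → Fin n → Fin n → ℝ) :
    (Fin n → Fin n → ℝ) →ₗ[ℝ] (Fin n → Fin n → ℝ) →ₗ[ℝ] ℝ :=
  bil C + (bil C).flip

/-- The second difference of `f` at `σ` along the transpositions `(i a)` and `(j b)`. -/
def secDiff (f : Perm (Fin n) → ℝ) (σ : Perm (Fin n)) (i a j b : Fin n) : ℝ :=
  f σ - f (σ * swap i a) - f (σ * swap j b) + f (σ * swap i a * swap j b)

/-- Each transposition subtracts a rectangle from the permutation matrix, and disjoint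
transpositions do not affect each other's rectangle, so only the mixed bilinear term survives. The
second difference therefore depends on `σ` only through four values. -/
lemma secDiff_eq (C : Fin n → Fin n → Fin n → Fin n → ℝ) (σ : Perm (Fin n)) {i a j b : Fin n}
    (hia : i ≠ a) (hjb : j ≠ b) (hij : i ≠ j) (hib : i ≠ b) (haj : a ≠ j) (hab : a ≠ b) :
    secDiff (qapObjective C) σ i a j b =
      bilSymm C (rect i a (σ i) (σ a)) (rect j b (σ j) (σ b)) := by
  have h1 : (σ * swap i a) j = σ j := by simp [swap_apply_of_ne_of_ne hij.symm haj.symm]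
  have h2 : (σ * swap i a) b = σ b := by simp [swap_apply_of_ne_of_ne hib.symm hab.symm]
  simp only [secDiff, qapObjective_eq_bil, bilSymm]
  rw [permMat_mul_swap (σ * swap i a) hjb, permMat_mul_swap σ hia, permMat_mul_swap σ hjb, h1, h2]
  simp only [map_sub, LinearMap.sub_apply, LinearMap.add_apply, LinearMap.flip_apply]
  ring

/-! ### Counting permutations with prescribed values -/

lemma exists_perm_of_injective {ι : Type*} {u v : ι → Fin n} (hu : Function.Injective u)
    (hv : Function.Injective v) : ∃ π : Perm (Fin n), ∀ r, π (u r) = v r := by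
  classical
  let e : {x // x ∈ Set.range u} ≃ {x // x ∈ Set.range v} :=
    (Equiv.ofInjective u hu).symm.trans (Equiv.ofInjective v hv)
  refine ⟨e.extendSubtype, fun r => ?_⟩
  rw [Equiv.extendSubtype_apply_of_mem e (u r) ⟨r, rfl⟩]
  have : (⟨u r, ⟨r, rfl⟩⟩ : {x // x ∈ Set.range u}) = Equiv.ofInjective u hu r := rfl
  simp only [e, Equiv.trans_apply, this, Equiv.symm_apply_apply]
  rfl

/-- The permutations that fix every point of `S`. -/
def fixing (S : Finset (Fin n)) : Finset (Perm (Fin n)) :=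
  univ.filter fun σ => ∀ x ∈ S, σ x = x

@[simp] lemma mem_fixing {S : Finset (Fin n)} {σ : Perm (Fin n)} :
    σ ∈ fixing S ↔ ∀ x ∈ S, σ x = x := by simp [fixing]

lemma card_fixing (S : Finset (Fin n)) : (fixing S).card = (n - S.card).factorial := by
  classical
  have e := Equiv.Perm.subtypeEquivSubtypePerm (fun x : Fin n => x ∉ S)
  have h := Fintype.card_congr e
  rw [Fintype.card_perm] at h
  have h3 : Fintype.card {x : Fin n // x ∉ S} = n - S.card := by
    rw [Fintype.card_subtype_compl]; simp
  rw [h3] at h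
  rw [h, Fintype.card_subtype, fixing]
  simp

lemma card_perm_prescribed_le {ι : Type*} [Fintype ι] {u : ι → Fin n}
    (hu : Function.Injective u) (v : ι → Fin n) :
    (univ.filter fun σ : Perm (Fin n) => ∀ r, σ (u r) = v r).card ≤
      (n - Fintype.card ι).factorial := by
  classical
  by_cases hne : (univ.filter fun σ : Perm (Fin n) => ∀ r, σ (u r) = v r).Nonempty
  · obtain ⟨π, hπ⟩ := hne
    simp only [mem_filter, mem_univ, true_and] at hπ
    have hS : (univ.image u).card = Fintype.card ι := by
      rw [card_image_of_injective _ hu, card_univ]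
    rw [← hS, ← card_fixing]
    refine card_le_card_of_injOn (fun σ => π⁻¹ * σ) ?_ (fun a _ b _ h => mul_left_cancel h)
    intro σ hσ
    simp only [coe_filter, mem_univ, true_and, Set.mem_ofPred_eq] at hσ
    simp only [mem_coe, mem_fixing, mem_image, mem_univ, true_and]
    rintro _ ⟨r, rfl⟩
    rw [Perm.mul_apply, hσ, ← hπ, Perm.inv_def, symm_apply_apply]
  · rw [not_nonempty_iff_eq_empty] at hne
    simp [hne]

lemma card_perm_prescribed {ι : Type*} [Fintype ι] {u v : ι → Fin n}
    (hu : Function.Injective u) (hv : Function.Injective v) :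
    (univ.filter fun σ : Perm (Fin n) => ∀ r, σ (u r) = v r).card =
      (n - Fintype.card ι).factorial := by
  classical
  refine le_antisymm (card_perm_prescribed_le hu v) ?_
  obtain ⟨π, hπ⟩ := exists_perm_of_injective hu hv
  have hS : (univ.image u).card = Fintype.card ι := by
    rw [card_image_of_injective _ hu, card_univ]
  rw [← hS, ← card_fixing]
  refine card_le_card_of_injOn (fun σ => π * σ) ?_ (fun a _ b _ h => mul_left_cancel h)
  intro σ hσ
  simp only [mem_coe, mem_fixing, mem_image, mem_univ, true_and] at hσ
  simp only [coe_filter, mem_univ, true_and, Set.mem_ofPred_eq]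
  intro r
  rw [Perm.mul_apply, hσ _ ⟨r, rfl⟩, hπ]

/-- The permutations with `σ i = k` and `σ j = l`. -/
def pairCoset (i j k l : Fin n) : Finset (Perm (Fin n)) :=
  univ.filter fun σ => σ i = k ∧ σ j = l

@[simp] lemma mem_pairCoset {i j k l : Fin n} {σ : Perm (Fin n)} :
    σ ∈ pairCoset i j k l ↔ σ i = k ∧ σ j = l := by simp [pairCoset]

lemma injective_pair {i j : Fin n} (h : i ≠ j) : Function.Injective ![i, j] := by
  intro a b; fin_cases a <;> fin_cases b <;> simp [h, h.symm]

lemma card_pairCoset {i j k l : Fin n} (hij : i ≠ j) (hkl : k ≠ l) :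
    (pairCoset i j k l).card = (n - 2).factorial := by
  have := card_perm_prescribed (injective_pair hij) (injective_pair hkl)
  simpa [Fin.forall_fin_two, pairCoset] using this

lemma card_tripleCoset_le {i j m : Fin n} (hij : i ≠ j) (him : i ≠ m) (hjm : j ≠ m)
    (k l o : Fin n) :
    (univ.filter fun σ : Perm (Fin n) => σ i = k ∧ σ j = l ∧ σ m = o).card ≤
      (n - 3).factorial := by
  have hu : Function.Injective ![i, j, m] := by
    intro a b; fin_cases a <;> fin_cases b <;> simp [hij, hij.symm, him, him.symm, hjm, hjm.symm]
  have := card_perm_prescribed_le hu ![k, l, o]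
  simpa [Fin.forall_fin_succ] using this

/-! ### Averaging over conjugation -/

/-- The number of fixed points of `σ`. -/
def fixCard (σ : Perm (Fin n)) : ℕ := (univ.filter fun x => σ x = x).card

/-- The number of points of `σ` on cycles of length two. -/
def invCard (σ : Perm (Fin n)) : ℕ := (univ.filter fun x => σ x ≠ x ∧ σ (σ x) = x).card

/-- The sum of `f` over all conjugates `ω σ ω⁻¹`. -/
def conjSum (f : Perm (Fin n) → ℝ) (σ : Perm (Fin n)) : ℝ := ∑ ω, f (ω * σ * ω⁻¹)

lemma fixCard_eq_sum (σ : Perm (Fin n)) :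
    (fixCard σ : ℝ) = ∑ x, if σ x = x then (1 : ℝ) else 0 := by
  simp [fixCard]

lemma invCard_eq_sum (σ : Perm (Fin n)) :
    (invCard σ : ℝ) = ∑ x, ∑ y, if x ≠ y ∧ σ x = y ∧ σ y = x then (1 : ℝ) else 0 := by
  rw [invCard, card_filter]
  push_cast
  refine sum_congr rfl fun x _ => ?_
  rw [sum_eq_single (σ x)]
  · congr 1; simp [eq_comm]
  · intro y _ hy; rw [if_neg]; rintro ⟨_, h, _⟩; exact hy h.symm
  · simp

/-- The array averaged over simultaneous relabelling of its four indices. -/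
def arrSum (C : Fin n → Fin n → Fin n → Fin n → ℝ) (i j k l : Fin n) : ℝ :=
  ∑ ω : Perm (Fin n), C (ω i) (ω j) (ω k) (ω l)

lemma conjSum_qapObjective (C : Fin n → Fin n → Fin n → Fin n → ℝ) (σ : Perm (Fin n)) :
    conjSum (qapObjective C) σ = ∑ i, ∑ j, arrSum C i j (σ i) (σ j) := by
  simp only [conjSum, qapObjective, arrSum]
  have : ∀ ω : Perm (Fin n), ∑ i, ∑ j, C i j ((ω * σ * ω⁻¹) i) ((ω * σ * ω⁻¹) j) =
      ∑ i, ∑ j, C (ω i) (ω j) (ω (σ i)) (ω (σ j)) := by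
    intro ω
    rw [← Equiv.sum_comp ω]
    refine sum_congr rfl fun i _ => ?_
    rw [← Equiv.sum_comp ω]
    simp
  simp only [this]
  rw [sum_comm]
  refine sum_congr rfl fun i _ => ?_
  rw [sum_comm]

lemma arrSum_apply (C : Fin n → Fin n → Fin n → Fin n → ℝ) (π : Perm (Fin n))
    (i j k l : Fin n) : arrSum C (π i) (π j) (π k) (π l) = arrSum C i j k l := by
  simp only [arrSum]
  rw [← Equiv.sum_comp (Equiv.mulRight π) (fun ω : Perm (Fin n) => C (ω i) (ω j) (ω k) (ω l))]
  simp

/-- By relabelling invariance `arrSum` depends only on which of its four indices coincide. -/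
lemma arrSum_eq_of_injective {ι : Type*} (C : Fin n → Fin n → Fin n → Fin n → ℝ) {u v : ι → Fin n}
    (hu : Function.Injective u) (hv : Function.Injective v) (a b c d : ι) :
    arrSum C (v a) (v b) (v c) (v d) = arrSum C (u a) (u b) (u c) (u d) := by
  obtain ⟨π, hπ⟩ := exists_perm_of_injective hu hv
  rw [← arrSum_apply C π (u a), hπ, hπ, hπ, hπ]

lemma exists_arrSum_form (hn : 4 ≤ n) (C : Fin n → Fin n → Fin n → Fin n → ℝ) :
    ∃ a₀ a₁ b₀ b₁ b₂ b₃ b₄ b₅ b₆ : ℝ, (∀ i k, arrSum C i i k k = a₀ + a₁ * if k = i then 1 else 0) ∧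
      ∀ i j k l, i ≠ j → k ≠ l → arrSum C i j k l =
        b₀ + b₁ * (if k = i then 1 else 0) + b₂ * (if l = j then 1 else 0) +
        b₃ * ((if k = i then 1 else 0) * (if l = j then 1 else 0)) +
        b₄ * (if k = j then 1 else 0) + b₅ * (if l = i then 1 else 0) +
        b₆ * ((if k = j then 1 else 0) * (if l = i then 1 else 0)) := by
  let z : Fin 4 → Fin n := Fin.castLE hn
  have hz : Function.Injective z := Fin.castLE_injective hn
  let D := fun a b c d : Fin 4 => arrSum C (z a) (z b) (z c) (z d)
  have inj2 : ∀ {i k : Fin n}, i ≠ k → Function.Injective ![i, k] := injective_pair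
  have key1 : ∀ (i : Fin n) , arrSum C i i i i = D 0 0 0 0 := by
    intro i
    refine arrSum_eq_of_injective C (u := fun _ : Fin 1 => z 0) (v := fun _ : Fin 1 => i) ?_ ?_ 0 0 0 0 <;>
    exact Function.injective_of_subsingleton _
  have h01 : z 0 ≠ z 1 := hz.ne (by decide)
  have h02 : z 0 ≠ z 2 := hz.ne (by decide)
  have h12 : z 1 ≠ z 2 := hz.ne (by decide)
  have key2 : ∀ {i k : Fin n}, i ≠ k → ∀ a b c d : Fin 2,
      arrSum C (![i, k] a) (![i, k] b) (![i, k] c) (![i, k] d) =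
        arrSum C (![z 0, z 1] a) (![z 0, z 1] b) (![z 0, z 1] c) (![z 0, z 1] d) :=
    fun h => arrSum_eq_of_injective C (inj2 h01) (inj2 h)
  have inj3 : ∀ {i j m : Fin n}, i ≠ j → i ≠ m → j ≠ m → Function.Injective ![i, j, m] := by
    intro i j m hij him hjm a b
    fin_cases a <;> fin_cases b <;> simp [hij, hij.symm, him, him.symm, hjm, hjm.symm]
  have key3 : ∀ {i j k : Fin n}, i ≠ j → i ≠ k → j ≠ k → ∀ a b c d : Fin 3,
      arrSum C (![i, j, k] a) (![i, j, k] b) (![i, j, k] c) (![i, j, k] d) =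
        arrSum C (![z 0, z 1, z 2] a) (![z 0, z 1, z 2] b) (![z 0, z 1, z 2] c)
          (![z 0, z 1, z 2] d) :=
    fun h h' h'' => arrSum_eq_of_injective C (inj3 h01 h02 h12) (inj3 h h' h'')
  have key4 : ∀ {i j k l : Fin n}, i ≠ j → i ≠ k → i ≠ l → j ≠ k → j ≠ l → k ≠ l →
      arrSum C i j k l = D 0 1 2 3 := by
    intro i j k l h1 h2 h3 h4 h5 h6
    refine arrSum_eq_of_injective C (u := z) (v := ![i, j, k, l]) hz ?_ 0 1 2 3
    intro a b
    fin_cases a <;> fin_cases b <;>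
      simp [h1, h1.symm, h2, h2.symm, h3, h3.symm, h4, h4.symm, h5, h5.symm, h6, h6.symm]
  -- `D` evaluates each coincidence pattern on fixed representatives; inclusion-exclusion over the
  -- patterns gives the coefficients.
  refine ⟨D 0 0 1 1, D 0 0 0 0 - D 0 0 1 1, D 0 1 2 3, D 0 1 0 2 - D 0 1 2 3,
    D 0 1 2 1 - D 0 1 2 3, D 0 1 0 1 - D 0 1 0 2 - D 0 1 2 1 + D 0 1 2 3,
    D 0 1 1 2 - D 0 1 2 3, D 0 1 2 0 - D 0 1 2 3,
    D 0 1 1 0 - D 0 1 1 2 - D 0 1 2 0 + D 0 1 2 3, ?_, ?_⟩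
  · intro i k
    by_cases h : k = i
    · subst h; rw [key1]; simp
    · have := key2 (Ne.symm h) 0 0 1 1
      simp only [Matrix.cons_val_zero, Matrix.cons_val_one] at this
      rw [this, if_neg h]; simp [D]
  · intro i j k l hij hkl
    by_cases h1 : k = i
    · subst h1
      by_cases h2 : l = j
      · subst h2
        have := key2 hij 0 1 0 1
        simp only [Matrix.cons_val_zero, Matrix.cons_val_one] at this
        simp [hij, hij.symm, this, D]; ring
      · have := key3 hij hkl (Ne.symm h2) 0 1 0 2
        simp at this
        simp [hij, hkl.symm, h2, this, D]
    · by_cases h2 : k = j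
      · subst h2
        by_cases h3 : l = i
        · subst h3
          have := key2 hij 0 1 1 0
          simp only [Matrix.cons_val_zero, Matrix.cons_val_one] at this
          simp [hij, hij.symm, this, D]; ring
        · have := key3 hij (Ne.symm h3) hkl 0 1 1 2
          simp at this
          simp [hij.symm, hkl.symm, h3, this, D]
      · by_cases h3 : l = i
        · subst h3
          have := key3 hij (Ne.symm h1) (Ne.symm h2) 0 1 2 0
          simp at this
          simp [hij, h1, h2, this, D]
        · by_cases h4 : l = j
          · subst h4
            have := key3 hij (Ne.symm h1) (Ne.symm h2) 0 1 2 1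
            simp at this
            simp [h1, h2, h3, this, D]
          · rw [key4 hij (Ne.symm h1) (Ne.symm h3) (Ne.symm h2) (Ne.symm h4) hkl]
            simp [h1, h2, h3, h4]

/-- The conjugation average of a quadratic function is a combination of `1`, `p`, `p (p - 1)`, `q`,
where `p` counts the fixed points and `q` the points on two-cycles. -/
lemma exists_conjSum_form (hn : 4 ≤ n) (C : Fin n → Fin n → Fin n → Fin n → ℝ) :
    ∃ x₀ x₁ x₂ x₃ : ℝ, ∀ σ : Perm (Fin n), conjSum (qapObjective C) σ =
      n.factorial * (x₀ + x₁ * fixCard σ + x₂ * (fixCard σ * (fixCard σ - 1)) +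
        x₃ * invCard σ) := by
  obtain ⟨a₀, a₁, b₀, b₁, b₂, b₃, b₄, b₅, b₆, hd, ho⟩ := exists_arrSum_form hn C
  have hf : (n.factorial : ℝ) ≠ 0 := by positivity
  refine ⟨(n * a₀ + b₀ * (n * n) + b₄ * n + b₅ * n - n * b₀) / n.factorial,
    (a₁ + b₁ * n + b₂ * n + b₃ + b₆ - (b₁ + b₂ + b₃ + b₄ + b₅ + b₆)) / n.factorial,
    b₃ / n.factorial, b₆ / n.factorial, fun σ => ?_⟩
  rw [conjSum_qapObjective]
  -- `X` marks fixed points and `Y` is the permutation matrix. Its rows and columns sum to `1`, and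
  -- `Y i j * Y j i` picks out fixed points and two-cycles.
  let X : Fin n → ℝ := fun i => if σ i = i then 1 else 0
  let Y : Fin n → Fin n → ℝ := fun i j => if σ i = j then 1 else 0
  have hX : ∑ i, X i = fixCard σ := (fixCard_eq_sum σ).symm
  have hY1 : ∀ i, ∑ j, Y i j = 1 := by intro i; simp [Y]
  have hY2 : ∀ j, ∑ i, Y i j = 1 := by
    intro j
    rw [sum_eq_single (σ.symm j)]
    · simp [Y]
    · intro b _ hb
      simp only [Y]
      rw [if_neg]
      rintro rfl
      simp at hb
    · simp
  have hYY : ∑ i, ∑ j, Y i j * Y j i = fixCard σ + invCard σ := by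
    rw [invCard_eq_sum, ← hX, ← sum_add_distrib]
    refine sum_congr rfl fun i _ => ?_
    have : X i = ∑ j, if j = i then X i else 0 := by simp
    rw [this, ← sum_add_distrib]
    refine sum_congr rfl fun j _ => ?_
    by_cases hij : j = i
    · subst hij
      by_cases h : σ j = j <;> simp [X, Y, h]
    · by_cases h1 : σ i = j <;> by_cases h2 : σ j = i <;> simp [Y, hij, h1, h2, Ne.symm hij]
  -- The off-diagonal formula, extended to all pairs; `hterm` then corrects the diagonal.
  let W : Fin n → Fin n → ℝ := fun i j =>
    b₀ + b₁ * X i + b₂ * X j + b₃ * (X i * X j) + b₄ * Y i j + b₅ * Y j i + b₆ * (Y i j * Y j i)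
  have hterm : ∀ i j, arrSum C i j (σ i) (σ j) =
      W i j + if i = j then (a₀ + a₁ * X i - (b₀ + (b₁ + b₂ + b₃ + b₄ + b₅ + b₆) * X i)) else 0 := by
    intro i j
    by_cases hij : i = j
    · subst hij
      rw [hd]
      by_cases h : σ i = i
      · simp only [W, X, Y, h, if_true]; ring
      · simp only [W, X, Y, h, if_true, if_false]; ring
    · rw [ho i j _ _ hij (fun h => hij (σ.injective h))]
      simp only [W, X, Y, hij, if_false]; ring
  simp only [hterm, sum_add_distrib, sum_ite_eq, mem_univ, if_true, W, ← mul_sum, hYY, hY1, hY2,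
    ← sum_mul, hX, sum_sub_distrib, sum_const, card_univ, Fintype.card_fin, nsmul_eq_mul]
  field_simp
  ring

lemma sum_conjSum (f : Perm (Fin n) → ℝ) :
    ∑ σ, conjSum f σ = n.factorial * ∑ σ, f σ := by
  simp only [conjSum]
  rw [sum_comm]
  have : ∀ ω : Perm (Fin n), ∑ σ, f (ω * σ * ω⁻¹) = ∑ σ, f σ := fun ω =>
    Equiv.sum_comp (MulAut.conj ω).toEquiv f
  simp [this, Fintype.card_perm]

/-- Points of `S` are always fixed; each of the other `n - |S|` points is fixed with probability `1
/ (n - |S|)`. So the mean is `|S| + 1`. -/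
lemma sum_fixing_fixCard (S : Finset (Fin n)) (hS : S.card < n) :
    ∑ σ ∈ fixing S, (fixCard σ : ℝ) = (S.card + 1) * (n - S.card).factorial := by
  classical
  simp only [fixCard_eq_sum]
  rw [sum_comm]
  have h1 : ∀ x, (∑ σ ∈ fixing S, if σ x = x then (1 : ℝ) else 0) =
      if x ∈ S then ((n - S.card).factorial : ℝ) else ((n - S.card - 1).factorial : ℝ) := by
    intro x
    rw [sum_boole]
    by_cases hx : x ∈ S
    · rw [if_pos hx, ← card_fixing S, filter_true_of_mem]
      intro σ hσ; exact mem_fixing.1 hσ x hx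
    · rw [if_neg hx]
      have : (fixing S).filter (fun σ => σ x = x) = fixing (insert x S) := by
        ext σ; simp [and_comm]
      rw [this, card_fixing, card_insert_of_notMem hx, Nat.sub_sub]
  simp only [h1, sum_ite, sum_const, nsmul_eq_mul]
  have h2 : (univ.filter fun x => x ∈ S) = S := by ext; simp
  have h3 : (univ.filter fun x => x ∉ S).card = n - S.card := by
    rw [filter_not, h2, card_sdiff_of_subset (subset_univ S)]; simp
  rw [h2, h3]
  obtain ⟨m, hm⟩ : ∃ m, n - S.card = m + 1 := ⟨n - S.card - 1, by omega⟩
  rw [hm, Nat.factorial_succ]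
  push_cast
  ring_nf

lemma card_fixing_swap (S : Finset (Fin n)) {x y : Fin n} (hx : x ∉ S) (hy : y ∉ S)
    (hxy : x ≠ y) :
    ((fixing S).filter fun σ => σ x = y ∧ σ y = x).card = (n - S.card - 2).factorial := by
  classical
  have hc : (insert x (insert y S)).card = S.card + 2 := by
    rw [card_insert_of_notMem, card_insert_of_notMem hy]
    simp [hx, hxy]
  rw [Nat.sub_sub, ← hc, ← card_fixing]
  refine card_bij' (fun σ _ => σ * swap x y) (fun σ _ => σ * swap x y) ?_ ?_ ?_ ?_
  · intro σ hσ
    simp only [mem_filter, mem_fixing] at hσ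
    obtain ⟨h1, h2, h3⟩ := hσ
    simp only [mem_fixing, mem_insert]
    rintro z (rfl | rfl | hz)
    · simp [h3]
    · simp [h2]
    · rw [Perm.mul_apply, swap_apply_of_ne_of_ne, h1 z hz]
      · rintro rfl; exact hx hz
      · rintro rfl; exact hy hz
  · intro σ hσ
    simp only [mem_fixing, mem_insert] at hσ
    simp only [mem_filter, mem_fixing]
    refine ⟨?_, ?_, ?_⟩
    · intro z hz
      rw [Perm.mul_apply, swap_apply_of_ne_of_ne, hσ z (Or.inr (Or.inr hz))]
      · rintro rfl; exact hx hz
      · rintro rfl; exact hy hz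
    · simp [hσ y (Or.inr (Or.inl rfl))]
    · simp [hσ x (Or.inl rfl)]
  · intro σ _; simp [mul_assoc]
  · intro σ _; simp [mul_assoc]

/-- Mean `1`: there are `(n-|S|)(n-|S|-1)` ordered pairs off `S`, each exchanged by `(n-|S|-2)!` of
the permutations. -/
lemma sum_fixing_invCard (S : Finset (Fin n)) (hS : S.card + 2 ≤ n) :
    ∑ σ ∈ fixing S, (invCard σ : ℝ) = (n - S.card).factorial := by
  classical
  simp only [invCard_eq_sum]
  rw [sum_comm]
  have h1 : ∀ x, (∑ σ ∈ fixing S, ∑ y, if x ≠ y ∧ σ x = y ∧ σ y = x then (1 : ℝ) else 0) =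
      ∑ y, if x ∉ S ∧ y ∉ S ∧ x ≠ y then ((n - S.card - 2).factorial : ℝ) else 0 := by
    intro x
    rw [sum_comm]
    refine sum_congr rfl fun y _ => ?_
    rw [sum_boole]
    by_cases h : x ∉ S ∧ y ∉ S ∧ x ≠ y
    · rw [if_pos h]
      obtain ⟨hx, hy, hxy⟩ := h
      rw [← card_fixing_swap S hx hy hxy]
      simp [hxy]
    · rw [if_neg h, Nat.cast_eq_zero, card_eq_zero, filter_eq_empty_iff]
      rintro σ hσ ⟨hxy, hσx, hσy⟩
      rw [mem_fixing] at hσ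
      refine h ⟨fun hx => hxy ?_, fun hy => hxy ?_, hxy⟩
      · rw [← hσx, hσ x hx]
      · rw [← hσy, hσ y hy]
  simp only [h1]
  have h2 : ∀ x, (∑ y, if x ∉ S ∧ y ∉ S ∧ x ≠ y then ((n - S.card - 2).factorial : ℝ) else 0) =
      if x ∈ Sᶜ then ((n - S.card - 1 : ℕ) : ℝ) * (n - S.card - 2).factorial else 0 := by
    intro x
    by_cases hx : x ∈ S
    · simp [hx]
    · rw [if_pos (by simpa using hx), ← sum_filter, sum_const, nsmul_eq_mul]
      congr 2
      have : (univ.filter fun y => x ∉ S ∧ y ∉ S ∧ x ≠ y) = Sᶜ.erase x := by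
        ext y; simp [hx, and_comm, eq_comm]
      rw [this, card_erase_of_mem (by simpa using hx), card_compl, Fintype.card_fin]
  simp only [h2]
  rw [sum_ite_mem, univ_inter, sum_const, card_compl, Fintype.card_fin, nsmul_eq_mul]
  obtain ⟨m, hm⟩ : ∃ m, n - S.card = m + 2 := ⟨n - S.card - 2, by omega⟩
  rw [hm]
  simp only [Nat.factorial_succ, Nat.add_sub_cancel, show m + 2 - 1 = m + 1 from rfl]
  push_cast
  ring

lemma sum_fixCard_mul_pred (hn : 2 ≤ n) :
    ∑ σ : Perm (Fin n), (fixCard σ : ℝ) * (fixCard σ - 1) = n.factorial := by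
  classical
  have h0 : ∀ σ : Perm (Fin n), (fixCard σ : ℝ) * fixCard σ =
      ∑ x, if σ x = x then (fixCard σ : ℝ) else 0 := by
    intro σ
    conv_lhs => rw [fixCard_eq_sum]
    rw [sum_mul]
    rw [← fixCard_eq_sum]
    simp
  have h1 : ∑ σ : Perm (Fin n), (fixCard σ : ℝ) * fixCard σ = 2 * n.factorial := by
    simp only [h0]
    rw [sum_comm]
    have : ∀ x : Fin n, (∑ σ : Perm (Fin n), if σ x = x then (fixCard σ : ℝ) else 0) =
        2 * (n - 1).factorial := by
      intro x
      have hf : (univ.filter fun σ : Perm (Fin n) => σ x = x) = fixing {x} := by ext; simp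
      rw [← sum_filter, hf, sum_fixing_fixCard {x} (by simp; omega)]
      norm_num
    simp only [this, sum_const, card_univ, Fintype.card_fin, nsmul_eq_mul]
    obtain ⟨m, rfl⟩ : ∃ m, n = m + 1 := ⟨n - 1, by omega⟩
    rw [Nat.factorial_succ]
    push_cast
    ring_nf
  have h2 := sum_fixing_fixCard (n := n) ∅ (by simp; omega)
  have hu : fixing (∅ : Finset (Fin n)) = univ := by ext; simp
  rw [hu] at h2
  simp only [mul_sub, sum_sub_distrib, mul_one, h1, h2]
  simp
  ring

/-! ### Permutations with many fixed points and their modifications -/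

lemma fixCard_mul_swap {π : Perm (Fin n)} {i a : Fin n} (hi : π i = i) (ha : π a ≠ a) :
    (fixCard (π * swap i a) : ℝ) = fixCard π - 1 := by
  classical
  have hia : i ≠ a := by rintro rfl; exact ha hi
  have : (univ.filter fun x => (π * swap i a) x = x) = (univ.filter fun x => π x = x).erase i := by
    ext x
    simp only [mem_filter, mem_univ, true_and, mem_erase]
    simp only [Perm.mul_apply]
    by_cases hx : x = i
    · subst hx
      simp only [swap_apply_left, ne_eq, not_true_eq_false, false_and, iff_false]
      intro h
      exact hia (π.injective (hi.trans h.symm))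
    · by_cases hx' : x = a
      · subst hx'
        simp [hi, hia, ha]
      · simp [swap_apply_of_ne_of_ne hx hx', hx]
  rw [fixCard, this, card_erase_of_mem (by simp [hi]), fixCard, Nat.cast_sub]
  · simp
  · exact card_pos.2 ⟨i, by simp [hi]⟩

/-- The product inserts the fixed point `i` into the cycle of `a`. That cycle already has length at
least three, so no two-cycle appears or disappears. -/
lemma invCard_mul_swap {π : Perm (Fin n)} {i a : Fin n} (hi : π i = i) (ha : π a ≠ a)
    (ha2 : π (π a) ≠ a) : invCard (π * swap i a) = invCard π := by
  classical
  have hia : i ≠ a := by rintro rfl; exact ha hi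
  have hne : ∀ {x}, π x = i → x = i := fun {x} h => π.injective (h.trans hi.symm)
  unfold invCard
  congr 1
  ext x
  simp only [mem_filter, mem_univ, true_and]
  simp only [Perm.mul_apply]
  by_cases hx : x = i
  · subst hx
    have h1 : π a ≠ x := fun h => hia (hne h).symm
    simp only [swap_apply_left, hi, ne_eq, not_true_eq_false, false_and, iff_false]
    rw [swap_apply_of_ne_of_ne h1 ha]
    rintro ⟨-, h⟩
    exact h1 (hne h)
  · by_cases hx' : x = a
    · subst hx'
      simp [hi, ha, ha2]
    · rw [swap_apply_of_ne_of_ne hx hx']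
      have h1 : π x ≠ i := fun h => hx (hne h)
      by_cases h2 : π x = a
      · rw [h2, swap_apply_right, hi]
        constructor
        · rintro ⟨-, h⟩; exact absurd h.symm hx
        · rintro ⟨-, h⟩; exact absurd (by rw [h, h2]) ha2
      · rw [swap_apply_of_ne_of_ne h1 h2]

/-- `t` exchanges the points `u (inl r)` and `u (inr r)` for `r ∈ D`, and fixes everything else. -/
structure SwapsOn {k : ℕ} (u : Fin k ⊕ Fin k → Fin n) (D : Finset (Fin k))
    (t : Perm (Fin n)) : Prop where
  left : ∀ r ∈ D, t (u (.inl r)) = u (.inr r)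
  right : ∀ r ∈ D, t (u (.inr r)) = u (.inl r)
  left' : ∀ r ∉ D, t (u (.inl r)) = u (.inl r)
  right' : ∀ r ∉ D, t (u (.inr r)) = u (.inr r)
  other : ∀ x ∉ Set.range u, t x = x

/-- The permutations fixing all `u (inl r)`, with at most three further fixed points, and with no
`u (inr r)` on a cycle of length at most two. -/
def anchored {k : ℕ} (u : Fin k ⊕ Fin k → Fin n) : Finset (Perm (Fin n)) :=
  univ.filter fun π => (∀ r, π (u (.inl r)) = u (.inl r)) ∧
    (∀ r, π (u (.inr r)) ≠ u (.inr r) ∧ π (π (u (.inr r))) ≠ u (.inr r)) ∧ fixCard π ≤ k + 3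

lemma mem_anchored {k : ℕ} {u : Fin k ⊕ Fin k → Fin n} {π : Perm (Fin n)} :
    π ∈ anchored u ↔ (∀ r, π (u (.inl r)) = u (.inl r)) ∧
    (∀ r, π (u (.inr r)) ≠ u (.inr r) ∧ π (π (u (.inr r))) ≠ u (.inr r)) ∧ fixCard π ≤ k + 3 := by
  simp [anchored]

/-- Markov's inequality: the number of fixed points beyond `S` has mean `1`, so it is at least `4`
with probability at most `1/4`. -/
lemma card_filter_fixing_fixCard_le (S : Finset (Fin n)) (hS : S.card < n) :
    (3 / 4 : ℝ) * (n - S.card).factorial ≤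
      ((fixing S).filter fun π => fixCard π ≤ S.card + 3).card := by
  classical
  have h := sum_fixing_fixCard S hS
  have hc := card_filter_add_card_filter_not (s := fixing S) (fun π => fixCard π ≤ S.card + 3)
  rw [card_fixing] at hc
  have hge : ∀ π ∈ fixing S, (S.card : ℝ) + 4 * (if fixCard π ≤ S.card + 3 then 0 else 1) ≤
      fixCard π := by
    intro π hπ
    split_ifs with h1
    · have : S.card ≤ fixCard π := card_le_card fun x hx => by simp [mem_fixing.1 hπ x hx]
      simpa using this
    · have : S.card + 4 ≤ fixCard π := by omega
      exact_mod_cast this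
  have h2 := sum_le_sum hge
  rw [h, sum_add_distrib, ← mul_sum, sum_const, card_fixing, nsmul_eq_mul] at h2
  have h3 : (∑ π ∈ fixing S, if fixCard π ≤ S.card + 3 then (0 : ℝ) else 1) =
      ((fixing S).filter fun π => ¬ fixCard π ≤ S.card + 3).card := by
    rw [← sum_boole]
    refine sum_congr rfl fun π _ => ?_
    by_cases h : fixCard π ≤ S.card + 3 <;> simp [h]
  rw [h3] at h2
  have hc' : (((fixing S).filter fun π => fixCard π ≤ S.card + 3).card : ℝ) +
      ((fixing S).filter fun π => ¬ fixCard π ≤ S.card + 3).card = (n - S.card).factorial := by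
    exact_mod_cast hc
  linarith

/-- Of the Markov share `3/4`, a union bound over the `k` points `u (inr r)` removes at most `1/4`;
this uses `8k ≤ n - k`. -/
lemma card_anchored {k : ℕ} {u : Fin k ⊕ Fin k → Fin n} (hu : Function.Injective u)
    (hn : 9 * k + 1 ≤ n) : (1 / 2 : ℝ) * (n - k).factorial ≤ (anchored u).card := by
  classical
  set S : Finset (Fin n) := univ.image fun r => u (.inl r) with hS
  have hSc : S.card = k := by
    rw [hS, card_image_of_injective (f := fun r => u (.inl r)) _ (hu.comp Sum.inl_injective)]; simp
  have hrS : ∀ r, u (.inr r) ∉ S := by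
    intro r hr
    simp only [hS, mem_image, mem_univ, true_and] at hr
    obtain ⟨r', h⟩ := hr
    exact absurd (hu h) (by simp)
  have h1 := card_filter_fixing_fixCard_le S (by omega)
  rw [hSc] at h1
  set bad : Fin k → Finset (Perm (Fin n)) := fun r => (fixing S).filter fun π =>
    π (u (.inr r)) = u (.inr r) ∨ π (π (u (.inr r))) = u (.inr r) with hbad
  have hcov : ((fixing S).filter fun π => fixCard π ≤ k + 3) ⊆
      anchored u ∪ univ.biUnion bad := by
    intro π hπ
    simp only [mem_filter, mem_fixing] at hπ
    simp only [mem_union, mem_biUnion, mem_univ, true_and, hbad, mem_filter, mem_anchored]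
    by_cases hb : ∃ r, π (u (.inr r)) = u (.inr r) ∨ π (π (u (.inr r))) = u (.inr r)
    · right
      obtain ⟨r, hr⟩ := hb
      exact ⟨r, mem_fixing.2 hπ.1, hr⟩
    · left
      push Not at hb
      exact ⟨fun r => hπ.1 _ (by simp [hS]), hb, hπ.2⟩
  have hbadc : ∀ r, (bad r).card ≤ 2 * (n - k - 1).factorial := by
    intro r
    set x := u (.inr r)
    have hsub : bad r ⊆ fixing (insert x S) ∪ ((univ \ insert x S).biUnion fun y =>
        (fixing S).filter fun σ => σ x = y ∧ σ y = x) := by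
      intro π hπ
      simp only [hbad, mem_filter] at hπ
      by_cases hx : π x = x
      · refine mem_union_left _ (mem_fixing.2 ?_)
        intro z hz
        rcases mem_insert.1 hz with rfl | hz
        · exact hx
        · exact mem_fixing.1 hπ.1 z hz
      · refine mem_union_right _ (mem_biUnion.2 ⟨π x, ?_, ?_⟩)
        · simp only [mem_sdiff, mem_univ, true_and, mem_insert, not_or]
          refine ⟨hx, fun h => hx ?_⟩
          exact π.injective (mem_fixing.1 hπ.1 _ h)
        · exact mem_filter.2 ⟨hπ.1, rfl, (hπ.2.resolve_left hx)⟩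
    refine (card_le_card hsub).trans ((card_union_le _ _).trans ?_)
    have e1 : (fixing (insert x S)).card = (n - k - 1).factorial := by
      rw [card_fixing, card_insert_of_notMem (hrS r), hSc, Nat.sub_sub]
    have e2 : ((univ \ insert x S).biUnion fun y =>
        (fixing S).filter fun σ => σ x = y ∧ σ y = x).card ≤ (n - k - 1).factorial := by
      refine (card_biUnion_le_card_mul _ _ (n - k - 2).factorial ?_).trans ?_
      · intro y hy
        simp only [mem_sdiff, mem_univ, true_and, mem_insert, not_or] at hy
        rw [card_fixing_swap S (hrS r) hy.2 (Ne.symm hy.1), hSc]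
      · rw [card_sdiff_of_subset (subset_univ _), card_univ, Fintype.card_fin,
          card_insert_of_notMem (hrS r), hSc]
        obtain ⟨m, hm⟩ : ∃ m, n - k = m + 2 ∨ n - k = 1 ∧ m = 0 := by
          by_cases h : n - k = 1
          · exact ⟨0, Or.inr ⟨h, rfl⟩⟩
          · exact ⟨n - k - 2, Or.inl (by omega)⟩
        rcases hm with hm | ⟨hm, -⟩
        · rw [show n - (k + 1) = m + 1 by omega, hm]
          simp [Nat.factorial_succ]
        · rw [show n - (k + 1) = 0 by omega]; simp
    omega
  have hle := (card_le_card hcov).trans (card_union_le _ _)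
  have hb2 : (univ.biUnion bad).card ≤ k * (2 * (n - k - 1).factorial) := by
    refine (card_biUnion_le_card_mul _ _ _ fun r _ => hbadc r).trans ?_
    simp
  have h4 : (k * (2 * (n - k - 1).factorial) : ℝ) ≤ (1 / 4) * (n - k).factorial := by
    obtain ⟨m, hm⟩ : ∃ m, n - k = m + 1 := ⟨n - k - 1, by omega⟩
    rw [hm, Nat.factorial_succ, Nat.add_sub_cancel]
    have : (8 * k : ℝ) ≤ m + 1 := by
      have : 8 * k ≤ m + 1 := by omega
      exact_mod_cast this
    push_cast
    have hp : (0 : ℝ) ≤ m.factorial := by positivity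
    nlinarith
  have hle' : (((fixing S).filter fun π => fixCard π ≤ k + 3).card : ℝ) ≤
      (anchored u).card + (univ.biUnion bad).card := by exact_mod_cast hle
  have hb3 : ((univ.biUnion bad).card : ℝ) ≤ k * (2 * (n - k - 1).factorial) := by
    exact_mod_cast hb2
  linarith

lemma fixCard_conj (ω π : Perm (Fin n)) : fixCard (ω * π * ω⁻¹) = fixCard π := by
  unfold fixCard
  refine card_bij' (fun x _ => ω⁻¹ x) (fun x _ => ω x) ?_ ?_ ?_ ?_
  · intro x hx
    simp only [mem_filter, mem_univ, true_and] at hx ⊢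
    exact ω.injective (by simpa using hx)
  · intro x hx
    simp only [mem_filter, mem_univ, true_and] at hx ⊢
    simpa using hx
  · intro x _; simp
  · intro x _; simp

lemma fixCard_mul_swapsOn_le {k : ℕ} {u : Fin k ⊕ Fin k → Fin n} (hu : Function.Injective u)
    {D : Finset (Fin k)} {t π : Perm (Fin n)} (ht : SwapsOn u D t) (hπ : π ∈ anchored u) :
    fixCard (π * t) ≤ Dᶜ.card + 3 := by
  classical
  obtain ⟨h1, h2, h3⟩ := mem_anchored.1 hπ
  have hsub : (univ.filter fun x => (π * t) x = x) ⊆ (Dᶜ.image fun r => u (.inl r)) ∪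
      ((univ.filter fun x => π x = x) \ univ.image fun r => u (.inl r)) := by
    intro x hx
    simp only [mem_filter, mem_univ, true_and] at hx
    simp only [Perm.mul_apply] at hx
    by_cases hr : x ∈ Set.range u
    · obtain ⟨r | r, rfl⟩ := hr
      · by_cases hD : r ∈ D
        · rw [ht.left r hD, ← h1 r] at hx
          have := π.injective hx
          exact absurd (hu this) (by simp)
        · exact mem_union_left _ (mem_image.2 ⟨r, by simpa using hD, rfl⟩)
      · by_cases hD : r ∈ D
        · rw [ht.right r hD, h1 r] at hx
          exact absurd (hu hx) (by simp)
        · rw [ht.right' r hD] at hx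
          exact absurd hx (h2 r).1
    · rw [ht.other x hr] at hx
      refine mem_union_right _ (mem_sdiff.2 ⟨by simpa using hx, ?_⟩)
      simp only [mem_image, mem_univ, true_and, not_exists]
      intro r h
      exact hr ⟨_, h⟩
  refine (card_le_card hsub).trans ((card_union_le _ _).trans (add_le_add card_image_le ?_))
  rw [card_sdiff_of_subset, card_image_of_injective (f := fun r => u (.inl r)) _
    (hu.comp Sum.inl_injective)]
  · have : (univ.filter fun x => π x = x).card ≤ k + 3 := h3
    simp
    omega
  · intro x hx
    simp only [mem_image, mem_univ, true_and] at hx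
    obtain ⟨r, rfl⟩ := hx
    simp [h1 r]

/-- A bound for sums over conjugates of the permutations `π t`, `π ∈ H`. -/
lemma sum_conj_le (H : Finset (Perm (Fin n))) (t : Perm (Fin n)) (m : ℕ)
    (hm : ∀ σ, (univ.filter fun ω : Perm (Fin n) => ∃ π ∈ H, ω * (π * t) * ω⁻¹ = σ).card ≤ m)
    (F : Perm (Fin n) → ℝ) (hF : ∀ σ, 0 ≤ F σ) :
    ∑ π ∈ H, ∑ ω, F (ω * (π * t) * ω⁻¹) ≤ m * ∑ σ, F σ := by
  classical
  rw [sum_comm]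
  -- For fixed `ω` the conjugates of distinct `π` are distinct, so `σ` is hit once for each `ω`
  -- counted by `hm`.
  have h1 : ∀ ω : Perm (Fin n), ∑ π ∈ H, F (ω * (π * t) * ω⁻¹) =
      ∑ σ, if ∃ π ∈ H, ω * (π * t) * ω⁻¹ = σ then F σ else 0 := by
    intro ω
    rw [← sum_filter]
    have : (univ.filter fun σ => ∃ π ∈ H, ω * (π * t) * ω⁻¹ = σ) =
        H.image fun π => ω * (π * t) * ω⁻¹ := by ext; simp
    rw [this, sum_image]
    intro a _ b _ h
    simpa using h
  simp only [h1]
  rw [sum_comm, mul_sum]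
  refine sum_le_sum fun σ _ => ?_
  rw [← sum_filter, sum_const, nsmul_eq_mul]
  exact mul_le_mul_of_nonneg_right (by exact_mod_cast hm σ) (hF σ)

lemma card_le_of_cover {ι κ : Type*} [Fintype ι] {u : ι → Fin n} (hu : Function.Injective u)
    (W : Finset (Perm (Fin n))) (E : Finset κ) (v : κ → ι → Fin n)
    (h : ∀ ω ∈ W, ∃ d ∈ E, ∀ r, ω (u r) = v d r) :
    W.card ≤ E.card * (n - Fintype.card ι).factorial := by
  classical
  have hsub : W ⊆ E.biUnion fun d => univ.filter fun σ : Perm (Fin n) => ∀ r, σ (u r) = v d r := by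
    intro ω hω
    obtain ⟨d, hd, h'⟩ := h ω hω
    exact mem_biUnion.2 ⟨d, hd, by simpa using h'⟩
  exact (card_le_card hsub).trans
    (card_biUnion_le_card_mul _ _ _ fun d _ => card_perm_prescribed_le hu (v d))

/-- Let `i = u (inl r)` and `a = u (inr r)`. If `ω(πt)ω⁻¹ = σ`, then `ω i = σ (ω a)` for `r ∈ D`,
while for `r ∉ D` the point `ω i` is one of at most `|Dᶜ| + 3` fixed points of `σ`. Choosing the `ω
a` freely gives `n ^ k`; then `n - 2k` values remain. Undoing transpositions thus brings the
conjugates closer to uniform. -/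
lemma sum_conj_anchored_le {k : ℕ} {u : Fin k ⊕ Fin k → Fin n} (hu : Function.Injective u)
    {D : Finset (Fin k)} {t : Perm (Fin n)} (ht : SwapsOn u D t)
    (F : Perm (Fin n) → ℝ) (hF : ∀ σ, 0 ≤ F σ) :
    ∑ π ∈ anchored u, ∑ ω, F (ω * (π * t) * ω⁻¹) ≤
      ((n ^ k * (Dᶜ.card + 3) ^ Dᶜ.card * (n - 2 * k).factorial : ℕ) : ℝ) * ∑ σ, F σ := by
  classical
  refine sum_conj_le _ _ _ (fun σ => ?_) F hF
  set W := univ.filter fun ω : Perm (Fin n) => ∃ π ∈ anchored u, ω * (π * t) * ω⁻¹ = σ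
  by_cases hW : W = ∅
  · rw [hW]; simp
  have hfix : fixCard σ ≤ Dᶜ.card + 3 := by
    obtain ⟨ω, hω⟩ := nonempty_iff_ne_empty.2 hW
    obtain ⟨π, hπ, rfl⟩ := (mem_filter.1 hω).2
    rw [fixCard_conj]
    exact fixCard_mul_swapsOn_le hu ht hπ
  let P : (Fin k → Fin n) → Fin k → Finset (Fin n) := fun φ r =>
    if r ∈ D then {σ (φ r)} else univ.filter fun x => σ x = x
  let E : Finset (Σ _ : Fin k → Fin n, Fin k → Fin n) :=
    (univ : Finset (Fin k → Fin n)).sigma fun φ => Fintype.piFinset (P φ)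
  have hcov := card_le_of_cover hu W E (fun d => Sum.elim d.2 d.1) ?_
  · have hE : E.card ≤ n ^ k * (Dᶜ.card + 3) ^ Dᶜ.card := by
      rw [card_sigma]
      have : ∀ φ, (Fintype.piFinset (P φ)).card ≤ (Dᶜ.card + 3) ^ Dᶜ.card := by
        intro φ
        rw [Fintype.card_piFinset, ← prod_compl_mul_prod D]
        have h1 : ∏ r ∈ D, (P φ r).card = 1 :=
          prod_eq_one fun r hr => by simp [P, hr]
        rw [h1, mul_one]
        refine prod_le_pow_card _ _ _ fun r hr => ?_
        have : r ∉ D := by simpa using hr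
        simp only [P, this, if_false]
        exact hfix
      refine (sum_le_sum fun φ _ => this φ).trans ?_
      simp
    refine hcov.trans ?_
    rw [Fintype.card_sum, Fintype.card_fin, ← two_mul]
    exact Nat.mul_le_mul_right _ hE
  · intro ω hω
    obtain ⟨π, hπ, rfl⟩ := (mem_filter.1 hω).2
    obtain ⟨h1, -, -⟩ := mem_anchored.1 hπ
    refine ⟨⟨fun r => ω (u (.inr r)), fun r => ω (u (.inl r))⟩, ?_, ?_⟩
    · simp only [E, mem_sigma, mem_univ, true_and, Fintype.mem_piFinset]
      intro r
      by_cases hr : r ∈ D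
      · simp [P, hr, ht.right r hr, h1]
      · simp only [P, hr, if_false, mem_filter, mem_univ, true_and]
        simp [ht.left' r hr, h1]
    · rintro (r | r) <;> simp

/-- Any contributing `ω` maps `S` into the at most `|S| + 3` fixed points of the target. -/
lemma sum_conj_fixing_le (S : Finset (Fin n)) (F : Perm (Fin n) → ℝ) (hF : ∀ σ, 0 ≤ F σ) :
    ∑ π ∈ (fixing S).filter (fun π => fixCard π ≤ S.card + 3), ∑ ω, F (ω * π * ω⁻¹) ≤
      (((S.card + 3) ^ S.card * (n - S.card).factorial : ℕ) : ℝ) * ∑ σ, F σ := by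
  classical
  have := sum_conj_le ((fixing S).filter (fun π => fixCard π ≤ S.card + 3)) 1
    ((S.card + 3) ^ S.card * (n - S.card).factorial) (fun σ => ?_) F hF
  · simpa using this
  set W := univ.filter fun ω : Perm (Fin n) =>
    ∃ π ∈ (fixing S).filter (fun π => fixCard π ≤ S.card + 3), ω * (π * 1) * ω⁻¹ = σ
  by_cases hW : W = ∅
  · rw [hW]; simp
  have hfix : fixCard σ ≤ S.card + 3 := by
    obtain ⟨ω, hω⟩ := nonempty_iff_ne_empty.2 hW
    obtain ⟨π, hπ, rfl⟩ := (mem_filter.1 hω).2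
    rw [fixCard_conj, mul_one]
    exact (mem_filter.1 hπ).2
  have hcov := card_le_of_cover (u := fun x : S => (x : Fin n)) Subtype.val_injective W
    (Fintype.piFinset fun _ : S => univ.filter fun x => σ x = x) (fun d => d) ?_
  · rw [Fintype.card_piFinset, prod_const, card_univ, Fintype.card_coe] at hcov
    exact hcov.trans (Nat.mul_le_mul_right _ (Nat.pow_le_pow_left hfix _))
  · intro ω hω
    obtain ⟨π, hπ, rfl⟩ := (mem_filter.1 hω).2
    have h1 := mem_fixing.1 (mem_filter.1 hπ).1
    refine ⟨fun x => ω x, ?_, fun r => rfl⟩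
    simp only [Fintype.mem_piFinset, mem_filter, mem_univ, true_and]
    intro x
    simp [h1 x x.2]

/-! ### The coefficients of the conjugation average -/

lemma swapsOn_one {k : ℕ} (u : Fin k ⊕ Fin k → Fin n) : SwapsOn u ∅ 1 := by
  constructor <;> simp

lemma swapsOn_mul_swap {k : ℕ} {u : Fin k ⊕ Fin k → Fin n} (hu : Function.Injective u)
    {D : Finset (Fin k)} {t : Perm (Fin n)} (ht : SwapsOn u D t) {r : Fin k} (hr : r ∉ D) :
    SwapsOn u (insert r D) (t * swap (u (.inl r)) (u (.inr r))) := by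
  have hne : ∀ {a b}, a ≠ b → u a ≠ u b := fun h => hu.ne h
  have hl : ∀ s, s ≠ r → swap (u (.inl r)) (u (.inr r)) (u (.inl s)) = u (.inl s) := fun s hs =>
    swap_apply_of_ne_of_ne (hne (by simpa using hs)) (hne (by simp))
  have hrr : ∀ s, s ≠ r → swap (u (.inl r)) (u (.inr r)) (u (.inr s)) = u (.inr s) := fun s hs =>
    swap_apply_of_ne_of_ne (hne (by simp)) (hne (by simpa using hs))
  refine ⟨fun s hs => ?_, fun s hs => ?_, fun s hs => ?_, fun s hs => ?_, fun x hx => ?_⟩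
  · rw [Perm.mul_apply]
    by_cases h : s = r
    · subst h; rw [swap_apply_left, ht.right' s hr]
    · rw [hl s h, ht.left s ((mem_insert.1 hs).resolve_left h)]
  · rw [Perm.mul_apply]
    by_cases h : s = r
    · subst h; rw [swap_apply_right, ht.left' s hr]
    · rw [hrr s h, ht.right s ((mem_insert.1 hs).resolve_left h)]
  · rw [mem_insert, not_or] at hs
    rw [Perm.mul_apply, hl s hs.1, ht.left' s hs.2]
  · rw [mem_insert, not_or] at hs
    rw [Perm.mul_apply, hrr s hs.1, ht.right' s hs.2]
  · rw [Perm.mul_apply, swap_apply_of_ne_of_ne, ht.other x hx]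
    · rintro rfl; exact hx ⟨_, rfl⟩
    · rintro rfl; exact hx ⟨_, rfl⟩

/-- The form of the conjugation average of a quadratic function. -/
def HasConjForm (f : Perm (Fin n) → ℝ) (x₀ x₁ x₂ x₃ : ℝ) : Prop :=
  ∀ σ : Perm (Fin n), conjSum f σ = n.factorial *
    (x₀ + x₁ * fixCard σ + x₂ * (fixCard σ * (fixCard σ - 1)) + x₃ * invCard σ)

lemma anchored_mul_swap {k : ℕ} {u : Fin k ⊕ Fin k → Fin n} (hu : Function.Injective u)
    {π : Perm (Fin n)} (hπ : π ∈ anchored u) {r s : Fin k} (hrs : r ≠ s) :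
    (π * swap (u (.inl r)) (u (.inr r))) (u (.inl s)) = u (.inl s) ∧
    (π * swap (u (.inl r)) (u (.inr r))) (u (.inr s)) ≠ u (.inr s) ∧
    (π * swap (u (.inl r)) (u (.inr r))) ((π * swap (u (.inl r)) (u (.inr r))) (u (.inr s))) ≠
      u (.inr s) := by
  obtain ⟨h1, h2, -⟩ := mem_anchored.1 hπ
  have hne : ∀ {a b}, a ≠ b → u a ≠ u b := fun h => hu.ne h
  have e1 : swap (u (.inl r)) (u (.inr r)) (u (.inl s)) = u (.inl s) :=
    swap_apply_of_ne_of_ne (hne (by simpa using hrs.symm)) (hne (by simp))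
  have e2 : swap (u (.inl r)) (u (.inr r)) (u (.inr s)) = u (.inr s) :=
    swap_apply_of_ne_of_ne (hne (by simp)) (hne (by simpa using hrs.symm))
  simp only [Perm.mul_apply, e1, e2]
  refine ⟨h1 s, (h2 s).1, ?_⟩
  have h3 : π (u (.inr s)) ≠ u (.inl r) := by
    intro h
    exact hne (by simp) (π.injective (h.trans (h1 r).symm))
  by_cases h4 : π (u (.inr s)) = u (.inr r)
  · rw [h4, swap_apply_right, h1 r]
    exact hne (by simp)
  · rw [swap_apply_of_ne_of_ne h3 h4]
    exact (h2 s).2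

/-- Each transposition lowers `p` by one and keeps `q`, so only `p(p-1)` has a nonzero second
difference, namely `2`. -/
lemma secDiff_conjSum {f : Perm (Fin n) → ℝ} {x₀ x₁ x₂ x₃ : ℝ} (hf : HasConjForm f x₀ x₁ x₂ x₃)
    {k : ℕ} {u : Fin k ⊕ Fin k → Fin n} (hu : Function.Injective u) {π : Perm (Fin n)}
    (hπ : π ∈ anchored u) {r s : Fin k} (hrs : r ≠ s) :
    secDiff (conjSum f) π (u (.inl r)) (u (.inr r)) (u (.inl s)) (u (.inr s)) =
      n.factorial * (2 * x₂) := by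
  obtain ⟨h1, h2, -⟩ := mem_anchored.1 hπ
  obtain ⟨h3, h4, h5⟩ := anchored_mul_swap hu hπ hrs
  simp only [secDiff, hf _]
  rw [fixCard_mul_swap h3 h4, invCard_mul_swap h3 h4 h5, fixCard_mul_swap (h1 r) (h2 r).1,
    fixCard_mul_swap (h1 s) (h2 s).1, invCard_mul_swap (h1 r) (h2 r).1 (h2 r).2,
    invCard_mul_swap (h1 s) (h2 s).1 (h2 s).2]
  ring

lemma conjSum_mul_swap_sub {f : Perm (Fin n) → ℝ} {x₀ x₁ x₂ x₃ : ℝ}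
    (hf : HasConjForm f x₀ x₁ x₂ x₃) {k : ℕ} {u : Fin k ⊕ Fin k → Fin n}
    (hu : Function.Injective u) {π : Perm (Fin n)}
    (hπ : π ∈ anchored u) {r s : Fin k} (hrs : r ≠ s) :
    conjSum f (π * swap (u (.inl r)) (u (.inr r))) - conjSum f (π * swap (u (.inl r)) (u (.inr r)) *
      swap (u (.inl s)) (u (.inr s))) = n.factorial * (x₁ + 2 * x₂ * (fixCard π - 2)) := by
  obtain ⟨h1, h2, -⟩ := mem_anchored.1 hπ
  obtain ⟨h3, h4, h5⟩ := anchored_mul_swap hu hπ hrs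
  simp only [hf _]
  rw [fixCard_mul_swap h3 h4, invCard_mul_swap h3 h4 h5, fixCard_mul_swap (h1 r) (h2 r).1,
    invCard_mul_swap (h1 r) (h2 r).1 (h2 r).2]
  ring

/-- The first `2 k` points, in two groups. -/
def firstPoints {k : ℕ} (h : k + k ≤ n) : Fin k ⊕ Fin k → Fin n :=
  fun x => Fin.castLE h (finSumFinEquiv x)

lemma firstPoints_injective {k : ℕ} (h : k + k ≤ n) : Function.Injective (firstPoints h) :=
  (Fin.castLE_injective h).comp finSumFinEquiv.injective

lemma abs_conjSum_le (f : Perm (Fin n) → ℝ) (σ : Perm (Fin n)) :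
    |conjSum f σ| ≤ ∑ ω : Perm (Fin n), |f (ω * σ * ω⁻¹)| := abs_sum_le_sum_abs _ _

lemma abs_sum_conjSum_anchored_le (f : Perm (Fin n) → ℝ) {k : ℕ} {u : Fin k ⊕ Fin k → Fin n}
    (hu : Function.Injective u) {D : Finset (Fin k)} {t : Perm (Fin n)} (ht : SwapsOn u D t) :
    |∑ π ∈ anchored u, conjSum f (π * t)| ≤
      ((n ^ k * (Dᶜ.card + 3) ^ Dᶜ.card * (n - 2 * k).factorial : ℕ) : ℝ) * ∑ σ, |f σ| := by
  refine (abs_sum_le_sum_abs _ _).trans ((sum_le_sum fun π _ => abs_conjSum_le f _).trans ?_)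
  exact sum_conj_anchored_le hu ht (fun σ => |f σ|) fun σ => abs_nonneg _

lemma invCard_ne_one (σ : Perm (Fin n)) : invCard σ ≠ 1 := by
  intro h
  obtain ⟨x, hx⟩ := card_eq_one.1 h
  have h1 : x ∈ univ.filter fun x => σ x ≠ x ∧ σ (σ x) = x := by rw [hx]; simp
  simp only [mem_filter, mem_univ, true_and] at h1
  have h2 : σ x ∈ univ.filter fun x => σ x ≠ x ∧ σ (σ x) = x := by
    simp only [mem_filter, mem_univ, true_and, h1.2]
    exact ⟨h1.1.symm, trivial⟩
  rw [hx, mem_singleton] at h2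
  exact h1.1 h2

lemma sum_univ_fixCard (hn : 0 < n) : ∑ σ : Perm (Fin n), (fixCard σ : ℝ) = n.factorial := by
  have h := sum_fixing_fixCard (n := n) ∅ (by simpa using hn)
  rw [show fixing (∅ : Finset (Fin n)) = univ by ext; simp] at h
  simpa using h

lemma sum_univ_invCard (hn : 2 ≤ n) : ∑ σ : Perm (Fin n), (invCard σ : ℝ) = n.factorial := by
  have h := sum_fixing_invCard (n := n) ∅ (by simpa using hn)
  rw [show fixing (∅ : Finset (Fin n)) = univ by ext; simp] at h
  simpa using h

lemma HasConjForm.sum_eq_zero {f : Perm (Fin n) → ℝ} {x₀ x₁ x₂ x₃ : ℝ}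
    (hf : HasConjForm f x₀ x₁ x₂ x₃) (hn : 2 ≤ n) (h0 : ∑ σ, f σ = 0) :
    x₀ + x₁ + x₂ + x₃ = 0 := by
  have h := sum_conjSum f
  rw [h0, mul_zero] at h
  simp only [hf _, ← mul_sum, sum_add_distrib, sum_univ_fixCard (by omega : 0 < n),
    sum_univ_invCard hn, sum_fixCard_mul_pred hn] at h
  simp only [sum_const, card_univ, Fintype.card_perm, Fintype.card_fin, nsmul_eq_mul] at h
  have hp : (n.factorial : ℝ) ≠ 0 := by positivity
  have : (n.factorial : ℝ) * (n.factorial * (x₀ + x₁ + x₂ + x₃)) = 0 := by linarith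
  simpa [hp] using this

/-- Eliminating `x₃` through `x₀ + x₁ + x₂ + x₃ = 0` leaves `x₀` with the factor `1 - q`. Its
absolute value is at least `1`, since points on two-cycles come in pairs. Then sum over `σ`, using
that `p`, `q` and `p(p-1)` have mean `1`. -/
lemma HasConjForm.coef_zero_bound {f : Perm (Fin n) → ℝ} {x₀ x₁ x₂ x₃ : ℝ}
    (hf : HasConjForm f x₀ x₁ x₂ x₃) (hn : 2 ≤ n) (h0 : ∑ σ, f σ = 0) :
    |x₀| * n.factorial ≤ (∑ σ, |f σ|) + 2 * (|x₁| * n.factorial) + 2 * (|x₂| * n.factorial) := by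
  set L := ∑ σ, |f σ| with hL
  have hp : (0 : ℝ) < n.factorial := by positivity
  have hz := hf.sum_eq_zero (by omega) h0
  have hpt : ∀ σ : Perm (Fin n), |x₀| * n.factorial ≤ |conjSum f σ| +
      n.factorial * |x₁| * (fixCard σ + invCard σ) +
      n.factorial * |x₂| * (fixCard σ * (fixCard σ - 1) + invCard σ) := by
    intro σ
    have h1 : n.factorial * (x₀ * (1 - invCard σ)) = conjSum f σ -
        n.factorial * (x₁ * (fixCard σ - invCard σ)) -
        n.factorial * (x₂ * (fixCard σ * (fixCard σ - 1) - invCard σ)) := by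
      rw [hf σ, show x₃ = -(x₀ + x₁ + x₂) by linarith]; ring
    have hq : (1 : ℝ) ≤ |1 - (invCard σ : ℝ)| := by
      rcases Nat.lt_or_gt_of_ne (invCard_ne_one σ) with h | h
      · rw [show invCard σ = 0 by omega]; simp
      · have : (2 : ℝ) ≤ invCard σ := by exact_mod_cast h
        rw [abs_of_nonpos (by linarith)]; linarith
    have hpp : (0 : ℝ) ≤ (fixCard σ : ℝ) * (fixCard σ - 1) := by
      rcases Nat.eq_zero_or_pos (fixCard σ) with h | h
      · rw [h]; simp
      · have : (1 : ℝ) ≤ fixCard σ := by exact_mod_cast h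
        exact mul_nonneg (by linarith) (by linarith)
    have hf0 : (0 : ℝ) ≤ fixCard σ := by positivity
    have hi0 : (0 : ℝ) ≤ invCard σ := by positivity
    have h2 : |(fixCard σ : ℝ) - invCard σ| ≤ fixCard σ + invCard σ := by
      rw [abs_le]; constructor <;> linarith
    have h3 : |(fixCard σ : ℝ) * (fixCard σ - 1) - invCard σ| ≤
        fixCard σ * (fixCard σ - 1) + invCard σ := by
      rw [abs_le]; constructor <;> linarith
    calc |x₀| * n.factorial ≤ |x₀| * n.factorial * |1 - (invCard σ : ℝ)| :=
          le_mul_of_one_le_right (by positivity) hq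
      _ = |n.factorial * (x₀ * (1 - invCard σ))| := by
          rw [abs_mul, abs_mul, abs_of_pos hp]; ring
      _ ≤ |conjSum f σ| + |n.factorial * (x₁ * (fixCard σ - invCard σ))| +
          |n.factorial * (x₂ * (fixCard σ * (fixCard σ - 1) - invCard σ))| := by
          rw [h1]
          exact (abs_sub _ _).trans (add_le_add_left (abs_sub _ _) _)
      _ ≤ _ := by
          rw [abs_mul, abs_mul, abs_mul (n.factorial : ℝ), abs_mul x₂, abs_of_pos hp,
            ← mul_assoc, ← mul_assoc]
          gcongr
  have hs := sum_le_sum fun σ (_ : σ ∈ (univ : Finset (Perm (Fin n)))) => hpt σ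
  simp only [sum_add_distrib, ← mul_sum, sum_univ_fixCard (by omega : 0 < n),
    sum_univ_invCard (by omega : 2 ≤ n), sum_fixCard_mul_pred (by omega : 2 ≤ n)] at hs
  simp only [sum_const, card_univ, Fintype.card_perm, Fintype.card_fin, nsmul_eq_mul] at hs
  have hcs : ∑ σ, |conjSum f σ| ≤ n.factorial * L := by
    refine (sum_le_sum fun σ _ => abs_conjSum_le f σ).trans ?_
    exact (sum_conjSum fun σ => |f σ|).le
  have h2 : (n.factorial : ℝ) * (|x₀| * n.factorial) ≤ n.factorial * (L + 2 * (|x₁| * n.factorial) +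
      2 * (|x₂| * n.factorial)) := by nlinarith
  exact le_of_mul_le_mul_left h2 hp

/-- With two anchored pairs, a second difference of `conjSum f` isolates `x₂` and a first difference
isolates `x₁`; the multiplicity bound controls the sums of all the terms by `L`. -/
lemma HasConjForm.coef_bound {f : Perm (Fin n) → ℝ} {x₀ x₁ x₂ x₃ : ℝ}
    (hf : HasConjForm f x₀ x₁ x₂ x₃) (hn : 20 ≤ n) (h0 : ∑ σ, f σ = 0) :
    |x₀| ≤ 1000 * ((∑ σ, |f σ|) / n.factorial) ∧ |x₁| ≤ 1000 * ((∑ σ, |f σ|) / n.factorial) ∧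
      |x₂| ≤ 1000 * ((∑ σ, |f σ|) / n.factorial) := by
  set L := ∑ σ, |f σ| with hL
  have hL0 : 0 ≤ L := sum_nonneg fun _ _ => abs_nonneg _
  have hp : (0 : ℝ) < n.factorial := by positivity
  have h2n : 2 + 2 ≤ n := by omega
  set u := firstPoints h2n
  have hu : Function.Injective u := firstPoints_injective h2n
  have hcard := card_anchored hu (by omega)
  set H : ℝ := ((anchored u).card : ℝ) with hH
  have hfac : (n : ℝ) ^ 2 * (n - 4).factorial ≤ 4 * H := by
    obtain ⟨m, rfl⟩ : ∃ m, n = m + 4 := ⟨n - 4, by omega⟩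
    rw [show m + 4 - 2 = m + 2 by omega] at hcard
    rw [Nat.add_sub_cancel]
    simp only [Nat.factorial_succ] at hcard
    push_cast at hcard ⊢
    have hm : (16 : ℝ) ≤ m := by exact_mod_cast (by omega : 16 ≤ m)
    have hmf : (0 : ℝ) ≤ m.factorial := by positivity
    have : ((m : ℝ) + 4) ^ 2 ≤ 2 * ((m + 1 + 1) * (m + 1)) := by nlinarith
    nlinarith
  have hHpos : 0 < H := by
    have : (0 : ℝ) < (n - 2).factorial := by positivity
    linarith
  have s0 := swapsOn_one u
  have s1 := swapsOn_mul_swap hu s0 (r := 0) (by simp)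
  have s1' := swapsOn_mul_swap hu s0 (r := 1) (by simp)
  have s2 := swapsOn_mul_swap hu s1 (r := 1) (by simp)
  have b0 := abs_sum_conjSum_anchored_le f hu s0
  have b1 := abs_sum_conjSum_anchored_le f hu s1
  have b1' := abs_sum_conjSum_anchored_le f hu s1'
  have b2 := abs_sum_conjSum_anchored_le f hu s2
  have c0 : ((∅ : Finset (Fin 2))ᶜ).card = 2 := by decide
  have c1 : ((insert 0 (∅ : Finset (Fin 2)))ᶜ).card = 1 := by decide
  have c1' : ((insert 1 (∅ : Finset (Fin 2)))ᶜ).card = 1 := by decide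
  have c2 : ((insert 1 (insert 0 (∅ : Finset (Fin 2))))ᶜ).card = 0 := by decide
  rw [c0] at b0
  rw [c1] at b1
  rw [c1'] at b1'
  rw [c2] at b2
  simp only [one_mul, mul_one, show 2 * 2 = 4 from rfl] at b0 b1 b1' b2
  push_cast at b0 b1 b1' b2
  simp only [← mul_assoc] at b2
  have e1 := sum_congr rfl fun π (hπ : π ∈ anchored u) =>
    secDiff_conjSum hf hu hπ (r := 0) (s := 1) (by decide)
  have e2 := sum_congr rfl fun π (hπ : π ∈ anchored u) =>
    conjSum_mul_swap_sub hf hu hπ (r := 0) (s := 1) (by decide)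
  simp only [secDiff, sum_add_distrib, sum_sub_distrib, sum_const, nsmul_eq_mul] at e1
  rw [sum_sub_distrib] at e2
  set Q := (n : ℝ) ^ 2 * (n - 4).factorial with hQ
  have hQL : Q * L ≤ 4 * H * L := mul_le_mul_of_nonneg_right hfac hL0
  have hx2 : |x₂| * n.factorial ≤ 68 * L := by
    -- `34 = 25 + 4 + 4 + 1`, the values of `(|Dᶜ| + 3) ^ |Dᶜ|` for the four sets `D`.
    have h1 : |H * (n.factorial * (2 * x₂))| ≤ 34 * (Q * L) := by
      rw [hH, ← e1, abs_le]
      rw [abs_le] at b0 b1 b1' b2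
      constructor <;> nlinarith
    rw [abs_mul, abs_mul, abs_mul, abs_of_pos hHpos, abs_of_pos hp, abs_two] at h1
    have h2 : H * (|x₂| * n.factorial) ≤ H * (68 * L) := by nlinarith
    exact le_of_mul_le_mul_left h2 hHpos
  have hx1 : |x₁| * n.factorial ≤ 428 * L := by
    -- An anchored `π` has between two and five fixed points, whence `408 = 2 * 3 * 68`.
    have hdev : |∑ π ∈ anchored u, n.factorial * (2 * x₂ * ((fixCard π : ℝ) - 2))| ≤
        H * (408 * L) := by
      refine (abs_sum_le_sum_abs _ _).trans ?_
      rw [hH, ← nsmul_eq_mul, ← sum_const]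
      refine sum_le_sum fun π hπ => ?_
      obtain ⟨h1, -, h3⟩ := mem_anchored.1 hπ
      have hge : 2 ≤ fixCard π := by
        have : (univ.image fun r => u (.inl r)).card = 2 := by
          rw [card_image_of_injective (f := fun r => u (.inl r)) _ (hu.comp Sum.inl_injective)]
          simp
        rw [← this]
        refine card_le_card fun x hx => ?_
        simp only [mem_image, mem_univ, true_and] at hx
        obtain ⟨r, rfl⟩ := hx
        simp [h1 r]
      have hp2 : |(fixCard π : ℝ) - 2| ≤ 3 := by
        have h4 : (fixCard π : ℝ) ≤ 5 := by exact_mod_cast h3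
        have h5 : (2 : ℝ) ≤ fixCard π := by exact_mod_cast hge
        rw [abs_le]; constructor <;> linarith
      rw [abs_mul, abs_mul, abs_mul, abs_of_pos hp, abs_two]
      have : (0 : ℝ) ≤ |x₂| * n.factorial := by positivity
      nlinarith
    have h1 : |H * (n.factorial * x₁)| ≤ 5 * (Q * L) + H * (408 * L) := by
      have e3 : H * (n.factorial * x₁) =
          ∑ π ∈ anchored u, n.factorial * (x₁ + 2 * x₂ * ((fixCard π : ℝ) - 2)) -
          ∑ π ∈ anchored u, n.factorial * (2 * x₂ * ((fixCard π : ℝ) - 2)) := by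
        rw [← sum_sub_distrib, hH, ← nsmul_eq_mul, ← sum_const]
        refine sum_congr rfl fun π _ => ?_
        ring
      rw [e3, ← e2, abs_le]
      rw [abs_le] at b1 b2 hdev
      constructor <;> nlinarith
    rw [abs_mul, abs_mul, abs_of_pos hHpos, abs_of_pos hp] at h1
    have h2 : H * (|x₁| * n.factorial) ≤ H * (428 * L) := by nlinarith
    exact le_of_mul_le_mul_left h2 hHpos
  have hx0 := hf.coef_zero_bound (by omega) h0
  have fin : ∀ {y : ℝ}, |y| * n.factorial ≤ 1000 * L → |y| ≤ 1000 * (L / n.factorial) := by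
    intro y h
    rw [← mul_div_assoc, le_div_iff₀ hp]; exact h
  exact ⟨fin (by linarith), fin (by linarith), fin (by linarith)⟩

/-! ### Quadratic functions are almost constant on cosets of pairs -/

lemma sum_pairCoset_mul (F : Perm (Fin n) → ℝ) (t : Perm (Fin n)) (i j k l : Fin n) :
    ∑ σ ∈ pairCoset i j k l, F (σ * t) = ∑ σ ∈ pairCoset (t⁻¹ i) (t⁻¹ j) k l, F σ := by
  refine sum_nbij' (fun σ => σ * t) (fun σ => σ * t⁻¹) ?_ ?_ ?_ ?_ ?_
  · intro σ hσ
    simpa using hσ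
  · intro σ hσ
    simpa using hσ
  · intro σ _; simp
  · intro σ _; simp
  · intro σ _; rfl

lemma sum_sum_pairCoset_le (F : Perm (Fin n) → ℝ) (k l : Fin n) :
    ∑ x, ∑ y, ∑ σ ∈ pairCoset x y k l, F σ ≤ ∑ σ, F σ := by
  have : ∀ x y, ∑ σ ∈ pairCoset x y k l, F σ =
      ∑ σ : Perm (Fin n), if x = σ⁻¹ k then (if y = σ⁻¹ l then F σ else 0) else 0 := by
    intro x y
    rw [pairCoset, sum_filter]
    refine sum_congr rfl fun σ _ => ?_
    rw [← ite_and]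
    congr 1
    rw [Perm.eq_inv_iff_eq, Perm.eq_inv_iff_eq]
  simp only [this]
  rw [sum_comm' (t' := univ) (s' := fun _ => univ) (by simp)]
  have h2 : ∀ y : Fin n, (∑ x : Fin n, ∑ σ : Perm (Fin n),
      if x = σ⁻¹ k then (if y = σ⁻¹ l then F σ else 0) else 0) =
      ∑ σ : Perm (Fin n), if y = σ⁻¹ l then F σ else 0 := by
    intro y
    rw [sum_comm]
    simp
  simp only [h2]
  rw [sum_comm]
  simp

lemma sum_pairCoset_left_le (F : Perm (Fin n) → ℝ) (hF : ∀ σ, 0 ≤ F σ) (j k l : Fin n) :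
    ∑ x, ∑ σ ∈ pairCoset x j k l, F σ ≤ ∑ σ, F σ := by
  refine le_trans (sum_le_sum fun x _ => ?_) (sum_sum_pairCoset_le F k l)
  exact single_le_sum (f := fun y => ∑ σ ∈ pairCoset x y k l, F σ)
    (fun y _ => sum_nonneg fun σ _ => hF σ) (mem_univ j)

lemma sum_pairCoset_right_le (F : Perm (Fin n) → ℝ) (hF : ∀ σ, 0 ≤ F σ) (i k l : Fin n) :
    ∑ y, ∑ σ ∈ pairCoset i y k l, F σ ≤ ∑ σ, F σ := by
  refine le_trans ?_ (sum_sum_pairCoset_le F k l)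
  exact single_le_sum (f := fun x => ∑ y, ∑ σ ∈ pairCoset x y k l, F σ)
    (fun y _ => sum_nonneg fun _ _ => sum_nonneg fun σ _ => hF σ) (mem_univ i)

/-- The mass of `|f|` on the cosets adjacent to `pairCoset i j k l` through rows `x` and `y`. -/
def adjMass (f : Perm (Fin n) → ℝ) (i j k l x y : Fin n) : ℝ :=
  ∑ σ ∈ pairCoset x j k l, |f σ| + ∑ σ ∈ pairCoset i y k l, |f σ| +
    ∑ σ ∈ pairCoset x y k l, |f σ|

lemma adjMass_nonneg (f : Perm (Fin n) → ℝ) (i j k l x y : Fin n) : 0 ≤ adjMass f i j k l x y :=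
  add_nonneg (add_nonneg (sum_nonneg fun _ _ => abs_nonneg _) (sum_nonneg fun _ _ => abs_nonneg _))
    (sum_nonneg fun _ _ => abs_nonneg _)

lemma sum_adjMass_le (hn : 0 < n) (f : Perm (Fin n) → ℝ) (i j k l : Fin n) :
    ∑ x, ∑ y, adjMass f i j k l x y ≤ 3 * n * ∑ σ, |f σ| := by
  have h1 := sum_pairCoset_left_le (fun σ => |f σ|) (fun _ => abs_nonneg _) j k l
  have h2 := sum_pairCoset_right_le (fun σ => |f σ|) (fun _ => abs_nonneg _) i k l
  have h3 := sum_sum_pairCoset_le (fun σ => |f σ|) k l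
  simp only [adjMass, sum_add_distrib, sum_const, card_univ, Fintype.card_fin, nsmul_eq_mul,
    ← mul_sum]
  have hn1 : (1 : ℝ) ≤ n := by exact_mod_cast hn
  have hL : 0 ≤ ∑ σ, |f σ| := sum_nonneg fun _ _ => abs_nonneg _
  nlinarith

/-- The other three terms of the second difference run over the three adjacent cosets. -/
lemma sum_abs_sub_secDiff_le (f : Perm (Fin n) → ℝ) {i j x y : Fin n} (k l : Fin n)
    (hij : i ≠ j) (hxj : x ≠ j) (hyi : y ≠ i) (hxy : x ≠ y) :
    ∑ σ ∈ pairCoset i j k l, |f σ - secDiff f σ i x j y| ≤ adjMass f i j k l x y := by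
  have e1 := sum_pairCoset_mul (fun σ => |f σ|) (swap i x) i j k l
  have e2 := sum_pairCoset_mul (fun σ => |f σ|) (swap j y) i j k l
  have e3 := sum_pairCoset_mul (fun σ => |f σ|) (swap i x * swap j y) i j k l
  simp only [mul_inv_rev, swap_inv, Perm.mul_apply, swap_apply_left,
    swap_apply_of_ne_of_ne hij.symm hxj.symm, swap_apply_of_ne_of_ne hij hyi.symm,
    swap_apply_of_ne_of_ne hxj hxy] at e1 e2 e3
  rw [adjMass, ← e1, ← e2, ← e3, ← sum_add_distrib, ← sum_add_distrib]
  refine sum_le_sum fun σ _ => ?_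
  rw [secDiff, mul_assoc]
  have : f σ - (f σ - f (σ * swap i x) - f (σ * swap j y) + f (σ * (swap i x * swap j y))) =
      f (σ * swap i x) + f (σ * swap j y) - f (σ * (swap i x * swap j y)) := by ring
  rw [this]
  exact (abs_sub _ _).trans (add_le_add_left (abs_add_le _ _) _)

/-- Averaging: for `n ≥ 50`, at least `n² / 2` ordered pairs of distinct points avoid `Z`. -/
lemma exists_good_pair (hn : 50 ≤ n) (G : Fin n → Fin n → ℝ) (hG : ∀ x y, 0 ≤ G x y) {T : ℝ}
    (hT : ∑ x, ∑ y, G x y ≤ T) (Z : Finset (Fin n)) (hZ : Z.card ≤ 12) :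
    ∃ x y, x ∉ Z ∧ y ∉ Z ∧ x ≠ y ∧ G x y ≤ 2 * T / n ^ 2 := by
  classical
  have hT0 : 0 ≤ T := le_trans (sum_nonneg fun x _ => sum_nonneg fun y _ => hG x y) hT
  have hm : n ≤ Zᶜ.card + 12 := by rw [card_compl, Fintype.card_fin]; omega
  have hcard : (n : ℝ) ^ 2 ≤ 2 * (Zᶜ.offDiag.card : ℝ) := by
    have h1 : Zᶜ.offDiag.card = Zᶜ.card * Zᶜ.card - Zᶜ.card := offDiag_card _
    set m := Zᶜ.card
    have h2 : m ≤ m * m := Nat.le_mul_self m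
    rw [h1, Nat.cast_sub h2]
    push_cast
    have h3 : (n : ℝ) ≤ m + 12 := by exact_mod_cast hm
    have h4 : (38 : ℝ) ≤ m := by exact_mod_cast (by omega : 38 ≤ m)
    have h5 : (0 : ℝ) ≤ n := by positivity
    nlinarith
  have hn0 : (0 : ℝ) < (n : ℝ) ^ 2 := by positivity
  have hne : Zᶜ.offDiag.Nonempty := by
    rw [← card_pos]
    have : (0 : ℝ) < Zᶜ.offDiag.card := by linarith
    exact_mod_cast this
  obtain ⟨p, hp, hle⟩ := exists_le_of_sum_le (f := fun p : Fin n × Fin n => G p.1 p.2)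
    (g := fun _ => 2 * T / n ^ 2) hne (by
      calc ∑ p ∈ Zᶜ.offDiag, G p.1 p.2 ≤ ∑ p : Fin n × Fin n, G p.1 p.2 :=
            sum_le_sum_of_subset_of_nonneg (subset_univ _) fun p _ _ => hG _ _
        _ = ∑ x, ∑ y, G x y := by rw [← univ_product_univ, sum_product]
        _ ≤ T := hT
        _ ≤ ∑ p ∈ Zᶜ.offDiag, 2 * T / n ^ 2 := by
            rw [sum_const, nsmul_eq_mul, ← mul_div_assoc, le_div_iff₀ hn0]
            nlinarith)
  simp only [mem_offDiag, mem_compl] at hp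
  exact ⟨p.1, p.2, hp.1, hp.2.1, hp.2.2, hle⟩

lemma exists_good_adj (hn : 50 ≤ n) (f : Perm (Fin n) → ℝ) (i j k l : Fin n)
    (Z : Finset (Fin n)) (hZ : Z.card ≤ 12) :
    ∃ x y, x ∉ Z ∧ y ∉ Z ∧ x ≠ y ∧ adjMass f i j k l x y ≤ 6 * (∑ σ, |f σ|) / n := by
  obtain ⟨x, y, hx, hy, hxy, h⟩ := exists_good_pair hn (fun x y => adjMass f i j k l x y)
    (fun x y => adjMass_nonneg f i j k l x y) (sum_adjMass_le (by omega) f i j k l) Z hZ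
  refine ⟨x, y, hx, hy, hxy, h.trans (le_of_eq ?_)⟩
  have : (n : ℝ) ≠ 0 := by exact_mod_cast (by omega : n ≠ 0)
  field_simp
  ring

/-- The second difference is the same at `σ` and at `σ * ω`, as `ω` fixes the four points involved;
both function values are close to it in mean. -/
lemma sum_abs_sub_mul_le (C : Fin n → Fin n → Fin n → Fin n → ℝ) {i j x y : Fin n} (k l : Fin n)
    (hij : i ≠ j) (hxi : x ≠ i) (hxj : x ≠ j) (hyi : y ≠ i) (hyj : y ≠ j) (hxy : x ≠ y)
    {ω : Perm (Fin n)} (hi : ω i = i) (hj : ω j = j) (hx : ω x = x) (hy : ω y = y) :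
    ∑ σ ∈ pairCoset i j k l, |qapObjective C σ - qapObjective C (σ * ω)| ≤
      2 * adjMass (qapObjective C) i j k l x y := by
  set f := qapObjective C
  have h1 := sum_abs_sub_secDiff_le f k l hij hxj hyi hxy
  have h2 : ∑ σ ∈ pairCoset i j k l, |f (σ * ω) - secDiff f (σ * ω) i x j y| ≤
      adjMass f i j k l x y := by
    rw [sum_pairCoset_mul (fun σ => |f σ - secDiff f σ i x j y|) ω i j k l,
      Perm.inv_eq_iff_eq.2 hi.symm, Perm.inv_eq_iff_eq.2 hj.symm]
    exact h1
  have h3 : ∀ σ, secDiff f (σ * ω) i x j y = secDiff f σ i x j y := by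
    intro σ
    simp only [f]
    rw [secDiff_eq C _ hxi.symm hyj.symm hij hyi.symm hxj hxy,
      secDiff_eq C _ hxi.symm hyj.symm hij hyi.symm hxj hxy]
    simp [hi, hj, hx, hy]
  simp only [h3] at h2
  rw [two_mul]
  refine le_trans ?_ (add_le_add h1 h2)
  rw [← sum_add_distrib]
  refine sum_le_sum fun σ _ => ?_
  rw [abs_sub_comm (f (σ * ω))]
  exact abs_sub_le _ _ _

lemma exists_perm_fixing_pair (S : Finset (Fin n)) {p q x y : Fin n} (hp : p ∉ S) (hq : q ∉ S)
    (hx : x ∉ S) (hy : y ∉ S) (hpq : p ≠ q) (hxy : x ≠ y) :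
    ∃ h : Perm (Fin n), (∀ z ∈ S, h z = z) ∧ h p = x ∧ h q = y := by
  have hq' : swap p x q ∉ S := by
    by_cases h : q = x
    · rw [h, swap_apply_right]; exact hp
    · rw [swap_apply_of_ne_of_ne hpq.symm h]; exact hq
  have hne : swap p x q ≠ x := by
    intro h
    have := (swap p x).injective (h.trans (swap_apply_left p x).symm)
    exact hpq this.symm
  refine ⟨swap y (swap p x q) * swap p x, fun z hz => ?_, ?_, ?_⟩
  · have h1 : swap p x z = z := swap_apply_of_ne_of_ne (fun h => hp (h ▸ hz)) fun h => hx (h ▸ hz)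
    rw [Perm.mul_apply, h1]
    exact swap_apply_of_ne_of_ne (fun h => hy (h ▸ hz)) fun h => hq' (h ▸ hz)
  · rw [Perm.mul_apply, swap_apply_left, swap_apply_of_ne_of_ne hxy hne.symm]
  · rw [Perm.mul_apply, swap_apply_right]

/-- The average of `f` on a coset. -/
noncomputable def cosetAvg (f : Perm (Fin n) → ℝ) (i j k l : Fin n) : ℝ :=
  (∑ σ ∈ pairCoset i j k l, f σ) / (n - 2).factorial

/-- An `ω` fixing only `i` and `j` factors as `(ω g⁻¹) g`, where the first factor also fixes one
good pair and `g` another. Applying the previous estimate to each factor gives near-invariance. -/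
lemma sum_abs_sub_mul_le_of_fixing (hn : 50 ≤ n) (C : Fin n → Fin n → Fin n → Fin n → ℝ)
    {i j : Fin n} (k l : Fin n) (hij : i ≠ j) {ω : Perm (Fin n)} (hi : ω i = i) (hj : ω j = j) :
    ∑ σ ∈ pairCoset i j k l, |qapObjective C σ - qapObjective C (σ * ω)| ≤
      24 * (∑ σ, |qapObjective C σ|) / n := by
  classical
  set f := qapObjective C with hf
  obtain ⟨x, y, hx, hy, hxy, h⟩ := exists_good_adj hn f i j k l {i, j}
    (card_le_two.trans (by norm_num))
  have hinv : ∀ {z w}, ω z = w → ω⁻¹ w = z := fun h => by rw [← h]; simp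
  -- Avoiding these points lets `g` carry `ω⁻¹ x, ω⁻¹ y` to `x, y` while fixing the second pair.
  set Z : Finset (Fin n) := {i, j, x, y, ω⁻¹ x, ω⁻¹ y} with hZ
  have hZc : Z.card ≤ 12 := card_le_six.trans (by norm_num)
  obtain ⟨x', y', hx', hy', hxy', h'⟩ := exists_good_adj hn f i j k l Z hZc
  simp only [mem_insert, mem_singleton, not_or] at hx hy
  simp only [hZ, mem_insert, mem_singleton, not_or] at hx' hy'
  have hne : ∀ {z}, z ≠ i → ω⁻¹ z ≠ i := by
    intro z hz h; apply hz; rw [← hi, ← h]; simp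
  have hne' : ∀ {z}, z ≠ j → ω⁻¹ z ≠ j := by
    intro z hz h; apply hz; rw [← hj, ← h]; simp
  obtain ⟨g, hg, hgp, hgq⟩ := exists_perm_fixing_pair {i, j, x', y'}
    (p := ω⁻¹ x) (q := ω⁻¹ y) (x := x) (y := y)
    (by simp only [mem_insert, mem_singleton, not_or]
        exact ⟨hne hx.1, hne' hx.2, Ne.symm hx'.2.2.2.2.1, Ne.symm hy'.2.2.2.2.1⟩)
    (by simp only [mem_insert, mem_singleton, not_or]
        exact ⟨hne hy.1, hne' hy.2, Ne.symm hx'.2.2.2.2.2, Ne.symm hy'.2.2.2.2.2⟩)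
    (by simp only [mem_insert, mem_singleton, not_or]
        exact ⟨hx.1, hx.2, Ne.symm hx'.2.2.1, Ne.symm hy'.2.2.1⟩)
    (by simp only [mem_insert, mem_singleton, not_or]
        exact ⟨hy.1, hy.2, Ne.symm hx'.2.2.2.1, Ne.symm hy'.2.2.2.1⟩)
    (fun h => hxy (ω⁻¹.injective h)) hxy
  have hg1 : g i = i := hg i (by simp)
  have hg2 : g j = j := hg j (by simp)
  have hg3 : g x' = x' := hg x' (by simp)
  have hg4 : g y' = y' := hg y' (by simp)
  have gi : ∀ {z w}, g z = w → g⁻¹ w = z := fun h => by rw [← h]; simp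
  have b1 := sum_abs_sub_mul_le C k l hij hx.1 hx.2 hy.1 hy.2 hxy (ω := ω * g⁻¹)
    (by rw [Perm.mul_apply, gi hg1, hi]) (by rw [Perm.mul_apply, gi hg2, hj])
    (by rw [Perm.mul_apply, gi hgp]; simp) (by rw [Perm.mul_apply, gi hgq]; simp)
  have b2 := sum_abs_sub_mul_le C k l hij hx'.1 hx'.2.1 hy'.1 hy'.2.1 hxy' hg1 hg2 hg3 hg4
  have b3 : ∑ σ ∈ pairCoset i j k l, |f (σ * (ω * g⁻¹)) - f (σ * (ω * g⁻¹) * g)| ≤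
      2 * adjMass f i j k l x' y' := by
    rw [sum_pairCoset_mul (fun σ => |f σ - f (σ * g)|) (ω * g⁻¹) i j k l]
    have e1 : (ω * g⁻¹)⁻¹ i = i := by
      rw [mul_inv_rev, inv_inv, Perm.mul_apply, hinv hi, hg1]
    have e2 : (ω * g⁻¹)⁻¹ j = j := by
      rw [mul_inv_rev, inv_inv, Perm.mul_apply, hinv hj, hg2]
    rw [e1, e2]
    exact b2
  have e : ∀ σ : Perm (Fin n), σ * (ω * g⁻¹) * g = σ * ω := fun σ => by simp [mul_assoc]
  simp only [e] at b3
  calc ∑ σ ∈ pairCoset i j k l, |f σ - f (σ * ω)|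
      ≤ ∑ σ ∈ pairCoset i j k l, (|f σ - f (σ * (ω * g⁻¹))| +
          |f (σ * (ω * g⁻¹)) - f (σ * ω)|) := sum_le_sum fun σ _ => abs_sub_le _ _ _
    _ ≤ 2 * adjMass f i j k l x y + 2 * adjMass f i j k l x' y' := by
        rw [sum_add_distrib]; exact add_le_add b1 b3
    _ ≤ 2 * (6 * (∑ σ, |f σ|) / n) + 2 * (6 * (∑ σ, |f σ|) / n) := by gcongr
    _ = 24 * (∑ σ, |f σ|) / n := by ring

/-- A quadratic function is close to its average on every coset of a pair. -/
lemma sum_abs_sub_cosetAvg_le (hn : 50 ≤ n) (C : Fin n → Fin n → Fin n → Fin n → ℝ)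
    {i j k l : Fin n} (hij : i ≠ j) (hkl : k ≠ l) :
    ∑ σ ∈ pairCoset i j k l, |qapObjective C σ - cosetAvg (qapObjective C) i j k l| ≤
      24 * (∑ σ, |qapObjective C σ|) / n := by
  classical
  set f := qapObjective C with hf
  have hp : (0 : ℝ) < (n - 2).factorial := by positivity
  have hc : ((pairCoset i j k l).card : ℝ) = (n - 2).factorial := by
    rw [card_pairCoset hij hkl]
  -- The stabilizer of `i` and `j` acts simply transitively on the coset from the right, so the
  -- average is a mean over `ω`.
  have h1 : ∀ σ ∈ pairCoset i j k l, (n - 2).factorial * |f σ - cosetAvg f i j k l| ≤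
      ∑ ω ∈ fixing {i, j}, |f σ - f (σ * ω)| := by
    intro σ hσ
    rw [mem_pairCoset] at hσ
    have h2 : ∑ ω ∈ fixing {i, j}, |f σ - f (σ * ω)| = ∑ τ ∈ pairCoset i j k l, |f σ - f τ| := by
      refine sum_nbij' (fun ω => σ * ω) (fun τ => σ⁻¹ * τ) ?_ ?_ ?_ ?_ ?_
      · intro ω hω
        simp only [mem_fixing, mem_insert, mem_singleton] at hω
        simp [hω i (Or.inl rfl), hω j (Or.inr rfl), hσ]
      · intro τ hτ
        rw [mem_pairCoset] at hτ
        simp only [mem_fixing, mem_insert, mem_singleton]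
        rintro z (rfl | rfl)
        · rw [Perm.mul_apply, hτ.1, ← hσ.1]; simp
        · rw [Perm.mul_apply, hτ.2, ← hσ.2]; simp
      · intro ω _; simp
      · intro τ _; simp
      · intro ω _; rfl
    rw [h2]
    refine le_trans (le_of_eq ?_) (abs_sum_le_sum_abs _ _)
    rw [sum_sub_distrib, sum_const, nsmul_eq_mul, hc, cosetAvg, ← abs_of_pos hp, ← abs_mul,
      abs_of_pos hp]
    congr 1
    field_simp
  have h2 := sum_le_sum h1
  rw [← mul_sum, sum_comm] at h2
  have h3 : ∑ ω ∈ fixing {i, j}, ∑ σ ∈ pairCoset i j k l, |f σ - f (σ * ω)| ≤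
      ∑ ω ∈ fixing {i, j}, 24 * (∑ σ, |f σ|) / n := by
    refine sum_le_sum fun ω hω => ?_
    simp only [mem_fixing, mem_insert, mem_singleton] at hω
    exact sum_abs_sub_mul_le_of_fixing hn C k l hij (hω i (Or.inl rfl)) (hω j (Or.inr rfl))
  rw [sum_const, card_fixing, card_pair hij, nsmul_eq_mul] at h3
  exact le_of_mul_le_mul_left (h2.trans h3) hp

/-! ### Second differences are controlled by coset averages -/

/-- The sign attached to a corner of a rectangle. -/
def cornerSign (p q : Bool) : ℝ := if p = q then 1 else -1

lemma rect_eq_sum (i a k₁ k₂ x w : Fin n) :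
    rect i a k₁ k₂ = ∑ p : Bool, ∑ q : Bool,
      cornerSign p q • rect (cond p a i) x (cond q k₂ k₁) w := by
  rw [rect_split i a k₁ k₂ x w]
  simp [cornerSign]
  abel

lemma abs_cornerSign (p q : Bool) : |cornerSign p q| = 1 := by
  unfold cornerSign; split_ifs <;> simp

/-- Exactly `(n-4)!` members of the coset take given admissible values at `x` and `y`. Mean
estimates on the coset thereby become estimates over pairs `(w, v)`. -/
lemma sum_pairCoset_ge {i j x y k l : Fin n} (hij : i ≠ j) (hkl : k ≠ l) (hxi : x ≠ i)
    (hxj : x ≠ j) (hyi : y ≠ i) (hyj : y ≠ j) (hxy : x ≠ y) (Z : Finset (Fin n)) (hk : k ∈ Z)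
    (hl : l ∈ Z) (G : Fin n → Fin n → ℝ) (hG : ∀ w v, 0 ≤ G w v) :
    (n - 4).factorial * (∑ w, ∑ v, if w ∉ Z ∧ v ∉ Z ∧ w ≠ v then G w v else 0) ≤
      ∑ σ ∈ pairCoset i j k l, G (σ x) (σ y) := by
  classical
  have h1 : ∑ σ ∈ pairCoset i j k l, G (σ x) (σ y) =
      ∑ w, ∑ v, ((pairCoset i j k l).filter fun σ => σ x = w ∧ σ y = v).card * G w v := by
    have : ∀ w v, (((pairCoset i j k l).filter fun σ => σ x = w ∧ σ y = v).card : ℝ) * G w v =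
        ∑ σ ∈ pairCoset i j k l, if w = σ x then (if v = σ y then G w v else 0) else 0 := by
      intro w v
      rw [← nsmul_eq_mul, ← sum_const, sum_filter]
      refine sum_congr rfl fun σ _ => ?_
      rw [← ite_and]
      congr 1
      simp [eq_comm]
    simp only [this]
    rw [sum_comm' (t' := univ) (s' := fun _ => univ) (by simp)]
    have h2 : ∀ v : Fin n, (∑ w : Fin n, ∑ σ ∈ pairCoset i j k l,
        if w = σ x then (if v = σ y then G w v else 0) else 0) =
        ∑ σ ∈ pairCoset i j k l, if v = σ y then G (σ x) v else 0 := by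
      intro v
      rw [sum_comm]
      simp
    simp only [h2]
    rw [sum_comm]
    simp
  rw [h1, mul_sum]
  refine sum_le_sum fun w _ => ?_
  rw [mul_sum]
  refine sum_le_sum fun v _ => ?_
  split_ifs with h
  · obtain ⟨hw, hv, hwv⟩ := h
    have hkw : k ≠ w := fun h => hw (h ▸ hk)
    have hlw : l ≠ w := fun h => hw (h ▸ hl)
    have hkv : k ≠ v := fun h => hv (h ▸ hk)
    have hlv : l ≠ v := fun h => hv (h ▸ hl)
    have hu1 : Function.Injective ![i, j, x, y] := by
      intro a b
      fin_cases a <;> fin_cases b <;>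
        simp [hij, hij.symm, hxi, hxi.symm, hxj, hxj.symm, hyi, hyi.symm, hyj, hyj.symm, hxy,
          hxy.symm]
    have hu2 : Function.Injective ![k, l, w, v] := by
      intro a b
      fin_cases a <;> fin_cases b <;>
        simp [hkl, hkl.symm, hkw, hkw.symm, hlw, hlw.symm, hkv, hkv.symm, hlv, hlv.symm, hwv,
          hwv.symm]
    have hc := card_perm_prescribed hu1 hu2
    rw [Fintype.card_fin] at hc
    have he : ((pairCoset i j k l).filter fun σ => σ x = w ∧ σ y = v).card =
        (n - 4).factorial := by
      convert hc using 2
      ext σ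
      simp [Fin.forall_fin_succ, and_assoc]
    rw [he]
  · rw [mul_zero]
    exact mul_nonneg (by positivity) (hG w v)

/-- The second difference of a quadratic function is close to the alternating sum of its averages
on the sixteen cosets spanned by the rows and columns involved. -/
lemma abs_secDiff_sub_le (hn : 50 ≤ n) (C : Fin n → Fin n → Fin n → Fin n → ℝ)
    (σ : Perm (Fin n)) {i a j b : Fin n}
    (hia : i ≠ a) (hjb : j ≠ b) (hij : i ≠ j) (hib : i ≠ b) (haj : a ≠ j) (hab : a ≠ b) :
    |secDiff (qapObjective C) σ i a j b - ∑ p : Bool, ∑ p' : Bool, ∑ q : Bool, ∑ q' : Bool,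
      cornerSign p p' * cornerSign q q' * cosetAvg (qapObjective C) (cond p a i) (cond q b j)
        (cond p' (σ a) (σ i)) (cond q' (σ b) (σ j))| ≤
      960 * (∑ σ, |qapObjective C σ|) / (n ^ 3 * (n - 4).factorial) := by
  classical
  set f := qapObjective C with hf
  set L := ∑ σ, |f σ| with hL
  have hn0 : (0 : ℝ) < n := by exact_mod_cast (by omega : 0 < n)
  have hfac : (0 : ℝ) < (n - 4).factorial := by positivity
  let R : Bool → Fin n := fun p => cond p a i
  let K : Bool → Fin n := fun p => cond p (σ a) (σ i)
  let R' : Bool → Fin n := fun p => cond p b j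
  let K' : Bool → Fin n := fun p => cond p (σ b) (σ j)
  have hRR : ∀ p q, R p ≠ R' q := by
    intro p q
    cases p <;> cases q <;> simp [R, R', hij, hib, haj, hab]
  have hKK : ∀ p q, K p ≠ K' q := by
    intro p q
    cases p <;> cases q <;> simp [K, K', hij, hib, haj, hab]
  let Z : Finset (Fin n) := {i, a, j, b}
  let Z' : Finset (Fin n) := {σ i, σ a, σ j, σ b}
  have hRZ : ∀ p, R p ∈ Z := by intro p; cases p <;> simp [R, Z]
  have hRZ' : ∀ p, R' p ∈ Z := by intro p; cases p <;> simp [R', Z]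
  have hKZ : ∀ p, K p ∈ Z' := by intro p; cases p <;> simp [K, Z']
  have hKZ' : ∀ p, K' p ∈ Z' := by intro p; cases p <;> simp [K', Z']
  -- A single auxiliary pair of rows serves all sixteen cosets; each contributes at most `3nL`,
  -- hence `48nL`.
  obtain ⟨x, y, hx, hy, hxy, hxyle⟩ := exists_good_pair hn
    (fun x y => ∑ c : Bool × Bool × Bool × Bool,
      adjMass f (R c.1) (R' c.2.2.1) (K c.2.1) (K' c.2.2.2) x y)
    (fun x y => sum_nonneg fun c _ => adjMass_nonneg _ _ _ _ _ _ _) (T := 48 * n * L)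
    (by
      have : ∑ x, ∑ y, ∑ c : Bool × Bool × Bool × Bool,
          adjMass f (R c.1) (R' c.2.2.1) (K c.2.1) (K' c.2.2.2) x y =
          ∑ c : Bool × Bool × Bool × Bool, ∑ x, ∑ y,
            adjMass f (R c.1) (R' c.2.2.1) (K c.2.1) (K' c.2.2.2) x y := by
        rw [sum_comm (s := (univ : Finset (Bool × Bool × Bool × Bool)))]
        refine sum_congr rfl fun x _ => ?_
        rw [sum_comm]
      rw [this]
      refine (sum_le_sum fun c _ => sum_adjMass_le (by omega) f _ _ _ _).trans (le_of_eq ?_)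
      simp
      ring) Z (card_le_four.trans (by norm_num))
  have hxne : ∀ p, x ≠ R p := fun p h => hx (h ▸ hRZ p)
  have hxne' : ∀ p, x ≠ R' p := fun p h => hx (h ▸ hRZ' p)
  have hyne : ∀ p, y ≠ R p := fun p h => hy (h ▸ hRZ p)
  have hyne' : ∀ p, y ≠ R' p := fun p h => hy (h ▸ hRZ' p)
  let Ψ : Bool × Bool × Bool × Bool → Fin n → Fin n → ℝ := fun c w v =>
    bilSymm C (rect (R c.1) x (K c.2.1) w) (rect (R' c.2.2.1) y (K' c.2.2.2) v)
  let A : Bool × Bool × Bool × Bool → ℝ := fun c =>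
    cosetAvg f (R c.1) (R' c.2.2.1) (K c.2.1) (K' c.2.2.2)
  -- On its own coset `Ψ c (π x) (π y)` is a second difference of `f`, hence close to `f`, hence to
  -- the coset average.
  have hV : ∀ c : Bool × Bool × Bool × Bool,
      ∑ π ∈ pairCoset (R c.1) (R' c.2.2.1) (K c.2.1) (K' c.2.2.2), |Ψ c (π x) (π y) - A c| ≤
        adjMass f (R c.1) (R' c.2.2.1) (K c.2.1) (K' c.2.2.2) x y + 24 * L / n := by
    intro c
    have h1 := sum_abs_sub_secDiff_le f (K c.2.1) (K' c.2.2.2) (hRR c.1 c.2.2.1) (hxne' c.2.2.1)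
      (hyne c.1) hxy
    have h2 := sum_abs_sub_cosetAvg_le hn C (hRR c.1 c.2.2.1) (hKK c.2.1 c.2.2.2)
    refine le_trans ?_ (add_le_add h1 h2)
    rw [← sum_add_distrib]
    refine sum_le_sum fun π hπ => ?_
    rw [mem_pairCoset] at hπ
    have : Ψ c (π x) (π y) = secDiff f π (R c.1) x (R' c.2.2.1) y := by
      rw [hf, secDiff_eq C π (hxne _).symm (hyne' _).symm (hRR _ _) (hyne _).symm (hxne' _) hxy,
        hπ.1, hπ.2]
    rw [this, abs_sub_comm (f π)]
    exact abs_sub_le _ _ _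
  -- One pair of columns makes all sixteen errors small at once; this passes from a mean bound to a
  -- pointwise one. Here `480 = 96 + 16 * 24`.
  obtain ⟨w, v, hw, hv, hwv, hwvle⟩ := exists_good_pair hn
    (fun w v => if w ∉ Z' ∧ v ∉ Z' ∧ w ≠ v then ∑ c, |Ψ c w v - A c| else 0)
    (fun w v => by
      split_ifs
      · exact sum_nonneg fun c _ => abs_nonneg _
      · exact le_rfl) (T := 480 * L / (n * (n - 4).factorial))
    (by
      have h1 : ∀ c, (n - 4).factorial * (∑ w, ∑ v,
          if w ∉ Z' ∧ v ∉ Z' ∧ w ≠ v then |Ψ c w v - A c| else 0) ≤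
          adjMass f (R c.1) (R' c.2.2.1) (K c.2.1) (K' c.2.2.2) x y + 24 * L / n := fun c =>
        (sum_pairCoset_ge (hRR _ _) (hKK _ _) (hxne _) (hxne' _) (hyne _) (hyne' _) hxy Z'
          (hKZ c.2.1) (hKZ' c.2.2.2) (fun w v => |Ψ c w v - A c|) fun _ _ => abs_nonneg _).trans
          (hV c)
      have h2 := sum_le_sum fun c (_ : c ∈ (univ : Finset (Bool × Bool × Bool × Bool))) => h1 c
      rw [← mul_sum, sum_add_distrib] at h2
      have h3 : (∑ w, ∑ v, if w ∉ Z' ∧ v ∉ Z' ∧ w ≠ v then ∑ c, |Ψ c w v - A c| else 0) =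
          ∑ c, ∑ w, ∑ v, if w ∉ Z' ∧ v ∉ Z' ∧ w ≠ v then |Ψ c w v - A c| else 0 := by
        rw [sum_comm (s := (univ : Finset (Bool × Bool × Bool × Bool)))]
        refine sum_congr rfl fun w _ => ?_
        rw [sum_comm (s := (univ : Finset (Bool × Bool × Bool × Bool)))]
        refine sum_congr rfl fun v _ => ?_
        split_ifs <;> simp
      rw [h3, le_div_iff₀ (by positivity)]
      have h4 : ∑ c : Bool × Bool × Bool × Bool, 24 * L / n = 384 * L / n := by
        simp
        ring
      rw [h4] at h2
      have h5 : 2 * (48 * n * L) / n ^ 2 = 96 * L / (n : ℝ) := by field_simp; ring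
      rw [h5] at hxyle
      have h6 := h2.trans (add_le_add_left hxyle _)
      have h7 : 96 * L / (n : ℝ) + 384 * L / n = 480 * L / n := by ring
      rw [h7, le_div_iff₀ hn0] at h6
      linarith) Z' (card_le_four.trans (by norm_num))
  simp only [hw, hv, hwv, ne_eq, not_false_eq_true, and_self, if_true] at hwvle
  have hexp : secDiff f σ i a j b = ∑ p : Bool, ∑ p' : Bool, ∑ q : Bool, ∑ q' : Bool,
      cornerSign p p' * cornerSign q q' * Ψ (p, p', q, q') w v := by
    rw [hf, secDiff_eq C σ hia hjb hij hib haj hab, rect_eq_sum i a (σ i) (σ a) x w,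
      rect_eq_sum j b (σ j) (σ b) y v]
    simp only [map_sum, LinearMap.sum_apply, map_smul, LinearMap.smul_apply, smul_eq_mul, mul_sum]
    simp only [← mul_assoc, Ψ, R, R', K, K']
    simp only [Fintype.sum_bool]
    ring
  rw [hexp]
  simp only [← sum_sub_distrib, ← mul_sub]
  have hfin : |∑ p : Bool, ∑ p' : Bool, ∑ q : Bool, ∑ q' : Bool,
      cornerSign p p' * cornerSign q q' * (Ψ (p, p', q, q') w v - A (p, p', q, q'))| ≤
      ∑ c, |Ψ c w v - A c| := by
    have e : (∑ p : Bool, ∑ p' : Bool, ∑ q : Bool, ∑ q' : Bool,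
      cornerSign p p' * cornerSign q q' * (Ψ (p, p', q, q') w v - A (p, p', q, q'))) =
      ∑ c : Bool × Bool × Bool × Bool,
        cornerSign c.1 c.2.1 * cornerSign c.2.2.1 c.2.2.2 * (Ψ c w v - A c) := by
      simp only [Fintype.sum_prod_type]
    rw [e]
    refine (abs_sum_le_sum_abs _ _).trans (sum_le_sum fun c _ => ?_)
    rw [abs_mul, abs_mul, abs_cornerSign, abs_cornerSign, one_mul, one_mul]
  refine hfin.trans (hwvle.trans (le_of_eq ?_))
  field_simp
  ring

/-! ### Cosets with large average -/

lemma abs_cosetAvg_le (f : Perm (Fin n) → ℝ) (i j k l : Fin n) :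
    |cosetAvg f i j k l| ≤ (∑ σ, |f σ|) / (n - 2).factorial := by
  have hp : (0 : ℝ) < (n - 2).factorial := by positivity
  rw [cosetAvg, abs_div, abs_of_pos hp]
  gcongr
  exact (abs_sum_le_sum_abs _ _).trans
    (sum_le_sum_of_subset_of_nonneg (subset_univ _) fun _ _ _ => abs_nonneg _)

lemma card_filter_abs_sub_le (hn : 50 ≤ n) (C : Fin n → Fin n → Fin n → Fin n → ℝ)
    {i j k l : Fin n} (hij : i ≠ j) (hkl : k ≠ l) {c : ℝ} (hc : 0 < c) :
    (((pairCoset i j k l).filter fun σ =>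
      c / 2 ≤ |qapObjective C σ - cosetAvg (qapObjective C) i j k l|).card : ℝ) ≤
      48 * (∑ σ, |qapObjective C σ|) / (n * c) := by
  have h := sum_abs_sub_cosetAvg_le hn C hij hkl
  set f := qapObjective C
  have hn0 : (0 : ℝ) < n := by exact_mod_cast (by omega : 0 < n)
  have h2 : (((pairCoset i j k l).filter fun σ => c / 2 ≤ |f σ - cosetAvg f i j k l|).card : ℝ) *
      (c / 2) ≤ ∑ σ ∈ pairCoset i j k l, |f σ - cosetAvg f i j k l| := by
    rw [← nsmul_eq_mul, ← sum_const]
    refine le_trans (sum_le_sum fun σ hσ => (mem_filter.1 hσ).2) ?_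
    exact sum_le_sum_of_subset_of_nonneg (filter_subset _ _) fun _ _ _ => abs_nonneg _
  have h3 := h2.trans h
  rw [le_div_iff₀ hn0] at h3
  rw [le_div_iff₀ (by positivity)]
  linarith

/-- If the average on some coset is at least `c`, then most of the coset lies above `c / 2`. -/
lemma card_filter_ge_of_cosetAvg (hn : 50 ≤ n) (C : Fin n → Fin n → Fin n → Fin n → ℝ)
    {i j k l : Fin n} (hij : i ≠ j) (hkl : k ≠ l) {c s : ℝ} (hc : 0 < c) (hs : s ≤ c / 2)
    (hF : c ≤ cosetAvg (qapObjective C) i j k l) :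
    ((n - 2).factorial : ℝ) - 48 * (∑ σ, |qapObjective C σ|) / (n * c) ≤
      ((univ.filter fun σ => s ≤ qapObjective C σ).card : ℝ) := by
  classical
  have h := card_filter_abs_sub_le hn C hij hkl hc
  set f := qapObjective C
  have hsub : pairCoset i j k l ⊆ (univ.filter fun σ => s ≤ f σ) ∪
      ((pairCoset i j k l).filter fun σ => c / 2 ≤ |f σ - cosetAvg f i j k l|) := by
    intro σ hσ
    by_cases h1 : s ≤ f σ
    · exact mem_union_left _ (by simpa using h1)
    · refine mem_union_right _ (mem_filter.2 ⟨hσ, ?_⟩)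
      rw [abs_sub_comm]
      exact le_trans (by linarith) (le_abs_self _)
  have hcard := (card_le_card hsub).trans (card_union_le _ _)
  rw [card_pairCoset hij hkl] at hcard
  have : ((n - 2).factorial : ℝ) ≤ (univ.filter fun σ => s ≤ f σ).card +
      ((pairCoset i j k l).filter fun σ => c / 2 ≤ |f σ - cosetAvg f i j k l|).card := by
    exact_mod_cast hcard
  linarith

lemma card_filter_abs_ge_of_cosetAvg (hn : 50 ≤ n) (C : Fin n → Fin n → Fin n → Fin n → ℝ)
    {i j k l : Fin n} (hij : i ≠ j) (hkl : k ≠ l) {c : ℝ} (hc : 0 < c)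
    (hF : c ≤ |cosetAvg (qapObjective C) i j k l|) :
    ((n - 2).factorial : ℝ) - 48 * (∑ σ, |qapObjective C σ|) / (n * c) ≤
      (((pairCoset i j k l).filter fun σ => c / 2 ≤ |qapObjective C σ|).card : ℝ) := by
  classical
  have h := card_filter_abs_sub_le hn C hij hkl hc
  set f := qapObjective C
  have hsub : pairCoset i j k l ⊆ ((pairCoset i j k l).filter fun σ => c / 2 ≤ |f σ|) ∪
      ((pairCoset i j k l).filter fun σ => c / 2 ≤ |f σ - cosetAvg f i j k l|) := by
    intro σ hσ
    by_cases h1 : c / 2 ≤ |f σ|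
    · exact mem_union_left _ (mem_filter.2 ⟨hσ, h1⟩)
    · refine mem_union_right _ (mem_filter.2 ⟨hσ, ?_⟩)
      have := abs_sub_abs_le_abs_sub (cosetAvg f i j k l) (f σ)
      rw [abs_sub_comm]
      linarith
  have hcard := (card_le_card hsub).trans (card_union_le _ _)
  rw [card_pairCoset hij hkl] at hcard
  have : ((n - 2).factorial : ℝ) ≤
      ((pairCoset i j k l).filter fun σ => c / 2 ≤ |f σ|).card +
      ((pairCoset i j k l).filter fun σ => c / 2 ≤ |f σ - cosetAvg f i j k l|).card := by
    exact_mod_cast hcard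
  linarith

/-- Quadruples that are neither equal nor swapped either conflict or prescribe a value at a third
point. -/
lemma card_inter_pairCoset_le {i j k l i' j' k' l' : Fin n} (hij : i ≠ j) (hij' : i' ≠ j')
    (h1 : (i', j', k', l') ≠ (i, j, k, l)) (h2 : (i', j', k', l') ≠ (j, i, l, k)) :
    (pairCoset i j k l ∩ pairCoset i' j' k' l').card ≤ (n - 3).factorial := by
  classical
  by_cases hi : i' = i ∨ i' = j
  · by_cases hj : j' = i ∨ j' = j
    · have : pairCoset i j k l ∩ pairCoset i' j' k' l' = ∅ := by
        rw [eq_empty_iff_forall_notMem]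
        intro σ hσ
        simp only [mem_inter, mem_pairCoset] at hσ
        obtain ⟨⟨rfl, rfl⟩, rfl, rfl⟩ := hσ
        rcases hi with rfl | rfl <;> rcases hj with rfl | rfl <;> simp_all
      simp [this]
    · push Not at hj
      refine le_trans (card_le_card ?_) (card_tripleCoset_le hij hj.1.symm hj.2.symm k l l')
      intro σ hσ
      simp only [mem_inter, mem_pairCoset] at hσ
      simp [hσ]
  · push Not at hi
    refine le_trans (card_le_card ?_) (card_tripleCoset_le hij hi.1.symm hi.2.symm k l k')
    intro σ hσ
    simp only [mem_inter, mem_pairCoset] at hσ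
    simp [hσ]

/-- The index quadruples of the cosets on which the average of `f` is at least `c` in absolute
value. -/
noncomputable def largeCosets (f : Perm (Fin n) → ℝ) (c : ℝ) :
    Finset (Fin n × Fin n × Fin n × Fin n) :=
  open Classical in univ.filter fun q => q.1 ≠ q.2.1 ∧ q.2.2.1 ≠ q.2.2.2 ∧
    c ≤ |cosetAvg f q.1 q.2.1 q.2.2.1 q.2.2.2|

lemma mem_largeCosets {f : Perm (Fin n) → ℝ} {c : ℝ} {i j k l : Fin n} :
    (i, j, k, l) ∈ largeCosets f c ↔ i ≠ j ∧ k ≠ l ∧ c ≤ |cosetAvg f i j k l| := by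
  simp [largeCosets]

/-- Double counting: most of each large coset satisfies `|f| ≥ c/2`, at most `2L/c` permutations do,
and cosets overlap little. The term quadratic in `Q.card` pays for overlaps. -/
lemma card_mul_le_of_subset_largeCosets (hn : 50 ≤ n) (C : Fin n → Fin n → Fin n → Fin n → ℝ)
    {c : ℝ} (hc : 0 < c) {Q : Finset (Fin n × Fin n × Fin n × Fin n)}
    (hQ : Q ⊆ largeCosets (qapObjective C) c) :
    Q.card * (((n - 2).factorial : ℝ) - 48 * (∑ σ, |qapObjective C σ|) / (n * c)) ≤
      4 * (∑ σ, |qapObjective C σ|) / c + Q.card ^ 2 * (n - 3).factorial := by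
  classical
  set f := qapObjective C with hf
  set L := ∑ σ, |f σ| with hL
  let V : Fin n × Fin n × Fin n × Fin n → Finset (Perm (Fin n)) := fun q =>
    pairCoset q.1 q.2.1 q.2.2.1 q.2.2.2
  let G : Finset (Perm (Fin n)) := univ.filter fun σ => c / 2 ≤ |f σ|
  let sw : Fin n × Fin n × Fin n × Fin n → Fin n × Fin n × Fin n × Fin n := fun q =>
    (q.2.1, q.1, q.2.2.2, q.2.2.1)
  have hG : (G.card : ℝ) ≤ 2 * L / c := by
    have : (G.card : ℝ) * (c / 2) ≤ L := by
      rw [← nsmul_eq_mul, ← sum_const]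
      refine le_trans (sum_le_sum fun σ hσ => (mem_filter.1 hσ).2) ?_
      exact sum_le_sum_of_subset_of_nonneg (filter_subset _ _) fun _ _ _ => abs_nonneg _
    rw [le_div_iff₀ hc]; linarith
  have hlow : (Q.card : ℝ) * (((n - 2).factorial : ℝ) - 48 * L / (n * c)) ≤
      ∑ q ∈ Q, ((V q ∩ G).card : ℝ) := by
    rw [← nsmul_eq_mul, ← sum_const]
    refine sum_le_sum fun q hq => ?_
    obtain ⟨i, j, k, l⟩ := q
    obtain ⟨hij, hkl, hF⟩ := mem_largeCosets.1 (hQ hq)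
    refine (card_filter_abs_ge_of_cosetAvg hn C hij hkl hc hF).trans (le_of_eq ?_)
    congr 2
    ext σ
    simp [V, G, hf]
  have hswap : ∑ q ∈ Q, (V q ∩ G).card = ∑ σ ∈ G, (Q.filter fun q => σ ∈ V q).card := by
    simp only [card_eq_sum_ones, sum_filter]
    rw [sum_comm]
    refine sum_congr rfl fun q _ => ?_
    rw [← sum_filter]
    refine sum_congr ?_ fun _ _ => rfl
    ext σ; simp [and_comm]
  -- The `2` allows for `q` and `sw q`, which name the same coset. If `σ` lies in more than two
  -- chosen cosets, each of them is paired with a different one.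
  have hpt : ∀ σ ∈ G, (Q.filter fun q => σ ∈ V q).card ≤ 2 +
      ∑ q ∈ Q, ∑ q' ∈ Q, if σ ∈ V q ∩ V q' ∧ q' ≠ q ∧ q' ≠ sw q then 1 else 0 := by
    intro σ _
    set Y := Q.filter fun q => σ ∈ V q with hY
    by_cases h2 : Y.card ≤ 2
    · omega
    · have h3 : ∀ q ∈ Y, 1 ≤ ∑ q' ∈ Q, if σ ∈ V q ∩ V q' ∧ q' ≠ q ∧ q' ≠ sw q then 1 else 0 := by
        intro q hq
        have hex : ∃ q' ∈ Y, q' ∉ ({q, sw q} : Finset _) := by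
          by_contra hcon
          push Not at hcon
          exact h2 ((card_le_card hcon).trans card_le_two)
        obtain ⟨q', hq', hn'⟩ := hex
        simp only [mem_insert, mem_singleton, not_or] at hn'
        refine le_trans ?_ (single_le_sum (fun _ _ => Nat.zero_le _) (mem_filter.1 hq').1)
        rw [if_pos]
        exact ⟨mem_inter.2 ⟨(mem_filter.1 hq).2, (mem_filter.1 hq').2⟩, hn'⟩
      have h4 := sum_le_sum h3
      rw [← card_eq_sum_ones] at h4
      have h5 := sum_le_sum_of_subset (f := fun q => ∑ q' ∈ Q,
        if σ ∈ V q ∩ V q' ∧ q' ≠ q ∧ q' ≠ sw q then 1 else 0) (filter_subset (fun q => σ ∈ V q) Q)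
      rw [← hY] at h5
      exact (h4.trans h5).trans (Nat.le_add_left _ _)
  have hZ : ∑ σ ∈ G, ∑ q ∈ Q, ∑ q' ∈ Q,
      (if σ ∈ V q ∩ V q' ∧ q' ≠ q ∧ q' ≠ sw q then 1 else 0) ≤
      Q.card ^ 2 * (n - 3).factorial := by
    rw [sum_comm]
    have h1 : ∀ q ∈ Q, ∑ σ ∈ G, ∑ q' ∈ Q,
        (if σ ∈ V q ∩ V q' ∧ q' ≠ q ∧ q' ≠ sw q then 1 else 0) ≤
        Q.card * (n - 3).factorial := by
      intro q hq
      rw [sum_comm]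
      refine (sum_le_card_nsmul _ _ (n - 3).factorial fun q' hq' => ?_).trans (by simp)
      rw [← card_filter]
      by_cases hne : q' ≠ q ∧ q' ≠ sw q
      · obtain ⟨i, j, k, l⟩ := q
        obtain ⟨i', j', k', l'⟩ := q'
        have hij := (mem_largeCosets.1 (hQ hq)).1
        have hij' := (mem_largeCosets.1 (hQ hq')).1
        refine le_trans (card_le_card ?_) (card_inter_pairCoset_le hij hij' hne.1 hne.2)
        intro σ hσ
        exact (mem_filter.1 hσ).2.1
      · rw [filter_false_of_mem]
        · simp
        · intro σ _ h; exact hne h.2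
    refine (sum_le_card_nsmul _ _ _ h1).trans (le_of_eq ?_)
    rw [smul_eq_mul]; ring
  have htot : ∑ q ∈ Q, (V q ∩ G).card ≤ 2 * G.card + Q.card ^ 2 * (n - 3).factorial := by
    rw [hswap]
    refine (sum_le_sum hpt).trans ?_
    rw [sum_add_distrib, sum_const, smul_eq_mul]
    omega
  have htot' : ∑ q ∈ Q, ((V q ∩ G).card : ℝ) ≤
      2 * G.card + Q.card ^ 2 * (n - 3).factorial := by exact_mod_cast htot
  have : 4 * L / c = 2 * (2 * L / c) := by ring
  linarith

/-! ### Undoing several transpositions at once -/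

lemma exists_swapsOn {k : ℕ} {u : Fin k ⊕ Fin k → Fin n} (hu : Function.Injective u)
    (D : Finset (Fin k)) : ∃ t, SwapsOn u D t ∧ ∀ σ : Perm (Fin n), permMat (σ * t) = permMat σ -
      ∑ r ∈ D, rect (u (.inl r)) (u (.inr r)) (σ (u (.inl r))) (σ (u (.inr r))) := by
  classical
  induction D using Finset.induction_on with
  | empty => exact ⟨1, swapsOn_one u, by simp⟩
  | insert r D hr ih =>
    obtain ⟨t, ht, hm⟩ := ih
    refine ⟨_, swapsOn_mul_swap hu ht hr, fun σ => ?_⟩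
    rw [← mul_assoc, permMat_mul_swap _ (hu.ne (by simp)), hm σ, sum_insert hr, Perm.mul_apply,
      Perm.mul_apply, ht.left' r hr, ht.right' r hr]
    abel

/-- The expansion of a quadratic function around the product of disjoint transpositions. -/
lemma objective_expand (C : Fin n → Fin n → Fin n → Fin n → ℝ) {k : ℕ}
    {u : Fin k ⊕ Fin k → Fin n} (hu : Function.Injective u) :
    ∃ (t : Perm (Fin n)) (t' : Fin k → Perm (Fin n)), SwapsOn u univ t ∧
      (∀ r, SwapsOn u (univ.erase r) (t' r)) ∧
      ∀ (ω σ : Perm (Fin n)), qapObjective C (ω * σ * ω⁻¹) = qapObjective C (ω * (σ * t) * ω⁻¹) +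
        ∑ r, (qapObjective C (ω * (σ * t' r) * ω⁻¹) - qapObjective C (ω * (σ * t) * ω⁻¹)) +
        1 / 2 * ∑ r, ∑ s ∈ univ.erase r, secDiff (qapObjective C) (ω * σ * ω⁻¹)
          (ω (u (.inl r))) (ω (u (.inr r))) (ω (u (.inl s))) (ω (u (.inr s))) := by
  classical
  obtain ⟨t, ht, hm⟩ := exists_swapsOn hu univ
  choose t' ht' hm' using fun r : Fin k => exists_swapsOn hu (univ.erase r)
  refine ⟨t, t', ht, ht', fun ω σ => ?_⟩
  -- Conjugation by `ω` is absorbed into a relabelled array.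
  let Cω : Fin n → Fin n → Fin n → Fin n → ℝ := fun i j k l => C (ω i) (ω j) (ω k) (ω l)
  have hC : ∀ ρ, qapObjective C (ω * ρ * ω⁻¹) = qapObjective Cω ρ := by
    intro ρ
    simp only [qapObjective, Cω]
    rw [← Equiv.sum_comp ω]
    refine sum_congr rfl fun i _ => ?_
    rw [← Equiv.sum_comp ω]
    simp
  let R : Fin k → Fin n → Fin n → ℝ := fun r =>
    rect (u (.inl r)) (u (.inr r)) (σ (u (.inl r))) (σ (u (.inr r)))
  have hsec : ∀ r, ∀ s ∈ univ.erase r, secDiff (qapObjective C) (ω * σ * ω⁻¹)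
      (ω (u (.inl r))) (ω (u (.inr r))) (ω (u (.inl s))) (ω (u (.inr s))) =
      bilSymm Cω (R r) (R s) := by
    intro r s hs
    have hrs : s ≠ r := (mem_erase.1 hs).1
    rw [← secDiff_eq Cω σ (hu.ne (by simp)) (hu.ne (by simp)) (hu.ne (by simpa using hrs.symm))
      (hu.ne (by simp)) (hu.ne (by simp)) (hu.ne (by simpa using hrs.symm))]
    simp only [secDiff, ← hC]
    simp only [Equiv.swap_apply_apply]
    simp only [mul_assoc, inv_mul_cancel_left]
  -- Since `permMat σ = Q + ∑ R r`, the quadratic form expands around `Q`. The terms linear in `R r`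
  -- together with the square of `R r` form the increment at `t' r`; the mixed terms are second
  -- differences.
  set Q := permMat (σ * t) with hQ
  have e0 : permMat σ = Q + ∑ r, R r := by rw [hQ, hm σ]; simp [R]
  have e1 : ∀ r, permMat (σ * t' r) = Q + R r := by
    intro r
    rw [hm' r σ, e0, ← add_sum_erase _ _ (mem_univ r)]
    simp [R]
    abel
  rw [sum_congr rfl fun r _ => sum_congr rfl (hsec r)]
  simp only [hC, qapObjective_eq_bil, e0, e1, ← hQ]
  have e2 : ∀ r, ∑ s ∈ univ.erase r, bilSymm Cω (R r) (R s) =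
      (∑ s, bilSymm Cω (R r) (R s)) - bilSymm Cω (R r) (R r) := by
    intro r
    rw [← add_sum_erase _ _ (mem_univ r)]; ring
  rw [sum_congr rfl fun r _ => e2 r]
  simp only [bilSymm, map_add, map_sum, LinearMap.add_apply, LinearMap.flip_apply,
    LinearMap.sum_apply, sum_add_distrib, sum_sub_distrib]
  rw [sum_comm (f := fun r s => bil Cω (R s) (R r))]
  ring

/-! ### Second differences and cosets with large average -/

lemma cond_ne_cond {α : Type*} {i a j b : α} (hij : i ≠ j) (hib : i ≠ b) (haj : a ≠ j)
    (hab : a ≠ b) (p q : Bool) : cond p a i ≠ cond q b j := by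
  cases p <;> cases q <;> simpa

/-- The all-`false` corner carries sign `+1`, so there a one-sided bound is enough. -/
lemma sum_corners_le {F : Bool → Bool → Bool → Bool → ℝ} {c : ℝ}
    (h0 : F false false false false ≤ c)
    (h : ∀ p p' q q', (p, p', q, q') ≠ (false, false, false, false) → |F p p' q q'| ≤ c) :
    ∑ p : Bool, ∑ p' : Bool, ∑ q : Bool, ∑ q' : Bool,
      cornerSign p p' * cornerSign q q' * F p p' q q' ≤ 16 * c := by
  have key : ∀ p p' q q', cornerSign p p' * cornerSign q q' * F p p' q q' ≤ c := by
    intro p p' q q'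
    by_cases hb : (p, p', q, q') = (false, false, false, false)
    · simp only [Prod.mk.injEq] at hb
      obtain ⟨rfl, rfl, rfl, rfl⟩ := hb
      simpa [cornerSign] using h0
    · refine (le_abs_self _).trans ?_
      rw [abs_mul, abs_mul, abs_cornerSign, abs_cornerSign, one_mul, one_mul]
      exact h p p' q q' hb
  calc _ ≤ ∑ p : Bool, ∑ p' : Bool, ∑ q : Bool, ∑ q' : Bool, c :=
        sum_le_sum fun p _ => sum_le_sum fun p' _ => sum_le_sum fun q _ => sum_le_sum fun q' _ =>
          key p p' q q'
    _ = 16 * c := by simp; ring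

/-- The corner quadruple of a pattern. -/
def corner (σ : Perm (Fin n)) (i a j b : Fin n) (p p' q q' : Bool) :
    Fin n × Fin n × Fin n × Fin n :=
  (cond p a i, cond q b j, cond p' (σ a) (σ i), cond q' (σ b) (σ j))

lemma secDiff_le_of_corners (hn : 50 ≤ n) (C : Fin n → Fin n → Fin n → Fin n → ℝ)
    (σ : Perm (Fin n)) {i a j b : Fin n} (hia : i ≠ a) (hjb : j ≠ b) (hij : i ≠ j) (hib : i ≠ b)
    (haj : a ≠ j) (hab : a ≠ b) {c : ℝ}
    (hc : ∀ i j k l, i ≠ j → k ≠ l → cosetAvg (qapObjective C) i j k l ≤ c)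
    (h : ∀ p p' q q', (p, p', q, q') ≠ (false, false, false, false) →
      corner σ i a j b p p' q q' ∉ largeCosets (qapObjective C) c) :
    secDiff (qapObjective C) σ i a j b ≤
      16 * c + 960 * (∑ σ, |qapObjective C σ|) / (n ^ 3 * (n - 4).factorial) := by
  have h1 := (abs_le.1 (abs_secDiff_sub_le hn C σ hia hjb hij hib haj hab)).2
  have h2 := sum_corners_le (c := c) (F := fun p p' q q' => cosetAvg (qapObjective C) (cond p a i)
    (cond q b j) (cond p' (σ a) (σ i)) (cond q' (σ b) (σ j)))
    (hc _ _ _ _ hij (σ.injective.ne hij)) ?_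
  · linarith
  · intro p p' q q' hb
    have h3 := h p p' q q' hb
    rw [corner, mem_largeCosets] at h3
    push Not at h3
    exact (h3 (cond_ne_cond hij hib haj hab _ _) (cond_ne_cond (σ.injective.ne hij)
      (σ.injective.ne hib) (σ.injective.ne haj) (σ.injective.ne hab) _ _)).le

lemma secDiff_le (hn : 50 ≤ n) (C : Fin n → Fin n → Fin n → Fin n → ℝ)
    (σ : Perm (Fin n)) {i a j b : Fin n} (hia : i ≠ a) (hjb : j ≠ b) (hij : i ≠ j) (hib : i ≠ b)
    (haj : a ≠ j) (hab : a ≠ b) :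
    secDiff (qapObjective C) σ i a j b ≤ 16 * ((∑ σ, |qapObjective C σ|) / (n - 2).factorial) +
      960 * (∑ σ, |qapObjective C σ|) / (n ^ 3 * (n - 4).factorial) := by
  have h1 := (abs_le.1 (abs_secDiff_sub_le hn C σ hia hjb hij hib haj hab)).2
  have h2 := sum_corners_le (F := fun p p' q q' => cosetAvg (qapObjective C) (cond p a i)
    (cond q b j) (cond p' (σ a) (σ i)) (cond q' (σ b) (σ j)))
    ((le_abs_self _).trans (abs_cosetAvg_le (qapObjective C) _ _ _ _))
    (fun p p' q q' _ => abs_cosetAvg_le (qapObjective C) _ _ _ _)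
  linarith

lemma card_filter_mem_le (Q : Finset (Fin n × Fin n × Fin n × Fin n)) {x₁ x₂ x₃ x₄ : Fin n}
    (h12 : x₁ ≠ x₂) (h : (x₃ ≠ x₁ ∧ x₃ ≠ x₂) ∨ (x₄ ≠ x₁ ∧ x₄ ≠ x₂)) :
    (univ.filter fun ω : Perm (Fin n) => (ω x₁, ω x₂, ω x₃, ω x₄) ∈ Q).card ≤
      Q.card * (n - 3).factorial := by
  classical
  refine le_trans (card_le_card (t := Q.biUnion fun q => univ.filter fun ω : Perm (Fin n) =>
    (ω x₁, ω x₂, ω x₃, ω x₄) = q) ?_) (card_biUnion_le_card_mul _ _ _ ?_)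
  · intro ω hω
    simpa using hω
  · rintro ⟨k, l, o, o'⟩ _
    rcases h with h | h
    · refine le_trans (card_le_card ?_) (card_tripleCoset_le h12 h.1.symm h.2.symm k l o)
      intro ω hω
      simp only [mem_filter, mem_univ, true_and, Prod.mk.injEq] at hω ⊢
      tauto
    · refine le_trans (card_le_card ?_) (card_tripleCoset_le h12 h.1.symm h.2.symm k l o')
      intro ω hω
      simp only [mem_filter, mem_univ, true_and, Prod.mk.injEq] at hω ⊢
      tauto

lemma corner_conj (ω π : Perm (Fin n)) (i a j b : Fin n) (p p' q q' : Bool) :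
    corner (ω * π * ω⁻¹) (ω i) (ω a) (ω j) (ω b) p p' q q' =
      (ω (cond p a i), ω (cond q b j), ω (cond p' (π a) (π i)), ω (cond q' (π b) (π j))) := by
  cases p <;> cases p' <;> cases q <;> cases q' <;> simp [corner]

/-- The excluded corner `(i, j, i, j)` has only two distinct entries. Every other corner has at
least three, so its random relabelling hits a given quadruple for at most `(n-3)!` choices of `ω`.
-/
lemma corner_distinct {π : Perm (Fin n)} {i a j b : Fin n} (hia : i ≠ a) (hjb : j ≠ b)
    (hij : i ≠ j) (hib : i ≠ b) (haj : a ≠ j) (hab : a ≠ b) (hi : π i = i) (hj : π j = j)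
    (ha : π a ≠ a) (hb : π b ≠ b) (ha2 : π (π a) ≠ a)
    {p p' q q' : Bool} (h : (p, p', q, q') ≠ (false, false, false, false)) :
    (cond p' (π a) (π i) ≠ cond p a i ∧ cond p' (π a) (π i) ≠ cond q b j) ∨
      (cond q' (π b) (π j) ≠ cond p a i ∧ cond q' (π b) (π j) ≠ cond q b j) := by
  have e1 : ∀ {x}, π x = i → x = i := fun {x} h => π.injective (h.trans hi.symm)
  have e2 : ∀ {x}, π x = j → x = j := fun {x} h => π.injective (h.trans hj.symm)
  have n1 : π a ≠ i := fun h => hia (e1 h).symm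
  have n2 : π a ≠ j := fun h => haj (e2 h)
  have n3 : π b ≠ i := fun h => hib (e1 h).symm
  have n4 : π b ≠ j := fun h => hjb (e2 h).symm
  have n5 : π a = b → π b ≠ a := by rintro rfl; exact ha2
  have n6 : π a ≠ π b := π.injective.ne hab
  rw [hi, hj]
  revert h
  cases p <;> cases p' <;> cases q <;> cases q' <;> simp <;> grind

/-- The sum of the second differences over any set of conjugating permutations. -/
lemma sum_secDiff_conj_le (hn : 50 ≤ n) (C : Fin n → Fin n → Fin n → Fin n → ℝ) {k : ℕ}
    {u : Fin k ⊕ Fin k → Fin n} (hu : Function.Injective u) {π : Perm (Fin n)}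
    (hπ : π ∈ anchored u) {r s : Fin k} (hrs : r ≠ s) {c : ℝ} (hc0 : 0 ≤ c)
    (hc : ∀ i j k l, i ≠ j → k ≠ l → cosetAvg (qapObjective C) i j k l ≤ c)
    (W : Finset (Perm (Fin n))) :
    ∑ ω ∈ W, secDiff (qapObjective C) (ω * π * ω⁻¹)
      (ω (u (.inl r))) (ω (u (.inr r))) (ω (u (.inl s))) (ω (u (.inr s))) ≤
    W.card * (16 * c + 960 * (∑ σ, |qapObjective C σ|) / (n ^ 3 * (n - 4).factorial)) +
      (16 * (largeCosets (qapObjective C) c).card * (n - 3).factorial : ℕ) *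
        (16 * ((∑ σ, |qapObjective C σ|) / (n - 2).factorial) +
          960 * (∑ σ, |qapObjective C σ|) / (n ^ 3 * (n - 4).factorial)) := by
  classical
  obtain ⟨h1, h2, -⟩ := mem_anchored.1 hπ
  have hLn : 0 ≤ ∑ σ, |qapObjective C σ| := sum_nonneg fun _ _ => abs_nonneg _
  set f := qapObjective C with hf
  set A := 16 * c + 960 * (∑ σ, |f σ|) / (n ^ 3 * (n - 4).factorial) with hA
  set E := 16 * ((∑ σ, |f σ|) / (n - 2).factorial) +
          960 * (∑ σ, |f σ|) / (n ^ 3 * (n - 4).factorial) with hE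
  have hA0 : 0 ≤ A := by positivity
  have hE0 : 0 ≤ E := by positivity
  let T : Finset (Bool × Bool × Bool × Bool) := univ.erase (false, false, false, false)
  let X : Bool × Bool × Bool × Bool → Finset (Perm (Fin n)) := fun v =>
    univ.filter fun ω => corner (ω * π * ω⁻¹) (ω (u (.inl r))) (ω (u (.inr r)))
      (ω (u (.inl s))) (ω (u (.inr s))) v.1 v.2.1 v.2.2.1 v.2.2.2 ∈ largeCosets f c
  have d1 : u (.inl r) ≠ u (.inr r) := hu.ne (by simp)
  have d2 : u (.inl s) ≠ u (.inr s) := hu.ne (by simp)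
  have d3 : u (.inl r) ≠ u (.inl s) := hu.ne (by simpa using hrs)
  have d4 : u (.inl r) ≠ u (.inr s) := hu.ne (by simp)
  have d5 : u (.inr r) ≠ u (.inl s) := hu.ne (by simp)
  have d6 : u (.inr r) ≠ u (.inr s) := hu.ne (by simpa using hrs)
  have hX : ∀ v ∈ T, (X v).card ≤ (largeCosets f c).card * (n - 3).factorial := by
    rintro ⟨p, p', q, q'⟩ hv
    have hv' := (mem_erase.1 hv).1
    simp only [X, corner_conj]
    exact card_filter_mem_le _ (cond_ne_cond d3 d4 d5 d6 _ _) (corner_distinct d1 d2 d3 d4 d5 d6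
      (h1 r) (h1 s) (h2 r).1 (h2 s).1 (h2 r).2 hv')
  have hXc : (T.biUnion X).card ≤ 16 * (largeCosets f c).card * (n - 3).factorial := by
    refine (card_biUnion_le_card_mul _ _ _ hX).trans ?_
    rw [mul_assoc]
    exact Nat.mul_le_mul_right _ (by decide)
  -- Off the exceptional set the corner bound applies; on it the crude bound costs `E` more.
  have hpt : ∀ ω ∈ W, secDiff f (ω * π * ω⁻¹)
      (ω (u (.inl r))) (ω (u (.inr r))) (ω (u (.inl s))) (ω (u (.inr s))) ≤
      A + if ω ∈ T.biUnion X then E else 0 := by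
    intro ω _
    by_cases hω : ω ∈ T.biUnion X
    · rw [if_pos hω]
      have := secDiff_le hn C (ω * π * ω⁻¹) (ω.injective.ne d1) (ω.injective.ne d2)
        (ω.injective.ne d3) (ω.injective.ne d4) (ω.injective.ne d5) (ω.injective.ne d6)
      linarith
    · rw [if_neg hω, add_zero]
      refine secDiff_le_of_corners hn C (ω * π * ω⁻¹) (ω.injective.ne d1) (ω.injective.ne d2)
        (ω.injective.ne d3) (ω.injective.ne d4) (ω.injective.ne d5) (ω.injective.ne d6) hc ?_
      intro p p' q q' hb hmem
      refine hω (mem_biUnion.2 ⟨(p, p', q, q'), mem_erase.2 ⟨hb, mem_univ _⟩, ?_⟩)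
      simpa [X] using hmem
  refine (sum_le_sum hpt).trans ?_
  rw [sum_add_distrib, sum_const, nsmul_eq_mul]
  refine add_le_add le_rfl ?_
  calc ∑ ω ∈ W, (if ω ∈ T.biUnion X then E else 0) ≤ ∑ ω, if ω ∈ T.biUnion X then E else 0 :=
        sum_le_sum_of_subset_of_nonneg (subset_univ _) fun ω _ _ => by split_ifs <;> simp [hE0]
    _ = (T.biUnion X).card * E := by
        rw [← sum_filter, filter_mem_eq_inter, univ_inter, sum_const, nsmul_eq_mul]
    _ ≤ _ := mul_le_mul_of_nonneg_right (by exact_mod_cast hXc) hE0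

/-! ### The averaged second-order inequality -/

lemma sum_secDiff_conj (f : Perm (Fin n) → ℝ) (π : Perm (Fin n)) (i a j b : Fin n) :
    ∑ ω : Perm (Fin n), secDiff f (ω * π * ω⁻¹) (ω i) (ω a) (ω j) (ω b) =
      secDiff (conjSum f) π i a j b := by
  simp only [secDiff, conjSum, sum_add_distrib, sum_sub_distrib, Equiv.swap_apply_apply]
  simp only [mul_assoc, inv_mul_cancel_left]

/-- The expansion is summed over anchored `π` and over those `ω` whose conjugate has value below
`s`. Multiplicity bounds `4HL` for `t` and `16HL` for each `t' r` give the loss `4(k+1) + 16k = 20k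
+ 4`. -/
lemma averaged_inequality (hn : 50 ≤ n) (C : Fin n → Fin n → Fin n → Fin n → ℝ)
    {x₀ x₁ x₂ x₃ : ℝ} (hf : HasConjForm (qapObjective C) x₀ x₁ x₂ x₃) {k : ℕ}
    {u : Fin k ⊕ Fin k → Fin n} (hu : Function.Injective u) (hk : 9 * k + 1 ≤ n)
    (hfac : (n : ℝ) ^ k * (n - 2 * k).factorial ≤ 2 * (n - k).factorial)
    {c s : ℝ} (hc0 : 0 ≤ c) (hs : 0 ≤ s)
    (hc : ∀ i j k l, i ≠ j → k ≠ l → cosetAvg (qapObjective C) i j k l ≤ c) :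
    1 / 2 * (k * (k - 1)) * (n.factorial * (2 * x₂) -
      4 * (k + 3) ^ k * (univ.filter fun σ => s ≤ qapObjective C σ).card *
        (16 * c + 960 * (∑ σ, |qapObjective C σ|) / (n ^ 3 * (n - 4).factorial)) -
      (16 * (largeCosets (qapObjective C) c).card * (n - 3).factorial : ℕ) *
        (16 * ((∑ σ, |qapObjective C σ|) / (n - 2).factorial) +
          960 * (∑ σ, |qapObjective C σ|) / (n ^ 3 * (n - 4).factorial))) -
      (20 * k + 4) * (∑ σ, |qapObjective C σ|) ≤ s * n.factorial := by
  classical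
  obtain ⟨t, t', ht, ht', hexp⟩ := objective_expand C hu
  have hsd := fun π (hπ : π ∈ anchored u) r s (hrs : r ≠ s) (W : Finset (Perm (Fin n))) =>
    sum_secDiff_conj_le hn C hu hπ (r := r) (s := s) hrs hc0 hc W
  have hLn : 0 ≤ ∑ σ, |qapObjective C σ| := sum_nonneg fun _ _ => abs_nonneg _
  set f := qapObjective C with hfdef
  set L := ∑ σ, |f σ| with hL
  set A := 16 * c + 960 * L / (n ^ 3 * (n - 4).factorial) with hA
  set E : ℝ := (16 * (largeCosets f c).card * (n - 3).factorial : ℕ) *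
    (16 * (L / (n - 2).factorial) + 960 * L / (n ^ 3 * (n - 4).factorial)) with hE
  set B := univ.filter fun σ => s ≤ f σ with hB
  have hA0 : 0 ≤ A := by positivity
  have hcard := card_anchored hu hk
  set H : ℝ := ((anchored u).card : ℝ) with hH
  have hHpos : 0 < H := by
    have : (0 : ℝ) < (n - k).factorial := by positivity
    linarith
  have hfac' : (n : ℝ) ^ k * (n - 2 * k).factorial ≤ 4 * H := by linarith
  let W : Perm (Fin n) → Finset (Perm (Fin n)) := fun π => univ.filter fun ω => ω * π * ω⁻¹ ∈ B
  have hW : ∑ π ∈ anchored u, ((W π).card : ℝ) ≤ 4 * H * (k + 3) ^ k * B.card := by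
    have h := sum_conj_anchored_le hu (swapsOn_one u) (fun σ => if σ ∈ B then (1 : ℝ) else 0)
      (fun σ => by split_ifs <;> simp)
    simp only [mul_one, sum_boole, compl_empty, card_univ, Fintype.card_fin] at h
    push_cast at h
    rw [filter_mem_eq_inter, univ_inter] at h
    refine h.trans ?_
    calc (n : ℝ) ^ k * (k + 3) ^ k * (n - 2 * k).factorial * B.card =
        ((n : ℝ) ^ k * (n - 2 * k).factorial) * ((k + 3) ^ k * B.card) := by ring
      _ ≤ (4 * H) * ((k + 3) ^ k * B.card) := by gcongr
      _ = _ := by ring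
  have h0 : ∑ π ∈ anchored u, ∑ ω : Perm (Fin n), |f (ω * (π * t) * ω⁻¹)| ≤ 4 * H * L := by
    have h := sum_conj_anchored_le hu ht (fun σ => |f σ|) fun σ => abs_nonneg _
    simp only [compl_univ, card_empty, pow_zero, mul_one] at h
    push_cast at h
    exact h.trans (mul_le_mul_of_nonneg_right hfac' hLn)
  have hr : ∀ r, ∑ π ∈ anchored u, ∑ ω : Perm (Fin n), |f (ω * (π * t' r) * ω⁻¹)| ≤
      16 * H * L := by
    intro r
    have h := sum_conj_anchored_le hu (ht' r) (fun σ => |f σ|) fun σ => abs_nonneg _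
    have hcr : ((univ.erase r)ᶜ : Finset (Fin k)).card = 1 := by
      rw [card_compl, card_erase_of_mem (mem_univ r), card_univ, Fintype.card_fin]
      have := r.pos
      omega
    rw [hcr] at h
    push_cast at h
    refine h.trans (mul_le_mul_of_nonneg_right ?_ hLn)
    linarith
  have hlow : ∀ π ∈ anchored u,
      1 / 2 * (k * (k - 1)) * (n.factorial * (2 * x₂) - (W π).card * A - E) -
      ((k + 1) * ∑ ω : Perm (Fin n), |f (ω * (π * t) * ω⁻¹)| +
        ∑ r, ∑ ω : Perm (Fin n), |f (ω * (π * t' r) * ω⁻¹)|) ≤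
      s * n.factorial := by
    intro π hπ
    have hup : ∑ ω ∈ (W π)ᶜ, f (ω * π * ω⁻¹) ≤ s * n.factorial := by
      calc ∑ ω ∈ (W π)ᶜ, f (ω * π * ω⁻¹) ≤ ∑ ω ∈ (W π)ᶜ, s := by
            refine sum_le_sum fun ω hω => ?_
            simp only [W, hB, mem_compl, mem_filter, mem_univ, true_and] at hω
            exact (not_le.1 hω).le
        _ = ((W π)ᶜ.card : ℝ) * s := by simp
        _ ≤ n.factorial * s := by
            refine mul_le_mul_of_nonneg_right ?_ hs
            have h := card_le_univ (W π)ᶜ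
            rw [Fintype.card_perm, Fintype.card_fin] at h
            exact_mod_cast h
        _ = _ := mul_comm _ _
    have hsplit : ∑ ω ∈ (W π)ᶜ, f (ω * π * ω⁻¹) =
        ∑ ω ∈ (W π)ᶜ, (f (ω * (π * t) * ω⁻¹) + ∑ r, (f (ω * (π * t' r) * ω⁻¹) -
          f (ω * (π * t) * ω⁻¹))) +
        1 / 2 * ∑ r, ∑ s ∈ univ.erase r, ∑ ω ∈ (W π)ᶜ, secDiff f (ω * π * ω⁻¹)
          (ω (u (.inl r))) (ω (u (.inr r))) (ω (u (.inl s))) (ω (u (.inr s))) := by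
      rw [sum_congr rfl fun ω _ => hexp ω π, sum_add_distrib, ← mul_sum, sum_comm]
      congr 2
      exact sum_congr rfl fun r _ => sum_comm
    have hfirst : -((k + 1) * ∑ ω : Perm (Fin n), |f (ω * (π * t) * ω⁻¹)| +
        ∑ r, ∑ ω : Perm (Fin n), |f (ω * (π * t' r) * ω⁻¹)|) ≤
        ∑ ω ∈ (W π)ᶜ, (f (ω * (π * t) * ω⁻¹) + ∑ r, (f (ω * (π * t' r) * ω⁻¹) -
          f (ω * (π * t) * ω⁻¹))) := by
      rw [neg_le]
      refine (neg_le_abs _).trans ((abs_sum_le_sum_abs _ _).trans ?_)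
      refine (sum_le_sum_of_subset_of_nonneg (subset_univ _) fun _ _ _ => abs_nonneg _).trans ?_
      rw [sum_comm, mul_sum, ← sum_add_distrib]
      refine sum_le_sum fun ω _ => ?_
      refine (abs_add_le _ _).trans ?_
      have : |∑ r, (f (ω * (π * t' r) * ω⁻¹) - f (ω * (π * t) * ω⁻¹))| ≤
          ∑ r, (|f (ω * (π * t' r) * ω⁻¹)| + |f (ω * (π * t) * ω⁻¹)|) :=
        (abs_sum_le_sum_abs _ _).trans (sum_le_sum fun r _ => abs_sub _ _)
      rw [sum_add_distrib, sum_const, card_univ, Fintype.card_fin, nsmul_eq_mul] at this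
      linarith
    -- The sum over all `ω` is known exactly and the part over `W π` is bounded above, so the
    -- complement is bounded below.
    have hsecond : ∀ r, ∀ s ∈ univ.erase r, n.factorial * (2 * x₂) - (W π).card * A - E ≤
        ∑ ω ∈ (W π)ᶜ, secDiff f (ω * π * ω⁻¹)
          (ω (u (.inl r))) (ω (u (.inr r))) (ω (u (.inl s))) (ω (u (.inr s))) := by
      intro r s hs
      have hrs : r ≠ s := (mem_erase.1 hs).1.symm
      have e1 := sum_secDiff_conj f π (u (.inl r)) (u (.inr r)) (u (.inl s)) (u (.inr s))
      rw [secDiff_conjSum hf hu hπ hrs, ← sum_add_sum_compl (W π)] at e1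
      have e2 := hsd π hπ r s hrs (W π)
      linarith
    have hsum : (k * (k - 1) : ℝ) * (n.factorial * (2 * x₂) - (W π).card * A - E) ≤
        ∑ r, ∑ s ∈ univ.erase r, ∑ ω ∈ (W π)ᶜ, secDiff f (ω * π * ω⁻¹)
          (ω (u (.inl r))) (ω (u (.inr r))) (ω (u (.inl s))) (ω (u (.inr s))) := by
      refine le_trans (le_of_eq ?_) (sum_le_sum fun r _ => sum_le_sum (hsecond r))
      have : ∀ r : Fin k, (((univ.erase r).card : ℕ) : ℝ) = k - 1 := by
        intro r
        rw [card_erase_of_mem (mem_univ r), card_univ, Fintype.card_fin, Nat.cast_sub r.pos]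
        simp
      simp only [sum_const, nsmul_eq_mul, this]
      rw [card_univ, Fintype.card_fin]
      ring
    linarith
  have htot := sum_le_sum hlow
  simp only [sum_sub_distrib, sum_add_distrib, ← mul_sum, sum_const, nsmul_eq_mul, ← hH] at htot
  rw [← sum_mul] at htot
  have hrs : ∑ π ∈ anchored u, ∑ r, ∑ ω : Perm (Fin n), |f (ω * (π * t' r) * ω⁻¹)| ≤
      k * (16 * H * L) := by
    rw [sum_comm]
    refine (sum_le_sum fun r _ => hr r).trans ?_
    simp
  have hkk : (0 : ℝ) ≤ 1 / 2 * (k * (k - 1)) := by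
    rcases Nat.eq_zero_or_pos k with h | h
    · simp [h]
    · have : (1 : ℝ) ≤ k := by exact_mod_cast h
      have : 0 ≤ (k : ℝ) - 1 := by linarith
      positivity
  have hWA := mul_le_mul_of_nonneg_left (mul_le_mul_of_nonneg_right hW hA0) hkk
  have h0k := mul_le_mul_of_nonneg_left h0 (by positivity : (0 : ℝ) ≤ k + 1)
  refine le_of_mul_le_mul_left ?_ hHpos
  linarith

/-! ### The lower bound for the number of good permutations near the average -/

/-- `|f|` is twice the positive part minus `f`; the positive part is at most `s` plus the indicator
of `f ≥ s`. -/
lemma sum_abs_le (f : Perm (Fin n) → ℝ) (h0 : ∑ σ, f σ = 0) (h1 : ∀ σ, f σ ≤ 1) {s : ℝ}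
    (hs : 0 ≤ s) : ∑ σ, |f σ| ≤
      2 * (s * n.factorial + (univ.filter fun σ => s ≤ f σ).card) := by
  have h : ∀ σ, |f σ| ≤ 2 * (s + if s ≤ f σ then 1 else 0) - f σ := by
    intro σ
    have := h1 σ
    split_ifs with hσ
    · rw [abs_of_nonneg (hs.trans hσ)]; linarith
    · push Not at hσ
      rw [abs_le]; constructor <;> linarith
  refine (sum_le_sum fun σ _ => h σ).trans (le_of_eq ?_)
  rw [sum_sub_distrib, h0, ← mul_sum, sum_add_distrib, sum_boole, sum_const, card_univ,
    Fintype.card_perm, Fintype.card_fin, nsmul_eq_mul]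
  ring

lemma HasConjForm.le_coef_two {f : Perm (Fin n) → ℝ} {x₀ x₁ x₂ x₃ e : ℝ}
    (hf : HasConjForm f x₀ x₁ x₂ x₃) (hn : 2 ≤ n) (h1 : f 1 = 1) (hx₀ : |x₀| ≤ e) (hx₁ : |x₁| ≤ e)
    (he : e * (n + 1) ≤ 1 / 2) : 1 / (2 * (n : ℝ) ^ 2) ≤ x₂ := by
  have hp : (n.factorial : ℝ) ≠ 0 := by positivity
  have hfix : fixCard (1 : Perm (Fin n)) = n := by simp [fixCard]
  have hinv : invCard (1 : Perm (Fin n)) = 0 := by simp [invCard]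
  have h := hf 1
  rw [hfix, hinv] at h
  have hc : conjSum f 1 = n.factorial := by
    simp [conjSum, h1, Fintype.card_perm]
  rw [hc] at h
  have h' : x₀ + x₁ * n + x₂ * (n * (n - 1)) + x₃ * (0 : ℕ) = 1 := by
    apply mul_left_cancel₀ hp; linarith
  simp only [Nat.cast_zero, mul_zero, add_zero] at h'
  have hn2 : (2 : ℝ) ≤ n := by exact_mod_cast hn
  have a0 := (abs_le.1 hx₀).2
  have a1 := mul_le_mul_of_nonneg_right (abs_le.1 hx₁).2 (by linarith : (0 : ℝ) ≤ n)
  have h2 : 1 / 2 ≤ x₂ * (n * (n - 1)) := by linarith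
  have hx : 0 ≤ x₂ := by
    by_contra hneg
    push Not at hneg
    have : x₂ * (n * (n - 1)) ≤ 0 := mul_nonpos_of_nonpos_of_nonneg hneg.le
      (mul_nonneg (by linarith) (by linarith))
    linarith
  rw [div_le_iff₀ (by positivity)]
  nlinarith

/-- Bernoulli's inequality gives `(1 - 2k/n)^k ≥ 1 - 2k²/n ≥ 1/2`. -/
lemma pow_mul_factorial_le {k : ℕ} (hk : 2 * k ≤ n) (hn : 4 * k ^ 2 ≤ n) (hn0 : 0 < n) :
    (n : ℝ) ^ k * (n - 2 * k).factorial ≤ 2 * (n - k).factorial := by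
  have hn' : (0 : ℝ) < n := by exact_mod_cast hn0
  have h1 : (n - k).factorial = (n - 2 * k).factorial * (n - k).descFactorial k := by
    rw [← Nat.factorial_mul_descFactorial (by omega : k ≤ n - k)]
    congr 2; omega
  have h2 : (n - 2 * k) ^ k ≤ (n - k).descFactorial k := by
    refine le_trans (Nat.pow_le_pow_left ?_ _) (Nat.pow_sub_le_descFactorial (n - k) k)
    omega
  have h3 : (n : ℝ) ^ k ≤ 2 * ((n - 2 * k : ℕ) : ℝ) ^ k := by
    have hb := one_add_mul_le_pow (a := -(2 * k / n : ℝ)) (by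
      have : (2 * k / n : ℝ) ≤ 1 := by
        rw [div_le_one hn']; exact_mod_cast hk
      linarith) k
    have hq : (k : ℝ) * (2 * k / n) ≤ 1 / 2 := by
      rw [← mul_div_assoc, div_le_iff₀ hn']
      have : (4 * k ^ 2 : ℝ) ≤ n := by exact_mod_cast hn
      nlinarith
    have e : ((n - 2 * k : ℕ) : ℝ) = n * (1 + -(2 * k / n)) := by
      rw [Nat.cast_sub hk]; push_cast; field_simp; ring
    rw [e, mul_pow]
    have hp : (0 : ℝ) < (n : ℝ) ^ k := by positivity
    nlinarith
  rw [h1]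
  have h2' : ((n - 2 * k : ℕ) : ℝ) ^ k ≤ (n - k).descFactorial k := by exact_mod_cast h2
  have hp : (0 : ℝ) ≤ (n - 2 * k).factorial := by positivity
  push_cast
  nlinarith

lemma factorial_bounds (hn : 4 ≤ n) :
    (n : ℝ) ^ 2 * (n - 2).factorial ≤ 2 * n.factorial ∧
    (n.factorial : ℝ) ≤ (n : ℝ) ^ 2 * (n - 2).factorial ∧
    (n : ℝ) ^ 3 * (n - 3).factorial ≤ 8 * n.factorial ∧
    (n.factorial : ℝ) ≤ (n : ℝ) ^ 4 * (n - 4).factorial ∧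
    (n - 2).factorial = (n - 2 : ℝ) * (n - 3).factorial := by
  obtain ⟨m, rfl⟩ : ∃ m, n = m + 4 := ⟨n - 4, by omega⟩
  simp only [Nat.add_sub_cancel, show m + 4 - 2 = m + 2 by omega, show m + 4 - 3 = m + 1 by omega,
    Nat.factorial_succ]
  push_cast
  have hm : (0 : ℝ) ≤ m := by positivity
  have hf : (0 : ℝ) < m.factorial := by positivity
  refine ⟨?_, ?_, ?_, ?_, by ring⟩
  · have : ((m : ℝ) + 4) ^ 2 * ((m + 1 + 1) * (m + 1)) ≤
        2 * ((m + 3 + 1) * ((m + 2 + 1) * ((m + 1 + 1) * (m + 1)))) := by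
      have : 0 ≤ ((m : ℝ) + 4) * ((m + 2) * (m + 1)) := by positivity
      nlinarith
    nlinarith
  · have : ((m : ℝ) + 3 + 1) * ((m + 2 + 1) * ((m + 1 + 1) * (m + 1))) ≤
        (m + 4) ^ 2 * ((m + 1 + 1) * (m + 1)) := by
      have : 0 ≤ ((m : ℝ) + 4) * ((m + 2) * (m + 1)) := by positivity
      nlinarith
    nlinarith
  · have : ((m : ℝ) + 4) ^ 3 * (m + 1) ≤
        8 * ((m + 3 + 1) * ((m + 2 + 1) * ((m + 1 + 1) * (m + 1)))) := by
      have h1 : ((m : ℝ) + 4) ^ 2 ≤ 8 * ((m + 3) * (m + 2)) := by nlinarith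
      have h2 : 0 ≤ ((m : ℝ) + 4) * (m + 1) := by positivity
      nlinarith
    nlinarith
  · have : ((m : ℝ) + 3 + 1) * ((m + 2 + 1) * ((m + 1 + 1) * (m + 1))) ≤ (m + 4) ^ 4 := by
      rw [← sub_nonneg]; ring_nf; positivity
    nlinarith

lemma card_largeCosets_lt (hn : 50 ≤ n) (C : Fin n → Fin n → Fin n → Fin n → ℝ) {c K : ℝ}
    (hc : 0 < c) (hK : 0 ≤ K) (hL : ∑ σ, |qapObjective C σ| ≤ K * (n - 2).factorial)
    (hnc : 96 * K / c ≤ n) {M : ℕ} (hM : 16 * K / c < M) (hnM : 4 * (M : ℝ) + 2 ≤ n) :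
    (largeCosets (qapObjective C) c).card < M := by
  by_contra hcon
  push Not at hcon
  -- A subfamily of exactly `M` cosets keeps the quadratic overlap term under control.
  obtain ⟨Q, hQ, hQM⟩ := exists_subset_card_eq hcon
  have h := card_mul_le_of_subset_largeCosets hn C hc hQ
  rw [hQM] at h
  set L := ∑ σ, |qapObjective C σ|
  have hn0 : (0 : ℝ) < n := by exact_mod_cast (by omega : 0 < n)
  obtain ⟨-, -, -, -, hfac⟩ := factorial_bounds (by omega : 4 ≤ n)
  have hp : (0 : ℝ) < (n - 2).factorial := by positivity
  have hp3 : (0 : ℝ) < (n - 3).factorial := by positivity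
  have hMpos : (0 : ℝ) < M := lt_of_le_of_lt (by positivity) hM
  have h1 : 48 * L / (n * c) ≤ 1 / 2 * (n - 2).factorial := by
    rw [div_le_iff₀ hc] at hnc
    rw [div_le_iff₀ (by positivity)]
    nlinarith
  have h2 : 4 * L / c < 1 / 4 * M * (n - 2).factorial := by
    rw [div_lt_iff₀ hc] at hM
    rw [div_lt_iff₀ hc]
    nlinarith
  have h3 : (M : ℝ) ^ 2 * (n - 3).factorial ≤ 1 / 4 * M * (n - 2).factorial := by
    rw [hfac]
    have : (M : ℝ) * (4 * M) ≤ M * (n - 2) := by gcongr; linarith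
    nlinarith
  have h4 := mul_le_mul_of_nonneg_left h1 hMpos.le
  linarith

set_option maxHeartbeats 1000000 in
/-- A quadratic function with average zero and maximum `f 1 = 1` is at least `α / n ^ 2` with
probability at least `(1 - η) / n ^ 2`, for large `n`. -/
theorem exists_le_card_filter {α η : ℝ} (hα : 0 < α) (hη : 0 < η) (hη1 : η < 1) :
    ∃ N : ℕ, ∀ n : ℕ, N ≤ n → ∀ C : Fin n → Fin n → Fin n → Fin n → ℝ,
      ∑ σ, qapObjective C σ = 0 → (∀ σ, qapObjective C σ ≤ 1) → qapObjective C 1 = 1 →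
      (1 - η) * (n.factorial / (n : ℝ) ^ 2) ≤
        (univ.filter fun σ => α / (n : ℝ) ^ 2 ≤ qapObjective C σ).card := by
  -- Chosen so that fewer than `T = n! / n²` good permutations force `L ≤ K T`.
  set K : ℝ := 2 * (α + 1) with hK
  have hK0 : 0 < K := by positivity
  -- Makes `k(k-1)/4` exceed `α + (20k+4)K`, the final contradiction.
  obtain ⟨k, hk⟩ := exists_nat_ge (1 + 4 * (24 * K + α + 1))
  set P : ℝ := 4 * (k + 3) ^ k with hP
  have hP0 : 0 < P := by positivity
  -- Only after `k` is fixed can `c` be chosen: `P * 16c = 1/8` keeps the cost of discarding good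
  -- conjugates, whose multiplicity grows with `P`, below a fixed share of `T`.
  set c : ℝ := 1 / (128 * P) with hc
  have hc0 : 0 < c := by positivity
  have hPc : P * (16 * c) = 1 / 8 := by rw [hc]; field_simp; norm_num
  obtain ⟨M, hM⟩ := exists_nat_gt (16 * K / c)
  obtain ⟨N, hN⟩ := exists_nat_ge (960 + (9 * k + 1) + 4 * (k : ℝ) ^ 2 + 4000 * K + 96 * K / c +
    (4 * M + 2) + 2 * α / c + 48 * K / (c * η) + 7680 * P * K + 8704 * M * K)
  refine ⟨N, fun n hNn C h0 h1 hf1 => ?_⟩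
  have hn : 960 + (9 * k + 1) + 4 * (k : ℝ) ^ 2 + 4000 * K + 96 * K / c +
    (4 * M + 2) + 2 * α / c + 48 * K / (c * η) + 7680 * P * K + 8704 * M * K ≤ n :=
    hN.trans (by exact_mod_cast hNn)
  clear hN hNn
  have q1 : (0 : ℝ) ≤ 4 * (k : ℝ) ^ 2 := by positivity
  have q2 : (0 : ℝ) ≤ 9 * k + 1 := by positivity
  have q3 : (0 : ℝ) ≤ 4000 * K := by positivity
  have q4 : 0 ≤ 96 * K / c := by positivity
  have q5 : (0 : ℝ) ≤ 4 * M + 2 := by positivity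
  have q6 : 0 ≤ 2 * α / c := by positivity
  have q7 : 0 ≤ 48 * K / (c * η) := by positivity
  have q8 : 0 ≤ 7680 * P * K := by positivity
  have q9 : 0 ≤ 8704 * M * K := by positivity
  have n1 : (960 : ℝ) ≤ n := by linarith
  have n2 : (9 * k + 1 : ℝ) ≤ n := by linarith
  have n3 : 4 * (k : ℝ) ^ 2 ≤ n := by linarith
  have n4 : 4000 * K ≤ n := by linarith
  have n5 : 96 * K / c ≤ n := by linarith
  have n6 : (4 * M + 2 : ℝ) ≤ n := by linarith
  have n7 : 2 * α / c ≤ n := by linarith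
  have n8 : 48 * K / (c * η) ≤ n := by linarith
  have n9 : 7680 * P * K ≤ n := by linarith
  have n10 : 8704 * M * K ≤ n := by linarith
  clear hn
  have m1 : 960 ≤ n := by exact_mod_cast n1
  have m2 : 9 * k + 1 ≤ n := by exact_mod_cast n2
  have m3 : 4 * k ^ 2 ≤ n := by exact_mod_cast n3
  have hn0 : (0 : ℝ) < n := by linarith
  by_contra hcon
  push Not at hcon
  obtain ⟨x₀, x₁, x₂, x₃, hform⟩ := exists_conjSum_form (by omega : 4 ≤ n) C
  have hform : HasConjForm (qapObjective C) x₀ x₁ x₂ x₃ := hform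
  have hs0 : 0 ≤ α / (n : ℝ) ^ 2 := by positivity
  have hLs := sum_abs_le (qapObjective C) h0 h1 hs0
  have hcoef := hform.coef_bound (by omega) h0
  obtain ⟨g1, g2, g3, g4, -⟩ := factorial_bounds (by omega : 4 ≤ n)
  have havg := fun i j k l (hij : i ≠ j) (hkl : k ≠ l) =>
    card_filter_ge_of_cosetAvg (by omega) C (i := i) (j := j) (k := k) (l := l) hij hkl hc0
      (s := α / (n : ℝ) ^ 2)
  have hlarge := fun hL => card_largeCosets_lt (by omega) C hc0 hK0.le hL n5 hM n6
  have hineq := fun hcav => averaged_inequality (by omega) C hform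
    (firstPoints_injective (by omega : k + k ≤ n)) m2
    (pow_mul_factorial_le (by omega) m3 (by omega)) hc0.le hs0 hcav
  have hLn : 0 ≤ ∑ σ, |qapObjective C σ| := sum_nonneg fun _ _ => abs_nonneg _
  set f := qapObjective C with hf
  set L := ∑ σ, |f σ| with hL
  set T : ℝ := n.factorial / (n : ℝ) ^ 2 with hT
  have hT0 : 0 < T := by positivity
  have hTn : T * (n : ℝ) ^ 2 = n.factorial := by rw [hT]; field_simp
  set b : ℝ := ((univ.filter fun σ => α / (n : ℝ) ^ 2 ≤ f σ).card : ℝ) with hb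
  have hb0 : 0 ≤ b := by positivity
  have hbT : b ≤ T := hcon.le.trans (mul_le_of_le_one_left hT0.le (by linarith))
  have hsT : α / (n : ℝ) ^ 2 * n.factorial = α * T := by rw [hT]; ring
  have hLK : L ≤ K * T := by rw [hsT] at hLs; rw [hK]; linarith
  have hT2 : T ≤ (n - 2).factorial := by
    rw [hT, div_le_iff₀ (by positivity)]; linarith
  have hL2 : L ≤ K * (n - 2).factorial := hLK.trans (mul_le_mul_of_nonneg_left hT2 hK0.le)
  clear_value b T L f c P K
  have hx2 : 1 / (2 * (n : ℝ) ^ 2) ≤ x₂ := by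
    refine hform.le_coef_two (e := 1000 * (L / n.factorial)) (by omega) hf1 hcoef.1 hcoef.2.1 ?_
    have h2 : L / n.factorial ≤ K / (n : ℝ) ^ 2 := by
      rw [← hTn, div_le_div_iff₀ (by positivity) (by positivity)]
      calc L * (n : ℝ) ^ 2 ≤ K * T * (n : ℝ) ^ 2 := by gcongr
        _ = _ := by ring
    calc 1000 * (L / n.factorial) * (n + 1) ≤ 1000 * (K / (n : ℝ) ^ 2) * (2 * n) := by
          gcongr; linarith
      _ = 2000 * K / n := by field_simp; ring
      _ ≤ 1 / 2 := by rw [div_le_iff₀ hn0]; linarith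
  -- Otherwise a share of at least `1 - η` of one coset would be good, against the assumed count.
  have hcav : ∀ i j k l, i ≠ j → k ≠ l → cosetAvg f i j k l ≤ c := by
    intro i j k l hij hkl
    by_contra hlt
    push Not at hlt
    have hs : α / (n : ℝ) ^ 2 ≤ c / 2 := by
      rw [div_le_iff₀ hc0] at n7
      rw [div_le_iff₀ (by positivity)]
      calc α ≤ c / 2 * (n * 1) := by linarith
        _ ≤ c / 2 * (n * n) := by gcongr; linarith
        _ = _ := by ring
    have h2 := havg i j k l hij hkl hs hlt.le
    have h3 : 48 * L / (n * c) ≤ η * (n - 2).factorial := by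
      rw [div_le_iff₀ (by positivity)] at n8
      rw [div_le_iff₀ (by positivity)]
      calc 48 * L ≤ 48 * (K * (n - 2).factorial) := by gcongr
        _ = 48 * K * (n - 2).factorial := by ring
        _ ≤ n * (c * η) * (n - 2).factorial := by gcongr
        _ = _ := by ring
    have h4 : (1 - η) * T ≤ (1 - η) * (n - 2).factorial :=
      mul_le_mul_of_nonneg_left hT2 (by linarith)
    linarith
  have hQ := hlarge hL2
  have hmain := hineq hcav
  rw [hsT, ← hP] at hmain
  have hr : 960 * L / (n ^ 3 * (n - 4).factorial) ≤ 960 * K / n := by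
    rw [div_le_div_iff₀ (by positivity) hn0]
    have : L * n ≤ K * (n ^ 3 * (n - 4).factorial) := by
      refine le_of_mul_le_mul_right ?_ hn0
      calc L * n * n ≤ K * T * n * n := by gcongr
        _ = K * (T * n ^ 2) := by ring
        _ ≤ K * (n ^ 4 * (n - 4).factorial) := by rw [hTn]; gcongr
        _ = _ := by ring
    linarith
  have hr0 : 0 ≤ 960 * L / (n ^ 3 * (n - 4).factorial) := by positivity
  set ρ := 960 * L / (n ^ 3 * (n - 4).factorial) with hρ
  have hPρ : P * ρ ≤ 1 / 8 := by
    calc P * ρ ≤ P * (960 * K / n) := by gcongr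
      _ = 960 * P * K / n := by ring
      _ ≤ 1 / 8 := by rw [div_le_iff₀ hn0]; linarith
  have hterm1 : P * b * (16 * c + ρ) ≤ 1 / 4 * T := by
    have : P * (16 * c + ρ) ≤ 1 / 4 := by rw [mul_add, hPc]; linarith
    calc P * b * (16 * c + ρ) = b * (P * (16 * c + ρ)) := by ring
      _ ≤ T * (1 / 4) := by gcongr
      _ = _ := by ring
  have hρK : ρ ≤ K := by
    refine hr.trans ?_
    rw [div_le_iff₀ hn0, mul_comm]
    gcongr
  have hL3 : L / (n - 2).factorial ≤ K := by
    rw [div_le_iff₀ (by positivity)]; exact hL2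
  have h3f : ((n - 3).factorial : ℝ) ≤ 8 * T / n := by
    rw [le_div_iff₀ hn0]
    refine le_of_mul_le_mul_right ?_ (by positivity : (0 : ℝ) < (n : ℝ) ^ 2)
    calc ((n - 3).factorial : ℝ) * n * (n : ℝ) ^ 2 = (n : ℝ) ^ 3 * (n - 3).factorial := by ring
      _ ≤ 8 * (n.factorial : ℝ) := g3
      _ = _ := by rw [← hTn]; ring
  have hterm2 : ((16 * (largeCosets f c).card * (n - 3).factorial : ℕ) : ℝ) *
      (16 * (L / (n - 2).factorial) + ρ) ≤ 1 / 4 * T := by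
    have hQ' : ((largeCosets f c).card : ℝ) ≤ M := by exact_mod_cast hQ.le
    push_cast
    calc (16 : ℝ) * (largeCosets f c).card * (n - 3).factorial * (16 * (L / (n - 2).factorial) + ρ)
        ≤ 16 * M * (8 * T / n) * (16 * K + K) := by gcongr
      _ = T * (2176 * M * K / n) := by ring
      _ ≤ T * (1 / 4) := by
          refine mul_le_mul_of_nonneg_left ?_ hT0.le
          rw [div_le_iff₀ hn0]; linarith
      _ = _ := by ring
  have hterm0 : T ≤ n.factorial * (2 * x₂) := by
    calc T = n.factorial * (2 * (1 / (2 * (n : ℝ) ^ 2))) := by rw [hT]; field_simp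
      _ ≤ _ := by gcongr
  have hk1 : (1 : ℝ) ≤ k := by linarith
  have hkk : (0 : ℝ) ≤ 1 / 2 * (k * (k - 1)) := by
    have : 0 ≤ (k : ℝ) - 1 := by linarith
    positivity
  have hbr : 1 / 2 * (k * (k - 1)) * (1 / 2 * T) ≤ 1 / 2 * (k * (k - 1)) *
      (n.factorial * (2 * x₂) - P * b * (16 * c + ρ) -
      ((16 * (largeCosets f c).card * (n - 3).factorial : ℕ) : ℝ) *
      (16 * (L / (n - 2).factorial) + ρ)) := by
    refine mul_le_mul_of_nonneg_left ?_ hkk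
    linarith
  have hLk : (20 * k + 4) * L ≤ (20 * k + 4) * (K * T) := by gcongr
  have hfin : 1 / 4 * (k * (k - 1)) * T ≤ (α + (20 * k + 4) * K) * T := by linarith
  have hfin2 := le_of_mul_le_mul_right hfin hT0
  have e1 : (k : ℝ) * (24 * K + α + 1) ≤ k * (1 / 4 * (k - 1)) := by gcongr; linarith
  have e2 : K ≤ k * K := le_mul_of_one_le_left hK0.le hk1
  have e3 : α ≤ k * α := le_mul_of_one_le_left hα.le hk1
  linarith

/-! ### Values further away from the average -/

/-- Both sides bound the mean of the conjugation average over permutations fixing `k` points and at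
most three more. Below: `x₀` and `x₁` cost `e(k+4)`, and `|x₃| ≤ 3e` with mean of `q` at most `4/3`
costs `4e`. Above: `f ≤ s` plus the indicator of `f ≥ s`, with the multiplicity bound. -/
lemma fixing_inequality {f : Perm (Fin n) → ℝ} {x₀ x₁ x₂ x₃ e y s : ℝ}
    (hf : HasConjForm f x₀ x₁ x₂ x₃) (h0 : ∑ σ, f σ = 0) (h1 : ∀ σ, f σ ≤ 1) (hs : 0 ≤ s)
    (hx₀ : |x₀| ≤ e) (hx₁ : |x₁| ≤ e) (hx₂ : |x₂| ≤ e) (hy : y ≤ x₂) (hy0 : 0 ≤ y)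
    {k : ℕ} (hk : 1 ≤ k) (hkn : k + 2 ≤ n) :
    y * (k * (k - 1)) - e * (k + 8) ≤
      s + 4 / 3 * (k + 3) ^ k * ((univ.filter fun σ => s ≤ f σ).card / n.factorial) := by
  classical
  obtain ⟨S, -, hS⟩ := exists_subset_card_eq (s := (univ : Finset (Fin n))) (n := k)
    (by simp; omega)
  have hz := hf.sum_eq_zero (by omega) h0
  have he : 0 ≤ e := (abs_nonneg _).trans hx₀
  have hx₃ : |x₃| ≤ 3 * e := by
    rw [abs_le] at *; constructor <;> linarith
  have hcard := card_filter_fixing_fixCard_le S (by omega)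
  have hinv := sum_fixing_invCard S (by omega)
  have hB := sum_conj_fixing_le S (fun σ => if s ≤ f σ then (1 : ℝ) else 0)
    (fun σ => by split_ifs <;> simp)
  rw [hS] at hcard hinv hB
  set G := (fixing S).filter fun π => fixCard π ≤ k + 3 with hG
  set g : ℝ := (G.card : ℝ) with hg
  set b : ℝ := ((univ.filter fun σ => s ≤ f σ).card : ℝ) with hb
  have hp : (0 : ℝ) < n.factorial := by positivity
  have hpk : (0 : ℝ) < (n - k).factorial := by positivity
  have hgpos : 0 < g := by linarith
  have hk1 : (1 : ℝ) ≤ k := by exact_mod_cast hk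
  have hlow : n.factorial * (g * (y * (k * (k - 1)) - e * (k + 8))) ≤
      ∑ π ∈ G, conjSum f π := by
    have hpt : ∀ π ∈ G, n.factorial * (y * (k * (k - 1)) - e * (k + 4) - 3 * e * invCard π) ≤
        conjSum f π := by
      intro π hπ
      rw [hf π]
      refine mul_le_mul_of_nonneg_left ?_ hp.le
      have hge : k ≤ fixCard π := by
        rw [← hS]
        exact card_le_card fun x hx => by simp [mem_fixing.1 (mem_filter.1 hπ).1 x hx]
      have hge' : (k : ℝ) ≤ fixCard π := by exact_mod_cast hge
      have hle' : (fixCard π : ℝ) ≤ k + 3 := by exact_mod_cast (mem_filter.1 hπ).2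
      have hi0 : (0 : ℝ) ≤ invCard π := by positivity
      have a0 := (abs_le.1 hx₀).1
      have a1 : -(e * (k + 3)) ≤ x₁ * fixCard π := by
        have := mul_le_mul_of_nonneg_right (abs_le.1 hx₁).1 (by linarith : (0 : ℝ) ≤ fixCard π)
        nlinarith
      have a2 : y * (k * (k - 1)) ≤ x₂ * (fixCard π * (fixCard π - 1)) := by
        have h2 : (k * (k - 1) : ℝ) ≤ fixCard π * (fixCard π - 1) := by nlinarith
        have h3 : (0 : ℝ) ≤ k * (k - 1) := mul_nonneg (by linarith) (by linarith)
        exact mul_le_mul hy h2 h3 (hy0.trans hy)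
      have a3 := mul_le_mul_of_nonneg_right (abs_le.1 hx₃).1 hi0
      linarith
    refine le_trans ?_ (sum_le_sum hpt)
    rw [← mul_sum]
    refine mul_le_mul_of_nonneg_left ?_ hp.le
    rw [sum_sub_distrib, ← mul_sum, sum_const, nsmul_eq_mul, ← hg]
    have hi : ∑ π ∈ G, (invCard π : ℝ) ≤ (n - k).factorial := by
      rw [← hinv]
      exact sum_le_sum_of_subset_of_nonneg (filter_subset _ _) fun _ _ _ => by positivity
    have h3 : 3 * e * ∑ π ∈ G, (invCard π : ℝ) ≤ 3 * e * (4 / 3 * g) :=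
      mul_le_mul_of_nonneg_left (by linarith) (by positivity)
    linarith
  have hup : ∑ π ∈ G, conjSum f π ≤
      n.factorial * (g * (s + 4 / 3 * (k + 3) ^ k * (b / n.factorial))) := by
    have hpt : ∀ π ∈ G, conjSum f π ≤ n.factorial * s +
        ∑ ω : Perm (Fin n), if s ≤ f (ω * π * ω⁻¹) then (1 : ℝ) else 0 := by
      intro π _
      have : ∀ ω : Perm (Fin n), f (ω * π * ω⁻¹) ≤
          s + if s ≤ f (ω * π * ω⁻¹) then (1 : ℝ) else 0 := by
        intro ω
        have := h1 (ω * π * ω⁻¹)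
        split_ifs with h <;> linarith
      refine (sum_le_sum fun ω _ => this ω).trans (le_of_eq ?_)
      rw [sum_add_distrib, sum_const, card_univ, Fintype.card_perm, Fintype.card_fin, nsmul_eq_mul]
    refine (sum_le_sum hpt).trans ?_
    rw [sum_add_distrib, sum_const, nsmul_eq_mul, ← hg]
    rw [sum_boole, ← hb] at hB
    push_cast at hB
    have h2 : ((k : ℝ) + 3) ^ k * (n - k).factorial * b ≤ (k + 3) ^ k * (4 / 3 * g) * b := by
      gcongr; linarith
    have h3 : (n.factorial : ℝ) * (g * (s + 4 / 3 * (k + 3) ^ k * (b / n.factorial))) =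
        g * (n.factorial * s) + (k + 3) ^ k * (4 / 3 * g) * b := by
      field_simp
    rw [h3]
    exact add_le_add le_rfl (hB.trans h2)
  exact le_of_mul_le_mul_left (le_of_mul_le_mul_left (hlow.trans hup) hp) hgpos

lemma eventually_parameters {ε δ D : ℝ} (hε : 0 < ε) (hδ : 1 - ε < δ) :
    ∃ N : ℕ, ∀ n : ℕ, N ≤ n → 3 ≤ n ∧ 1 ≤ Real.log n ∧ D ≤ (n : ℝ) ^ ε ∧
      D * Real.log n ≤ (n : ℝ) ^ (δ - (1 - ε)) := by
  have t := tendsto_natCast_atTop_atTop (R := ℝ)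
  have h1 := (Real.tendsto_log_atTop.comp t).eventually_ge_atTop 1
  have h2 := ((tendsto_rpow_atTop hε).comp t).eventually_ge_atTop D
  have h3 := (isLittleO_log_rpow_atTop (by linarith : 0 < δ - (1 - ε))).bound
    (c := 1 / (|D| + 1)) (by positivity)
  have h3' := t.eventually h3
  obtain ⟨N, hN⟩ := Filter.eventually_atTop.1 (h1.and (h2.and h3'))
  refine ⟨max N 3, fun n hn => ?_⟩
  obtain ⟨a, b, c⟩ := hN n (le_of_max_le_left hn)
  have hn3 : 3 ≤ n := le_of_max_le_right hn
  have a : 1 ≤ Real.log n := a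
  refine ⟨hn3, a, b, ?_⟩
  rw [Real.norm_of_nonneg (by linarith), Real.norm_of_nonneg (by positivity)] at c
  rw [one_div, ← div_eq_inv_mul, le_div_iff₀ (by positivity)] at c
  have := le_abs_self D
  nlinarith

/-- In logarithms, `k log(k+3) ≤ 2D n^(1-ε) log n`; the extra `3 log n` covers `1 + (1+ε) log n`,
and `exp(-1) ≤ 3/4`. -/
lemma pow_mul_exp_le {ε δ D : ℝ} (hε : 0 < ε) (hε1 : ε < 1) (hD : 0 ≤ D) {n k : ℕ} (hn : 3 ≤ n)
    (hlog : 1 ≤ Real.log n) (hkD : (k : ℝ) ≤ D * (n : ℝ) ^ (1 - ε)) (hkn : k + 2 ≤ n)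
    (hpar : (2 * D + 3) * Real.log n ≤ (n : ℝ) ^ (δ - (1 - ε))) :
    ((k : ℝ) + 3) ^ k * Real.exp (-(n : ℝ) ^ δ) ≤ 3 / 4 * (n : ℝ) ^ (-1 - ε) := by
  have hn0 : (0 : ℝ) < n := by exact_mod_cast (by omega : 0 < n)
  have hn1 : (1 : ℝ) ≤ n := by exact_mod_cast (by omega : 1 ≤ n)
  set m : ℝ := (n : ℝ) ^ (1 - ε) with hm
  have hm1 : 1 ≤ m := Real.one_le_rpow hn1 (by linarith)
  have hk3 : (0 : ℝ) < k + 3 := by positivity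
  have hlk : Real.log (k + 3) ≤ 2 * Real.log n := by
    have h : Real.log (k + 3) ≤ Real.log ((n : ℝ) ^ 2) := by
      apply Real.log_le_log hk3
      have : (k : ℝ) + 2 ≤ n := by exact_mod_cast hkn
      have : (3 : ℝ) ≤ n := by exact_mod_cast hn
      nlinarith
    rwa [Real.log_pow, Nat.cast_ofNat] at h
  have hlk0 : 0 ≤ Real.log (k + 3) := Real.log_nonneg (by
    have : (0 : ℝ) ≤ k := by positivity
    linarith)
  have e1 : ((k : ℝ) + 3) ^ k = Real.exp (k * Real.log (k + 3)) := by
    rw [mul_comm, ← Real.rpow_def_of_pos hk3, Real.rpow_natCast]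
  have e2 : (n : ℝ) ^ (-1 - ε) = Real.exp (Real.log n * (-1 - ε)) := Real.rpow_def_of_pos hn0 _
  have e3 : Real.exp (-1) ≤ 3 / 4 := by
    have h := Real.add_one_le_exp (1 : ℝ)
    rw [Real.exp_neg, inv_le_comm₀ (Real.exp_pos _) (by norm_num)]
    norm_num at h ⊢
    linarith
  have e4 : (n : ℝ) ^ δ = m * (n : ℝ) ^ (δ - (1 - ε)) := by
    rw [hm, ← Real.rpow_add hn0]; congr 1; ring
  have e5 : k * Real.log (k + 3) ≤ D * m * (2 * Real.log n) := by gcongr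
  have e6 : m * ((2 * D + 3) * Real.log n) ≤ (n : ℝ) ^ δ := by
    rw [e4]; gcongr
  have e7 : Real.log n ≤ m * Real.log n := le_mul_of_one_le_left (by linarith) hm1
  have e8 : ε * Real.log n ≤ Real.log n := mul_le_of_le_one_left (by linarith) hε1.le
  calc ((k : ℝ) + 3) ^ k * Real.exp (-(n : ℝ) ^ δ) =
      Real.exp (k * Real.log (k + 3) - (n : ℝ) ^ δ) := by rw [e1, ← Real.exp_add]; rfl
    _ ≤ Real.exp (-1 + Real.log n * (-1 - ε)) := by
        apply Real.exp_le_exp.2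
        linarith
    _ = Real.exp (-1) * (n : ℝ) ^ (-1 - ε) := by rw [Real.exp_add, e2]
    _ ≤ _ := by gcongr

/-- A quadratic function with average zero and maximum `f 1 = 1` is at least `n ^ (-1 - ε)` with
probability at least `exp (- n ^ δ)`, for large `n`, if `1 - ε < δ`. -/
theorem exists_exp_le_card_filter {ε δ : ℝ} (hε : 0 < ε) (hε1 : ε < 1) (hδ : 1 - ε < δ) :
    ∃ N : ℕ, ∀ n : ℕ, N ≤ n → ∀ C : Fin n → Fin n → Fin n → Fin n → ℝ,
      ∑ σ, qapObjective C σ = 0 → (∀ σ, qapObjective C σ ≤ 1) → qapObjective C 1 = 1 →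
      Real.exp (-(n : ℝ) ^ δ) * n.factorial ≤
        (univ.filter fun σ => (n : ℝ) ^ (-1 - ε) ≤ qapObjective C σ).card := by
  obtain ⟨N, hN⟩ := eventually_parameters (D := 2 * 90001 + 3) hε hδ
  refine ⟨max N 20, fun n hn C h0 h1 hf1 => ?_⟩
  obtain ⟨hn3, hlog, hpow, hpar⟩ := hN n (le_of_max_le_left hn)
  have hn20 : 20 ≤ n := le_of_max_le_right hn
  have hn0 : (0 : ℝ) < n := by exact_mod_cast (by omega : 0 < n)
  have hn1 : (1 : ℝ) ≤ n := by exact_mod_cast (by omega : 1 ≤ n)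
  set m : ℝ := (n : ℝ) ^ (1 - ε) with hm
  set s : ℝ := (n : ℝ) ^ (-1 - ε) with hs
  have hm1 : 1 ≤ m := Real.one_le_rpow hn1 (by linarith)
  have hs0 : 0 < s := Real.rpow_pos_of_pos hn0 _
  have hsm : s * (n : ℝ) ^ 2 = m := by
    rw [hs, hm, ← Real.rpow_natCast, ← Real.rpow_add hn0]; congr 1; push_cast; ring
  have hmε : m * (n : ℝ) ^ ε = n := by
    rw [hm, ← Real.rpow_add hn0]; simp
  -- The final inequality reads roughly `k² ≤ 8000 m k`, so a sufficiently large multiple of `m`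
  -- contradicts it.
  set k : ℕ := ⌈90000 * m⌉₊ with hk
  have hkl : 90000 * m ≤ k := Nat.le_ceil _
  have hku : (k : ℝ) ≤ 90001 * m := by
    have := Nat.ceil_lt_add_one (by positivity : 0 ≤ 90000 * m)
    linarith
  have hmn : (2 * 90001 + 3) * m ≤ n := by
    rw [← hmε, mul_comm]; gcongr
  have hkn : k + 2 ≤ n := by
    have : (k : ℝ) + 2 ≤ n := by linarith
    exact_mod_cast this
  have hexp := pow_mul_exp_le hε hε1 (by norm_num) hn3 hlog hku hkn hpar
  have hexp1 : Real.exp (-(n : ℝ) ^ δ) ≤ s := by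
    have h2 : (1 : ℝ) ≤ ((k : ℝ) + 3) ^ k := one_le_pow₀ (by
      have : (0 : ℝ) ≤ k := by positivity
      linarith)
    have := le_mul_of_one_le_left (Real.exp_pos (-(n : ℝ) ^ δ)).le h2
    linarith
  by_contra hcon
  push Not at hcon
  obtain ⟨x₀, x₁, x₂, x₃, hform⟩ := exists_conjSum_form (by omega : 4 ≤ n) C
  have hform : HasConjForm (qapObjective C) x₀ x₁ x₂ x₃ := hform
  have hp : (0 : ℝ) < n.factorial := by positivity
  have hLs := sum_abs_le (qapObjective C) h0 h1 hs0.le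
  obtain ⟨c0, c1, c2⟩ := hform.coef_bound hn20 h0
  have hb := mul_le_mul_of_nonneg_right hexp1 hp.le
  have hL : (∑ σ, |qapObjective C σ|) / n.factorial ≤ 4 * s := by
    rw [div_le_iff₀ hp]; linarith
  have d0 : |x₀| ≤ 4000 * s := by linarith
  have d1 : |x₁| ≤ 4000 * s := by linarith
  have d2 : |x₂| ≤ 4000 * s := by linarith
  have hx2 := hform.le_coef_two (by omega) hf1 d0 d1 (by
    have h2 : s * n * n = m := by rw [← hsm]; ring
    have h3 : s * n * (2 * 90001 + 3) ≤ 1 := by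
      refine le_of_mul_le_mul_right ?_ hn0
      linarith
    have h4 : s * 1 ≤ s * n := by gcongr
    linarith)
  have hk1 : 1 ≤ k := by
    have : (1 : ℝ) ≤ k := by linarith
    exact_mod_cast this
  have hmain := fixing_inequality hform h0 h1 hs0.le d0 d1 d2 hx2 (by positivity) hk1 hkn
  have hbn : ((univ.filter fun σ => s ≤ qapObjective C σ).card : ℝ) / n.factorial ≤
      Real.exp (-(n : ℝ) ^ δ) := by
    rw [div_le_iff₀ hp]; exact hcon.le
  have hr : 4 / 3 * ((k : ℝ) + 3) ^ k *
      ((univ.filter fun σ => s ≤ qapObjective C σ).card / n.factorial) ≤ s := by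
    calc 4 / 3 * ((k : ℝ) + 3) ^ k *
        ((univ.filter fun σ => s ≤ qapObjective C σ).card / n.factorial) ≤
        4 / 3 * ((k : ℝ) + 3) ^ k * Real.exp (-(n : ℝ) ^ δ) := by gcongr
      _ = 4 / 3 * (((k : ℝ) + 3) ^ k * Real.exp (-(n : ℝ) ^ δ)) := by ring
      _ ≤ 4 / 3 * (3 / 4 * s) := by gcongr
      _ = s := by ring
  have h5 : 1 / (2 * (n : ℝ) ^ 2) * (k * (k - 1)) ≤ s * (4000 * (k + 8) + 2) := by linarith
  have h6 : (k * (k - 1) : ℝ) ≤ 2 * m * (4000 * (k + 8) + 2) := by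
    rw [one_div, inv_mul_le_iff₀ (by positivity)] at h5
    refine h5.trans (le_of_eq ?_)
    rw [← hsm]; ring
  have hk9 : (90000 : ℝ) ≤ k := by linarith
  have h7 : 2 * m * (4000 * (k + 8) + 2) ≤ 2 * (k / 90000) * (4000 * (k + 8) + 2) := by
    gcongr
    linarith
  nlinarith

/-! ### Normalization -/

lemma sum_permShift (f : Perm (Fin n) → ℝ) : ∑ σ, permShift f σ = 0 := by
  have hp : (n.factorial : ℝ) ≠ 0 := by positivity
  simp only [permShift, sum_sub_distrib, sum_const, card_univ, Fintype.card_perm, Fintype.card_fin,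
    nsmul_eq_mul, permAverage]
  field_simp
  ring

lemma permProb_setOf (p : Perm (Fin n) → Prop) [DecidablePred p] :
    permProb {σ | p σ} = ((univ.filter p).card : ℝ) / n.factorial := by
  rw [permProb, ← Set.ncard_coe_finset]
  simp

/-- It suffices to treat quadratic functions with average zero and maximum `f 1 = 1`. -/
lemma le_permProb_of_normalized (hn : 0 < n) {s p : ℝ} (hp : p ≤ 1)
    (h : ∀ C : Fin n → Fin n → Fin n → Fin n → ℝ, ∑ σ, qapObjective C σ = 0 →
      (∀ σ, qapObjective C σ ≤ 1) → qapObjective C 1 = 1 →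
      p * n.factorial ≤ (univ.filter fun σ => s ≤ qapObjective C σ).card)
    (C : Fin n → Fin n → Fin n → Fin n → ℝ) (τ : Perm (Fin n))
    (hτ : ∀ σ, permShift (qapObjective C) σ ≤ permShift (qapObjective C) τ) :
    p ≤ permProb {σ | s * permShift (qapObjective C) τ ≤ permShift (qapObjective C) σ} := by
  classical
  have hfac : (0 : ℝ) < n.factorial := by positivity
  have hsum := sum_permShift (qapObjective C)
  set f₀ := permShift (qapObjective C) with hf₀
  set M := f₀ τ with hM
  rw [permProb_setOf, le_div_iff₀ hfac]
  have hM0 : 0 ≤ M := by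
    by_contra hneg
    push Not at hneg
    have : ∑ σ, f₀ σ < ∑ _σ : Perm (Fin n), (0 : ℝ) :=
      sum_lt_sum_of_nonempty ⟨1, mem_univ _⟩ fun σ _ => (hτ σ).trans_lt hneg
    simp [hsum] at this
  rcases hM0.eq_or_lt with hM0 | hM0
  -- With maximum `0` and sum `0` the function vanishes, the event is everything, and `p ≤ 1`
  -- finishes.
  · have hz : ∀ σ, f₀ σ = 0 := by
      intro σ
      have := (sum_eq_zero_iff_of_nonpos fun σ (_ : σ ∈ univ) => (hM0 ▸ hτ σ : f₀ σ ≤ 0)).1 hsum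
      exact this σ (mem_univ σ)
    rw [filter_true_of_mem fun σ _ => by rw [hz σ, ← hM0, mul_zero], card_univ, Fintype.card_perm,
      Fintype.card_fin]
    exact mul_le_of_le_one_left hfac.le hp
  -- The mean is spread evenly over the `n²` pairs `(i, j)`, and relabelling by `τ` moves the
  -- optimum to the identity.
  · let C' : Fin n → Fin n → Fin n → Fin n → ℝ := fun i j k l =>
      (C i j (τ k) (τ l) - permAverage (qapObjective C) / (n : ℝ) ^ 2) / M
    have hC' : ∀ σ, qapObjective C' σ = f₀ (τ * σ) / M := by
      intro σ
      have hn' : (n : ℝ) ≠ 0 := by exact_mod_cast hn.ne'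
      simp only [qapObjective, C', ← sum_div, sum_sub_distrib, sum_const, card_univ,
        Fintype.card_fin, nsmul_eq_mul, hf₀, permShift, Perm.mul_apply]
      congr 2
      field_simp
    have h' := h C' ?_ ?_ ?_
    · refine h'.trans (le_of_eq ?_)
      congr 1
      refine card_bij' (fun σ _ => τ * σ) (fun σ _ => τ⁻¹ * σ) ?_ ?_ ?_ ?_
      · intro σ hσ
        simp only [mem_filter, mem_univ, true_and] at hσ ⊢
        rwa [hC', le_div_iff₀ hM0] at hσ
      · intro σ hσ
        simp only [mem_filter, mem_univ, true_and] at hσ ⊢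
        rwa [hC', le_div_iff₀ hM0, mul_inv_cancel_left]
      · intro σ _; simp
      · intro σ _; simp
    · simp only [hC', ← sum_div]
      have hshift := Equiv.sum_comp (Equiv.mulLeft τ) f₀
      simp only [Equiv.coe_mulLeft] at hshift
      rw [hshift, hsum, zero_div]
    · intro σ
      rw [hC', div_le_one hM0]
      exact hτ _
    · rw [hC', mul_one, div_self hM0.ne']

/-- Here `n^(-1-ε) ≤ n^(-2)`, so the first claim's method with `α = 1` gives density `1 / (2n²)`,
which beats `exp(-n^δ)`. -/
lemma exists_exp_le_card_filter_of_one_le {ε δ : ℝ} (hε : 1 ≤ ε) (hδ : 0 < δ) :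
    ∃ N : ℕ, ∀ n : ℕ, N ≤ n → ∀ C : Fin n → Fin n → Fin n → Fin n → ℝ,
      ∑ σ, qapObjective C σ = 0 → (∀ σ, qapObjective C σ ≤ 1) → qapObjective C 1 = 1 →
      Real.exp (-(n : ℝ) ^ δ) * n.factorial ≤
        (univ.filter fun σ => (n : ℝ) ^ (-1 - ε) ≤ qapObjective C σ).card := by
  obtain ⟨N₁, hN₁⟩ := exists_le_card_filter (α := 1) (η := 1 / 2) one_pos (by norm_num)
    (by norm_num)
  obtain ⟨N₂, hN₂⟩ := eventually_parameters (ε := 1) (δ := δ) (D := 3) one_pos (by linarith)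
  refine ⟨max N₁ N₂, fun n hn C h0 h1 hf1 => ?_⟩
  have h := hN₁ n (le_of_max_le_left hn) C h0 h1 hf1
  obtain ⟨hn3, hlog, -, hpar⟩ := hN₂ n (le_of_max_le_right hn)
  have hn0 : (0 : ℝ) < n := by exact_mod_cast (by omega : 0 < n)
  have hn1 : (1 : ℝ) ≤ n := by exact_mod_cast (by omega : 1 ≤ n)
  rw [sub_self, sub_zero] at hpar
  have hexp : Real.exp (-(n : ℝ) ^ δ) ≤ 1 / 2 * (1 / (n : ℝ) ^ 2) := by
    have e3 : Real.exp (-1) ≤ 1 / 2 := by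
      have h := Real.add_one_le_exp (1 : ℝ)
      rw [Real.exp_neg, inv_le_comm₀ (Real.exp_pos _) (by norm_num)]
      norm_num at h ⊢
      linarith
    calc Real.exp (-(n : ℝ) ^ δ) ≤ Real.exp (-1 + -(2 * Real.log n)) :=
          Real.exp_le_exp.2 (by linarith)
      _ = Real.exp (-1) * (1 / (n : ℝ) ^ 2) := by
          rw [Real.exp_add, Real.exp_neg (2 * Real.log n), two_mul, Real.exp_add,
            Real.exp_log hn0, one_div, sq]
      _ ≤ _ := by gcongr
  have hthr : (n : ℝ) ^ (-1 - ε) ≤ 1 / (n : ℝ) ^ 2 := by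
    rw [one_div, ← Real.rpow_natCast, ← Real.rpow_neg hn0.le]
    refine Real.rpow_le_rpow_of_exponent_le hn1 ?_
    push_cast
    linarith
  calc Real.exp (-(n : ℝ) ^ δ) * n.factorial ≤ 1 / 2 * (1 / (n : ℝ) ^ 2) * n.factorial := by gcongr
    _ = (1 - 1 / 2) * (n.factorial / (n : ℝ) ^ 2) := by ring
    _ ≤ _ := h
    _ ≤ _ := by
        gcongr with σ

end QAP

/-! ### Assembly of the two claims. -/

theorem corollary5p2 :
    (∃ c : ℝ, 0 < c ∧ ∀ α : ℝ, 1 < α → ∃ N : ℕ, ∀ n : ℕ, N ≤ n →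
      ∀ (C : Fin n → Fin n → Fin n → Fin n → ℝ) (τ : Equiv.Perm (Fin n)),
        (∀ σ, permShift (qapObjective C) σ ≤ permShift (qapObjective C) τ) →
        Real.exp (-(c * α * Real.log α)) * ((n : ℝ) ^ 2)⁻¹ ≤
          permProb {σ | α / (n : ℝ) ^ 2 * permShift (qapObjective C) τ ≤
            permShift (qapObjective C) σ}) ∧
    (∀ ε : ℝ, 0 < ε → ∀ δ : ℝ, 0 < δ → 1 - ε < δ → ∃ N : ℕ, ∀ n : ℕ, N ≤ n →
      ∀ (C : Fin n → Fin n → Fin n → Fin n → ℝ) (τ : Equiv.Perm (Fin n)),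
        (∀ σ, permShift (qapObjective C) σ ≤ permShift (qapObjective C) τ) →
        Real.exp (-(n : ℝ) ^ δ) ≤
          permProb {σ | (n : ℝ) ^ (-1 - ε) * permShift (qapObjective C) τ ≤
            permShift (qapObjective C) σ}) := by
  -- Any positive constant would serve, since only `exp(-c α log α) < 1` matters; `η` is its
  -- complement to `1`.
  refine ⟨⟨1, one_pos, fun α hα => ?_⟩, fun ε hε δ hδ hεδ => ?_⟩
  · have hlt : Real.exp (-(1 * α * Real.log α)) < 1 := by
      rw [Real.exp_lt_one_iff, neg_lt_zero]
      have := Real.log_pos hα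
      positivity
    obtain ⟨N, hN⟩ := QAP.exists_le_card_filter (α := α)
      (η := 1 - Real.exp (-(1 * α * Real.log α))) (by linarith) (by linarith)
      (by linarith [Real.exp_pos (-(1 * α * Real.log α))])
    refine ⟨max N 1, fun n hn C τ hτ => ?_⟩
    have hn1 : 1 ≤ n := le_of_max_le_right hn
    have hn1' : (1 : ℝ) ≤ n := by exact_mod_cast hn1
    refine QAP.le_permProb_of_normalized hn1 ?_ (fun C' h0 h1 hf1 => ?_) C τ hτ
    · exact mul_le_one₀ hlt.le (by positivity) (inv_le_one_of_one_le₀ (one_le_pow₀ hn1'))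
    · refine le_trans (le_of_eq ?_) (hN n (le_of_max_le_left hn) C' h0 h1 hf1)
      ring
  · obtain ⟨N, hN⟩ : ∃ N : ℕ, ∀ n : ℕ, N ≤ n → ∀ C : Fin n → Fin n → Fin n → Fin n → ℝ,
        ∑ σ, qapObjective C σ = 0 → (∀ σ, qapObjective C σ ≤ 1) → qapObjective C 1 = 1 →
        Real.exp (-(n : ℝ) ^ δ) * n.factorial ≤
          (Finset.univ.filter fun σ => (n : ℝ) ^ (-1 - ε) ≤ qapObjective C σ).card := by
      rcases lt_or_ge ε 1 with h | h
      · exact QAP.exists_exp_le_card_filter hε h hεδ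
      · exact QAP.exists_exp_le_card_filter_of_one_le h hδ
    refine ⟨max N 1, fun n hn C τ hτ => ?_⟩
    refine QAP.le_permProb_of_normalized (le_of_max_le_right hn) ?_
      (hN n (le_of_max_le_left hn)) C τ hτ
    rw [Real.exp_le_one_iff, neg_nonpos]
    positivity
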